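/- For $\lambda\in\mathbb R^n$ let $\sigma_k(\lambda)=\sum_{1\le i_1<\dots<i_k\le n}\lambda_{i_1}\cdots\lambda_{i_k}$ and $\Gamma_k=\{\lambda\in\mathbb R^n:\sigma_j(\lambda)>0,\ j=1,\dots,k\}$. Write $\lambda(D^2u)$ for the eigenvalues of the Hessian of $u$ and $\sigma_k(D^2u)=\sigma_k(\lambda(D^2u))$. A function $u$ is $k$-admissible in $\Omega$ if $\lambda(D^2u(x))\in\Gamma_k$ for all $x\in\Omega$. Let $1\le k\le n$, and let $\Omega\subset\mathbb R^n$ be a nonempty bounded uniformly convex domain of class $C^4$: $\Omega$ is open and convex, and there is a defining function $\rho\in C^4(\mathbb R^n)$ with $\Omega=\{\rho<0\}$, $\partial\Omega=\{\rho=0\}$ and $|\nabla\rho|\ge 1$ on $\partial\Omega$; and all principal curvatures of $\partial\Omega$ with respect to the inner normal, i.e. the values $D^2\rho(x)(\tau,\tau)/|\nabla\rho(x)|$ for $x\in\partial\Omega$ and unit $\tau\perp\nabla\rho(x)$, are at least a constant $\kappa>0$. The $C^4$ norm of $\partial\Omega$ is said to be at most $L$ if $\rho$ can be chosen with all its derivatives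 of order $\le 4$ bounded by $L$ on $\overline\Omega$. Let $\nu=\nabla\rho/|\nabla\rho|$ be the outer unit normal of $\partial\Omega$. Let $f\in C^2(\overline\Omega\times\mathbb R)$ be positive, and let $\varphi\in C^3(\overline\Omega\times\mathbb R)$ be such that $z\mapsto\varphi(x,z)$ is non-increasing for every $x\in\overline\Omega$. Let $u\in C^4(\Omega)\cap C^3(\overline\Omega)$ be a $k$-admissible solution of $$\sigma_k(D^2u)=f(x,u)\ \text{ in }\Omega,\qquad u_\nu=\varphi(x,u)\ \text{ on }\partial\Omega,$$ and put $M_0=\sup_\Omega|u|$. Then $$\sup_{\partial\Omega}|u_{\nu\nu}|\le C,\qquad u_{\nu\nu}=D^2u(\nu,\nu),$$ where $C$ depends only on $n$, $k$, $\kappa$, a positive lower bound for $f$ on $\overline\Omega\times[-M_0,M_0]$, and upper bounds for $\|u\|_{C^1(\overline\Omega)}$, $\|f\|_{C^2(\overline\Omega\times[-M_0,M_0])}$, $\|\varphi\|_{C^3(\overline\Omega\times[-M_0,M_0])}$ and the $C^4$ norm of $\partial\Omega$. -/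

import Mathlib

open Set

noncomputable section

namespace HessianNeumann

/-- The `k`-th elementary symmetric function of `n` real numbers. -/
def sigma {n : ℕ} (k : ℕ) (l : Fin n → ℝ) : ℝ :=
  ∑ s ∈ Finset.powersetCard k (Finset.univ : Finset (Fin n)), ∏ i ∈ s, l i

/-- The cone `Γ_k` of all vectors whose first `k` elementary symmetric functions are positive. -/
def gammaCone (n k : ℕ) : Set (Fin n → ℝ) :=
  {l | ∀ j : ℕ, 1 ≤ j → j ≤ k → 0 < sigma j l}

/-- The Hessian matrix `D²u(x)` of second partial derivatives. -/
def hessian {n : ℕ} (u : EuclideanSpace ℝ (Fin n) → ℝ) (x : EuclideanSpace ℝ (Fin n)) :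
    Matrix (Fin n) (Fin n) ℝ :=
  Matrix.of fun i j =>
    iteratedFDeriv ℝ 2 u x ![EuclideanSpace.single i (1 : ℝ), EuclideanSpace.single j (1 : ℝ)]

open Classical in
/-- The eigenvalues `λ(D²u(x))`, with multiplicity. (The Hessian matrix is symmetric wherever `u`
is twice continuously differentiable, which is the only case of interest.) -/
def hessianEigenvalues {n : ℕ} (u : EuclideanSpace ℝ (Fin n) → ℝ)
    (x : EuclideanSpace ℝ (Fin n)) : Fin n → ℝ :=
  if h : (hessian u x).IsHermitian then h.eigenvalues else 0

/-- `u` is `k`-admissible in `Ω`: the eigenvalues of its Hessian lie in `Γ_k` at every point. -/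
def IsAdmissible {n : ℕ} (k : ℕ) (Ω : Set (EuclideanSpace ℝ (Fin n)))
    (u : EuclideanSpace ℝ (Fin n) → ℝ) : Prop :=
  ∀ x ∈ Ω, hessianEigenvalues u x ∈ gammaCone n k

/-- `Ω` has boundary of class `C⁴` with `C⁴` norm controlled by `L`, as witnessed by the defining
function `ρ`: `ρ` is of class `C⁴`, it is negative exactly on `Ω` and zero exactly on `∂Ω`,
its gradient has length at least one on `∂Ω`, and its derivatives of order at most four are
bounded by `L` on the closure of `Ω`. -/
structure IsC4DefiningFunction {n : ℕ} (Ω : Set (EuclideanSpace ℝ (Fin n)))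
    (ρ : EuclideanSpace ℝ (Fin n) → ℝ) (L : ℝ) : Prop where
  contDiff : ContDiff ℝ 4 ρ
  domain_eq : Ω = {x | ρ x < 0}
  frontier_eq : frontier Ω = {x | ρ x = 0}
  one_le_norm_gradient : ∀ x ∈ frontier Ω, 1 ≤ ‖gradient ρ x‖
  norm_le : ∀ j : ℕ, j ≤ 4 → ∀ x ∈ closure Ω, ‖iteratedFDeriv ℝ j ρ x‖ ≤ L

/-- The outer unit normal `ν` of the domain `{ρ < 0}` at a boundary point, `ρ` being a defining
function. -/
def outerNormal {n : ℕ} (ρ : EuclideanSpace ℝ (Fin n) → ℝ) (x : EuclideanSpace ℝ (Fin n)) :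
    EuclideanSpace ℝ (Fin n) :=
  ‖gradient ρ x‖⁻¹ • gradient ρ x

/-- All principal curvatures of `∂Ω` (with respect to the inner normal) are at least `κ`: the
second fundamental form of the level set `{ρ = 0}` is `D²ρ(τ,τ) / |∇ρ|` on tangent vectors `τ`. -/
def PrincipalCurvaturesGE {n : ℕ} (Ω : Set (EuclideanSpace ℝ (Fin n)))
    (ρ : EuclideanSpace ℝ (Fin n) → ℝ) (κ : ℝ) : Prop :=
  ∀ x ∈ frontier Ω, ∀ τ : EuclideanSpace ℝ (Fin n), inner ℝ τ (gradient ρ x) = 0 →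
    κ * ‖τ‖ ^ 2 ≤ iteratedFDeriv ℝ 2 ρ x ![τ, τ] / ‖gradient ρ x‖

/-- The derivatives of `g` of order at most `m`, taken within `S`, are bounded by `L` at all points
of the set `T ⊆ S`. -/
def CNormLE {E : Type*} [NormedAddCommGroup E] [NormedSpace ℝ E] (m : ℕ) (g : E → ℝ)
    (S T : Set E) (L : ℝ) : Prop :=
  ∀ j : ℕ, j ≤ m → ∀ x ∈ T, ‖iteratedFDerivWithin ℝ j g S x‖ ≤ L

/-- The number `M₀ = sup_Ω |u|`. -/
def supAbs {n : ℕ} (Ω : Set (EuclideanSpace ℝ (Fin n)))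
    (u : EuclideanSpace ℝ (Fin n) → ℝ) : ℝ :=
  sSup ((fun x => |u x|) '' Ω)

/-- The set `closure Ω × [-M₀, M₀]` with `M₀ = sup_Ω |u|`. -/
def valueRange {n : ℕ} (Ω : Set (EuclideanSpace ℝ (Fin n)))
    (u : EuclideanSpace ℝ (Fin n) → ℝ) : Set (EuclideanSpace ℝ (Fin n) × ℝ) :=
  closure Ω ×ˢ Icc (-supAbs Ω u) (supAbs Ω u)

end HessianNeumann

end

/-! Let M_ν be the maximum of |u_νν| over ∂Ω. Two estimates are proved whose right sides contain M_ν
itself: all second derivatives of u are at most C(1 + M_ν) on the closure of Ω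
(`exists_hessian_bound`), and |u_νν| ≤ A + M_ν/2 on ∂Ω (`exists_double_normal_absorption`). The
constants depend on the data only, so the second estimate at a maximum point gives M_ν ≤ 2A.

Algebra. Write F_i for σ_{k-1} of the eigenvalues with λ_i removed. Newton's inequality and the
Marcus–Lopes argument show that Γ_k is convex and log σ_k is concave on it. By Birkhoff's theorem
the diagonal of D²u(y) in the eigenframe of D²u(x) is an average of permutations of the eigenvalues
at y, so the tangent plane inequality for log σ_k at x applies to it. This gives the equation
differentiated once and twice (`linearized_equation`) without any derivative of an eigenvalue.

First estimate. The Lions–Trudinger–Urbas function is u_ξξ, minus twice the mixed tangential-normal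
term as the boundary condition prescribes it, plus K₁|x - y₀|²/2 + K₂|Du|²/2. It is maximized over x
and over unit ξ. At an interior maximum Σ F_i λ_i² dominates everything else. On the boundary the
subtraction decouples normal from tangential directions, so either the decoupled form is at most M_ν
or ξ is a tangential principal direction. In the latter case, differentiating u_ν = φ(x,u) twice
along ∂Ω and using φ_z ≤ 0 gives u_ξξν ≤ -2κ u_ξξ + C(1 + M_ν), while maximality gives u_ξξν ≥ -C(1
+ M_ν).

Second estimate. The defect w = ⟨Du, ν⟩ - φ(x,u), with ν extended inside, vanishes on ∂Ω and has
normal derivative u_νν up to bounded terms. Near p ∈ ∂Ω let b be a strictly convex barrier with b ≤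
0, b(p) = 0, Db(p) = ν(p); set B = A + M_ν/2, σ = ±1, and P = (1 - βb)σw - Bb. If P ≥ 0 near p then
σu_νν(p) ≤ B + C, and only an interior minimum of P could prevent this. At such a point DP = 0
produces an eigenvector e_j that is far from tangential and has σλ_j ≥ B/8. The operator Σ F_i
∂_i∂_i applied to w leaves 2Σ F_i λ_i ⟨e_i, Dν e_i⟩, a term of the same order as B. Where σλ_i < 0
and e_i is nearly tangential, convexity of Ω gives it a good sign; where σλ_i < 0 and e_i is not,
the gradient term βB Σ F_i b_i² created by the weight absorbs it; where σλ_i > 0,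
`exists_esym_erase_mul_le` bounds it by F_j σλ_j, and F_j is at most a multiple of Σ F_i b_i². A
small multiple of B Σ F_i remains, which the convexity of b beats. -/

namespace HessianNeumann

open Filter Topology

set_option maxSynthPendingDepth 6

/-! ### Elementary symmetric functions over a finite index set -/

section ESym

set_option linter.unusedSectionVars false

variable {ι : Type*} [DecidableEq ι]

/-- The `k`-th elementary symmetric function of the numbers `l i`, `i ∈ s`. -/
def esym (k : ℕ) (s : Finset ι) (l : ι → ℝ) : ℝ := ∑ t ∈ s.powersetCard k, ∏ i ∈ t, l i

@[simp] lemma esym_zero (s : Finset ι) (l : ι → ℝ) : esym 0 s l = 1 := by simp [esym]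

@[simp] lemma esym_succ_empty (k : ℕ) (l : ι → ℝ) : esym (k + 1) (∅ : Finset ι) l = 0 := by
  rw [esym, Finset.powersetCard_eq_empty.2 (by simp), Finset.sum_empty]

lemma esym_insert (k : ℕ) {s : Finset ι} {a : ι} (h : a ∉ s) (l : ι → ℝ) :
    esym (k + 1) (insert a s) l = esym (k + 1) s l + l a * esym k s l := by
  unfold esym
  rw [Finset.powersetCard_succ_insert h, Finset.sum_union, Finset.sum_image, Finset.mul_sum]
  · congr 1
    refine Finset.sum_congr rfl fun t ht => ?_
    rw [Finset.prod_insert fun hat => h ((Finset.mem_powersetCard.1 ht).1 hat)]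
  · intro t ht t' ht' hEq
    have h1 : a ∉ t := fun hat => h ((Finset.mem_powersetCard.1 ht).1 hat)
    have h2 : a ∉ t' := fun hat => h ((Finset.mem_powersetCard.1 ht').1 hat)
    rw [← Finset.erase_insert h1, ← Finset.erase_insert h2, hEq]
  · rw [Finset.disjoint_left]
    intro t ht ht'
    obtain ⟨t', -, rfl⟩ := Finset.mem_image.1 ht'
    exact h ((Finset.mem_powersetCard.1 ht).1 (Finset.mem_insert_self a t'))

lemma esym_erase (k : ℕ) {s : Finset ι} {a : ι} (h : a ∈ s) (l : ι → ℝ) :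
    esym (k + 1) s l = esym (k + 1) (s.erase a) l + l a * esym k (s.erase a) l := by
  conv_lhs => rw [← Finset.insert_erase h]
  exact esym_insert k (Finset.notMem_erase a s) l

lemma esym_one (s : Finset ι) (l : ι → ℝ) : esym 1 s l = ∑ i ∈ s, l i := by
  simp [esym, Finset.powersetCard_one]

/-- Double counting: each product over a (k+1)-set arises once from each of its elements. This is
Euler's identity for the homogeneous σ_{k+1}. -/
lemma sum_mul_esym_erase (k : ℕ) (s : Finset ι) (l : ι → ℝ) :
    ∑ i ∈ s, l i * esym k (s.erase i) l = (k + 1) * esym (k + 1) s l := by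
  induction s using Finset.induction_on generalizing k with
  | empty => simp
  | insert a s ha ih =>
    have hne : ∀ i ∈ s, i ≠ a := fun i hi h => ha (h ▸ hi)
    rw [Finset.sum_insert ha, Finset.erase_insert ha, esym_insert k ha]
    have herase : ∀ i ∈ s, (insert a s).erase i = insert a (s.erase i) := fun i hi =>
      Finset.erase_insert_of_ne (hne i hi).symm
    cases k with
    | zero => simp [esym_one]; ring
    | succ k =>
      have : ∑ i ∈ s, l i * esym (k + 1) ((insert a s).erase i) l =
          ∑ i ∈ s, (l i * esym (k + 1) (s.erase i) l + l a * (l i * esym k (s.erase i) l)) := by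
        refine Finset.sum_congr rfl fun i hi => ?_
        rw [herase i hi, esym_insert k fun h => ha (Finset.mem_of_mem_erase h)]
        ring
      rw [this, Finset.sum_add_distrib, ← Finset.mul_sum, ih, ih]
      push_cast
      ring

lemma sum_esym_erase (k : ℕ) (s : Finset ι) (l : ι → ℝ) :
    ∑ i ∈ s, esym k (s.erase i) l = (s.card - k) * esym k s l := by
  cases k with
  | zero => simp
  | succ k =>
    have : ∑ i ∈ s, esym (k + 1) (s.erase i) l =
        ∑ i ∈ s, (esym (k + 1) s l - l i * esym k (s.erase i) l) :=
      Finset.sum_congr rfl fun i hi => by rw [esym_erase k hi]; ring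
    rw [this, Finset.sum_sub_distrib, sum_mul_esym_erase, Finset.sum_const, nsmul_eq_mul]
    push_cast
    ring

lemma sum_sq_mul_esym_erase (k : ℕ) (s : Finset ι) (l : ι → ℝ) :
    ∑ i ∈ s, l i ^ 2 * esym k (s.erase i) l
      = esym 1 s l * esym (k + 1) s l - (k + 2) * esym (k + 2) s l := by
  have h := sum_mul_esym_erase (k + 1) s l
  have : ∑ i ∈ s, l i * esym (k + 1) (s.erase i) l =
      ∑ i ∈ s, (l i * esym (k + 1) s l - l i ^ 2 * esym k (s.erase i) l) :=
    Finset.sum_congr rfl fun i hi => by rw [esym_erase k hi]; ring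
  rw [this, Finset.sum_sub_distrib, ← Finset.sum_mul] at h
  rw [esym_one]
  push_cast at h
  linarith

/-- Newton's inequality, with a constant that is not sharp. -/
theorem newton_inequality (k : ℕ) (s : Finset ι) (l : ι → ℝ) :
    (k + 2) * (esym (k + 2) s l * esym k s l) ≤ (k + 1) * esym (k + 1) s l ^ 2 := by
  induction hn : s.card generalizing k s with
  | zero =>
    rw [Finset.card_eq_zero] at hn
    subst hn
    simp
  | succ n ih =>
    -- The two sides differ by Σ l_i² D_i. For k = 0 each D_i is -1; otherwise D_i is the Newton
    -- expression one order lower in the remaining variables, nonpositive by induction on the number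
    -- of variables.
    obtain ⟨D, hD, key⟩ : ∃ D : ι → ℝ, (∀ i ∈ s, D i ≤ 0) ∧
        (k + 2) * (esym (k + 2) s l * esym k s l) =
          (k + 1) * esym (k + 1) s l ^ 2 + ∑ i ∈ s, l i ^ 2 * D i := by
      cases k with
      | zero =>
        refine ⟨fun _ => -1, fun _ _ => by norm_num, ?_⟩
        have h := sum_sq_mul_esym_erase 0 s l
        simp at h ⊢
        linarith
      | succ j =>
        refine ⟨fun i => esym (j + 2) (s.erase i) l * esym j (s.erase i) l
            - esym (j + 1) (s.erase i) l ^ 2, fun i hi => ?_, ?_⟩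
        · have := ih j (s.erase i) (by rw [Finset.card_erase_of_mem hi, hn]; rfl)
          rw [sub_nonpos]
          have hj : (0 : ℝ) ≤ j := j.cast_nonneg
          by_contra! hlt
          nlinarith [sq_nonneg (esym (j + 1) (s.erase i) l)]
        · have h1 := sum_sq_mul_esym_erase (j + 1) s l
          have h2 := sum_sq_mul_esym_erase j s l
          have h3 : ∑ i ∈ s, l i ^ 2 * (esym (j + 2) (s.erase i) l * esym j (s.erase i) l
              - esym (j + 1) (s.erase i) l ^ 2) =
              esym (j + 2) s l * ∑ i ∈ s, l i ^ 2 * esym j (s.erase i) l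
              - esym (j + 1) s l * ∑ i ∈ s, l i ^ 2 * esym (j + 1) (s.erase i) l := by
            rw [Finset.mul_sum, Finset.mul_sum, ← Finset.sum_sub_distrib]
            refine Finset.sum_congr rfl fun i hi => ?_
            rw [esym_erase (j + 1) hi, esym_erase j hi]
            ring
          rw [h3, h1, h2]
          push_cast
          ring
    rw [key]
    linarith [Finset.sum_nonpos fun i hi => mul_nonpos_of_nonneg_of_nonpos (sq_nonneg (l i))
      (hD i hi)]

lemma esym_mul_esym_le_sq (k : ℕ) (s : Finset ι) (l : ι → ℝ) :
    esym (k + 2) s l * esym k s l ≤ esym (k + 1) s l ^ 2 := by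
  have := newton_inequality k s l
  have hj : (0 : ℝ) ≤ k := k.cast_nonneg
  by_contra! hlt
  nlinarith [sq_nonneg (esym (k + 1) s l)]

/-- The Gårding cone over a finite index set. -/
def IsGarding (k : ℕ) (s : Finset ι) (l : ι → ℝ) : Prop := ∀ j ≤ k, 0 < esym j s l

lemma IsGarding.mono {k j : ℕ} {s : Finset ι} {l : ι → ℝ} (h : IsGarding k s l) (hj : j ≤ k) :
    IsGarding j s l := fun i hi => h i (hi.trans hj)

/-- Write a, b, c for σ_{k+1}, σ_k, σ_{k+2} without the variable l_i. If a ≤ 0, then a + l_i b > 0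
forces l_i > 0, and c + l_i a > 0 gives cb > l_i b(-a) ≥ a², against Newton's inequality. -/
lemma IsGarding.erase {k : ℕ} {s : Finset ι} {l : ι → ℝ} (h : IsGarding (k + 1) s l) {i : ι}
    (hi : i ∈ s) : IsGarding k (s.erase i) l := by
  induction k with
  | zero =>
    intro j hj
    rw [Nat.le_zero.1 hj]
    simp
  | succ k ih =>
    have ihk := ih (h.mono (Nat.le_succ _))
    intro j hj
    rcases hj.lt_or_eq with hlt | rfl
    · exact ihk j (Nat.lt_succ_iff.1 hlt)
    · have h0 := ihk k le_rfl
      have h1 := h (k + 1) (Nat.le_succ _)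
      have h2 := h (k + 1 + 1) le_rfl
      rw [esym_erase k hi] at h1
      rw [esym_erase (k + 1) hi] at h2
      have hN := esym_mul_esym_le_sq k (s.erase i) l
      by_contra! hneg
      set a := esym (k + 1) (s.erase i) l
      set b := esym k (s.erase i) l
      set c := esym (k + 2) (s.erase i) l
      have hpos : 0 < l i := by
        by_contra! hl
        nlinarith
      have h3 : l i * (-a) * b < c * b := by
        have : l i * (-a) < c := by
          have : c = esym (k + 1 + 1) (s.erase i) l := rfl
          linarith
        exact mul_lt_mul_of_pos_right this h0
      nlinarith [mul_nonneg (neg_nonneg.2 hneg) h1.le]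

lemma esym_smul (k : ℕ) (s : Finset ι) (c : ℝ) (l : ι → ℝ) :
    esym k s (c • l) = c ^ k * esym k s l := by
  unfold esym
  rw [Finset.mul_sum]
  refine Finset.sum_congr rfl fun t ht => ?_
  simp only [Pi.smul_apply, smul_eq_mul, Finset.prod_mul_distrib, Finset.prod_const,
    (Finset.mem_powersetCard.1 ht).2]

lemma IsGarding.smul {k : ℕ} {s : Finset ι} {l : ι → ℝ} (h : IsGarding k s l) {c : ℝ}
    (hc : 0 < c) : IsGarding k s (c • l) := fun j hj => by
  rw [esym_smul]
  exact mul_pos (pow_pos hc j) (h j hj)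

/-- A form of Cauchy–Schwarz, making the fractions in `esym_quotient_eq` subadditive. -/
lemma sq_div_add_le {x y a b : ℝ} (ha : 0 < a) (hb : 0 < b) :
    (x + y) ^ 2 / (a + b) ≤ x ^ 2 / a + y ^ 2 / b := by
  rw [div_add_div _ _ ha.ne' hb.ne', div_le_div_iff₀ (by positivity) (by positivity)]
  nlinarith [sq_nonneg (x * b - y * a), mul_pos ha hb]

/-- The denominator equals σ_{k+1}(l) / σ_k(l without l_i), so this is `sum_sq_mul_esym_erase`
divided by σ_{k+1}. Only quotients of lower order, in one variable less, occur on the right; this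
opens superadditivity to induction. -/
lemma esym_quotient_eq {k : ℕ} {s : Finset ι} {l : ι → ℝ} (h : IsGarding (k + 1) s l) :
    (k + 2) * (esym (k + 2) s l / esym (k + 1) s l) =
      ∑ i ∈ s, (l i - l i ^ 2 /
        (l i + esym (k + 1) (s.erase i) l / esym k (s.erase i) l)) := by
  have h0 := h (k + 1) le_rfl
  have h1 := sum_sq_mul_esym_erase k s l
  have : ∀ i ∈ s, l i ^ 2 / (l i + esym (k + 1) (s.erase i) l / esym k (s.erase i) l) =
      l i ^ 2 * esym k (s.erase i) l / esym (k + 1) s l := by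
    intro i hi
    have h2 := h.erase hi k le_rfl
    rw [esym_erase k hi] at h0 ⊢
    rw [div_eq_div_iff]
    · field_simp
      ring
    · have : l i + esym (k + 1) (s.erase i) l / esym k (s.erase i) l =
        (esym (k + 1) (s.erase i) l + l i * esym k (s.erase i) l) / esym k (s.erase i) l := by
        field_simp
        ring
      rw [this]
      positivity
    · exact h0.ne'
  rw [Finset.sum_sub_distrib, Finset.sum_congr rfl this, ← Finset.sum_div, h1, esym_one]
  field_simp
  ring

/-- Marcus and Lopes: the cone is convex and the quotients `σ_{k+1}/σ_k` are superadditive. -/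
theorem IsGarding.add_and_quotient (k : ℕ) (s : Finset ι) {l m : ι → ℝ} (hl : IsGarding k s l)
    (hm : IsGarding k s m) :
    IsGarding k s (l + m) ∧ esym (k + 1) s l / esym k s l + esym (k + 1) s m / esym k s m ≤
      esym (k + 1) s (l + m) / esym k s (l + m) := by
  induction k generalizing s with
  | zero =>
    refine ⟨fun j hj => ?_, ?_⟩
    · rw [Nat.le_zero.1 hj]
      simp
    · simp [esym_one, Finset.sum_add_distrib]
  | succ k ih =>
    obtain ⟨h1, h2⟩ := ih s (hl.mono (Nat.le_succ _)) (hm.mono (Nat.le_succ _))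
    have hadd : IsGarding (k + 1) s (l + m) := by
      intro j hj
      rcases hj.lt_or_eq with hlt | rfl
      · exact h1 j (Nat.lt_succ_iff.1 hlt)
      -- Membership of the sum at the new level follows from superadditivity of the quotient one
      -- level below.
      · have hq1 := div_pos (hl (k + 1) le_rfl) (hl k (Nat.le_succ _))
        have hq2 := div_pos (hm (k + 1) le_rfl) (hm k (Nat.le_succ _))
        have := (add_pos hq1 hq2).trans_le h2
        exact (div_pos_iff_of_pos_right (h1 k le_rfl)).1 this
    refine ⟨hadd, ?_⟩
    have hk : (0 : ℝ) < k + 2 := by positivity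
    refine le_of_mul_le_mul_left ?_ hk
    rw [mul_add, show k + 1 + 1 = k + 2 from rfl, esym_quotient_eq hl, esym_quotient_eq hm,
      esym_quotient_eq hadd, ← Finset.sum_add_distrib]
    -- Termwise: the quotient in the denominator is superadditive by induction with `i` removed, and
    -- x²/a is decreasing in a and jointly subadditive.
    refine Finset.sum_le_sum fun i hi => ?_
    have pos : ∀ {v : ι → ℝ}, IsGarding (k + 1) s v →
        0 < v i + esym (k + 1) (s.erase i) v / esym k (s.erase i) v := by
      intro v hv
      have h3 := hv.erase hi k le_rfl
      have h4 := hv (k + 1) le_rfl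
      rw [esym_erase k hi] at h4
      have : v i + esym (k + 1) (s.erase i) v / esym k (s.erase i) v =
        (esym (k + 1) (s.erase i) v + v i * esym k (s.erase i) v) / esym k (s.erase i) v := by
        field_simp
        ring
      rw [this]
      positivity
    have h5 := (ih (s.erase i) (hl.erase hi) (hm.erase hi)).2
    have h6 := sq_div_add_le (x := l i) (y := m i) (pos hl) (pos hm)
    have h7 : (l i + m i) ^ 2 / ((l + m) i + esym (k + 1) (s.erase i) (l + m) /
        esym k (s.erase i) (l + m)) ≤ (l i + m i) ^ 2 /
        ((l i + esym (k + 1) (s.erase i) l / esym k (s.erase i) l) +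
          (m i + esym (k + 1) (s.erase i) m / esym k (s.erase i) m)) := by
      refine div_le_div_of_nonneg_left (sq_nonneg _) (add_pos (pos hl) (pos hm)) ?_
      simp only [Pi.add_apply]
      linarith
    simp only [Pi.add_apply] at h7 ⊢
    linarith

lemma convex_setOf_isGarding (k : ℕ) (s : Finset ι) : Convex ℝ {l | IsGarding k s l} := by
  rw [convex_iff_forall_pos]
  intro l hl m hm a b ha hb _
  exact (IsGarding.add_and_quotient k s (IsGarding.smul hl ha) (IsGarding.smul hm hb)).1

/-- Telescoping: log σ_{k+1} = log(σ_{k+1}/σ_k) + log σ_k. The quotient is superadditive and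
homogeneous of degree one, hence concave, and log is increasing and concave. -/
theorem concaveOn_log_esym (k : ℕ) (s : Finset ι) :
    ConcaveOn ℝ {l | IsGarding k s l} fun l => Real.log (esym k s l) := by
  induction k with
  | zero => simpa using concaveOn_const (𝕜 := ℝ) (0 : ℝ) (convex_setOf_isGarding 0 s)
  | succ k ih =>
    rw [concaveOn_iff_forall_pos]
    refine ⟨convex_setOf_isGarding _ s, fun l hl m hm a b ha hb hab => ?_⟩
    have hl' : IsGarding k s l := IsGarding.mono hl (Nat.le_succ _)
    have hm' : IsGarding k s m := IsGarding.mono hm (Nat.le_succ _)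
    have h1 := ih.2 (x := l) hl' (y := m) hm' ha.le hb.le hab
    have hq := (IsGarding.add_and_quotient k s (hl'.smul ha) (hm'.smul hb)).2
    have hc : IsGarding (k + 1) s (a • l + b • m) :=
      convex_setOf_isGarding _ s hl hm ha.le hb.le hab
    have hscale : ∀ {c : ℝ} {v : ι → ℝ}, 0 < c → esym (k + 1) s (c • v) / esym k s (c • v) =
        c * (esym (k + 1) s v / esym k s v) := by
      intro c v hcpos
      rw [esym_smul, esym_smul, pow_succ, mul_assoc, mul_div_mul_left _ _ (pow_pos hcpos k).ne',
        mul_div_assoc]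
    rw [hscale ha, hscale hb] at hq
    have hqpos : ∀ {v : ι → ℝ}, IsGarding (k + 1) s v → 0 < esym (k + 1) s v / esym k s v :=
      fun hv => div_pos (hv _ le_rfl) (hv _ (Nat.le_succ _))
    have h2 := strictConcaveOn_log_Ioi.concaveOn.2 (x := esym (k + 1) s l / esym k s l)
      (hqpos hl) (y := esym (k + 1) s m / esym k s m) (hqpos hm) ha.le hb.le hab
    simp only [smul_eq_mul] at h1 h2 ⊢
    have h3 := Real.log_le_log (add_pos (mul_pos ha (hqpos hl)) (mul_pos hb (hqpos hm))) hq
    have hlog : ∀ {v : ι → ℝ}, IsGarding (k + 1) s v →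
        Real.log (esym (k + 1) s v / esym k s v) =
          Real.log (esym (k + 1) s v) - Real.log (esym k s v) :=
      fun hv => Real.log_div (hv _ le_rfl).ne' (hv _ (Nat.le_succ _)).ne'
    rw [hlog hc] at h3
    rw [hlog hl, hlog hm] at h2
    linarith

lemma hasDerivAt_esym (k : ℕ) (s : Finset ι) (l d : ι → ℝ) :
    HasDerivAt (fun t : ℝ => esym (k + 1) s (l + t • d))
      (∑ i ∈ s, d i * esym k (s.erase i) l) 0 := by
  induction s using Finset.induction_on generalizing k with
  | empty => simpa using hasDerivAt_const (0 : ℝ) (0 : ℝ)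
  | insert a s ha ih =>
    have hne : ∀ i ∈ s, i ≠ a := fun i hi h => ha (h ▸ hi)
    have hlin : HasDerivAt (fun t : ℝ => l a + t * d a) (d a) 0 := by
      simpa using ((hasDerivAt_id (0 : ℝ)).mul_const (d a)).const_add (l a)
    simp only [esym_insert _ ha, Pi.add_apply, Pi.smul_apply, smul_eq_mul]
    rw [Finset.sum_insert ha, Finset.erase_insert ha]
    have hsum : ∑ i ∈ s, d i * esym k ((insert a s).erase i) l = ∑ i ∈ s, d i *
        esym k (insert a (s.erase i)) l := Finset.sum_congr rfl fun i hi => by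
      rw [Finset.erase_insert_of_ne (hne i hi).symm]
    cases k with
    | zero =>
      refine (((ih 0).add hlin).congr_deriv ?_).congr_of_eventuallyEq
        (Filter.Eventually.of_forall fun t => ?_)
      · simp [esym_zero, add_comm]
      · simp [esym_zero]
    | succ k =>
      refine ((ih (k + 1)).add (hlin.mul (ih k))).congr_deriv ?_
      have hsum2 : ∑ i ∈ s, d i * esym (k + 1) (insert a (s.erase i)) l =
          ∑ i ∈ s, d i * esym (k + 1) (s.erase i) l + l a * ∑ i ∈ s, d i * esym k (s.erase i) l := by
        rw [Finset.mul_sum, ← Finset.sum_add_distrib]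
        refine Finset.sum_congr rfl fun i hi => ?_
        rw [esym_insert k fun h => ha (Finset.mem_of_mem_erase h)]
        ring
      rw [hsum, hsum2]
      simp only [zero_mul, add_zero, zero_smul]
      ring

/-- The supporting hyperplane inequality for the concave function `log σ_{k+1}`. -/
theorem log_esym_le (k : ℕ) (s : Finset ι) {l m : ι → ℝ} (hl : IsGarding (k + 1) s l)
    (hm : IsGarding (k + 1) s m) :
    Real.log (esym (k + 1) s m) ≤ Real.log (esym (k + 1) s l) +
      (∑ i ∈ s, esym k (s.erase i) l * (m i - l i)) / esym (k + 1) s l := by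
  have hpos := hl (k + 1) le_rfl
  have hd := (hasDerivAt_esym k s l (m - l)).log (by simpa using hpos.ne')
  simp only [zero_smul, add_zero] at hd
  have hslope := (hasDerivAt_iff_tendsto_slope.1 hd).mono_left
    (nhdsWithin_mono (0 : ℝ) (show Ioi (0 : ℝ) ⊆ {0}ᶜ from fun x hx => ne_of_gt hx))
  have hsum : ∑ i ∈ s, esym k (s.erase i) l * (m i - l i) =
      ∑ i ∈ s, (m - l) i * esym k (s.erase i) l :=
    Finset.sum_congr rfl fun i _ => by rw [mul_comm]; rfl
  rw [hsum, ← sub_le_iff_le_add']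
  refine ge_of_tendsto hslope ?_
  filter_upwards [Ioo_mem_nhdsGT (zero_lt_one' ℝ)] with t ht
  have h := (concaveOn_log_esym (k + 1) s).2 (x := l) hl (y := m) hm
    (sub_nonneg.2 ht.2.le) ht.1.le (sub_add_cancel 1 t)
  have hEq : (1 - t) • l + t • m = l + t • (m - l) := by
    ext i
    simp
    ring
  rw [hEq] at h
  simp only [smul_eq_mul] at h
  rw [slope_def_field]
  simp only [zero_smul, add_zero, sub_zero]
  rw [le_div_iff₀ ht.1]
  linarith

end ESym

/-! ### Comparison of the coefficients F_i = ∂σ_{m+1}/∂λ_i -/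

section Comparison

set_option linter.unusedSectionVars false

variable {ι : Type*} [DecidableEq ι] {m : ℕ} {s : Finset ι} {l : ι → ℝ}

lemma IsGarding.esym_erase_pos (h : IsGarding (m + 1) s l) {i : ι} (hi : i ∈ s) :
    0 < esym m (s.erase i) l := h.erase hi m le_rfl

/-- F_i - F_j is (l_j - l_i) times σ_{m-1} with both variables removed, and that factor is positive.
-/
lemma IsGarding.esym_erase_anti (h : IsGarding (m + 1) s l) {i j : ι} (hi : i ∈ s) (hj : j ∈ s)
    (hij : l j ≤ l i) : esym m (s.erase i) l ≤ esym m (s.erase j) l := by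
  rcases eq_or_ne i j with rfl | hne
  · exact le_rfl
  cases m with
  | zero => simp
  | succ m =>
    have hji : j ∈ s.erase i := Finset.mem_erase.2 ⟨hne.symm, hj⟩
    have hij' : i ∈ s.erase j := Finset.mem_erase.2 ⟨hne, hi⟩
    have hA := (h.erase hi).esym_erase_pos hji
    rw [esym_erase m hji, esym_erase m hij', Finset.erase_right_comm (a := j)]
    nlinarith

/-- A partial converse to the monotonicity of F: the larger eigenvalue has the smaller coefficient,
but F λ² cannot drop by more than a fixed factor. With A, S the symmetric functions of two
consecutive orders of the variables other than l_i, l_j, one has F_i = S + l_j A and F_j = S + l_i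
A. The only danger is S close to -l_i A, which Newton's inequality excludes. -/
lemma IsGarding.esym_erase_mul_sq_le (h : IsGarding (m + 1) s l) {i j : ι} (hi : i ∈ s)
    (hj : j ∈ s) (hpos : 0 < l i) (hij : l i ≤ l j) :
    esym m (s.erase i) l * l i ^ 2 ≤ 4 * (m + 1) * (esym m (s.erase j) l * l j ^ 2) := by
  have hm0 : (0 : ℝ) ≤ m := m.cast_nonneg
  rcases eq_or_ne i j with rfl | hne
  · have := mul_pos (h.esym_erase_pos hi) (pow_pos hpos 2)
    nlinarith
  cases m with
  | zero =>
    simp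
    nlinarith
  | succ m =>
    have hji : j ∈ s.erase i := Finset.mem_erase.2 ⟨hne.symm, hj⟩
    have hij' : i ∈ s.erase j := Finset.mem_erase.2 ⟨hne, hi⟩
    have hA := (h.erase hi).esym_erase_pos hji
    have hFi := h.esym_erase_pos hi
    have hFj := h.esym_erase_pos hj
    have hs := h (m + 1 + 1) le_rfl
    rw [esym_erase (m + 1) hi, esym_erase (m + 1) hji, esym_erase m hji] at hs
    rw [esym_erase m hji] at hFi
    rw [esym_erase m hij', ← Finset.erase_right_comm (a := i)] at hFj
    rw [esym_erase m hji, esym_erase m hij', ← Finset.erase_right_comm (a := i)]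
    have hN := newton_inequality m ((s.erase i).erase j) l
    push_cast at hm0 ⊢
    set A := esym m ((s.erase i).erase j) l
    set S := esym (m + 1) ((s.erase i).erase j) l
    set R := esym (m + 1 + 1) ((s.erase i).erase j) l
    have hN' : (m + 2) * (R * A) ≤ (m + 1) * S ^ 2 := hN
    set a := l j
    set b := l i
    have ha : 0 < a := hpos.trans_le hij
    set M : ℝ := m + 1 + 1
    have hM : 1 ≤ M := by linarith
    have hab : b * b ≤ a * a := mul_self_le_mul_self hpos.le hij
    rcases le_or_gt 0 S with hS | hS
    · have h1 : (S + a * A) * b ^ 2 ≤ (S + b * A) * a ^ 2 := by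
        have e1 : S * (b * b) ≤ S * (a * a) := mul_le_mul_of_nonneg_left hab hS
        have e2 : (a * b * A) * b ≤ (a * b * A) * a :=
          mul_le_mul_of_nonneg_left hij (by positivity)
        nlinarith
      have h2 : 0 < (S + b * A) * a ^ 2 := by positivity
      nlinarith
    · have h1 : (S + a * A) * b ^ 2 ≤ a * A * b ^ 2 := by nlinarith [sq_nonneg b]
      refine h1.trans ?_
      rcases le_or_gt (b * A / 2) (-S) with h2 | h2
      · have h3 : S ^ 2 ≤ M * ((S + a * A) * (S + b * A)) := by
          have : (S + a * A) * (S + b * A) = A * (R + a * S + b * (S + a * A)) - R * A + S ^ 2 := by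
            ring
          have hpos' : 0 < A * (R + a * S + b * (S + a * A)) := mul_pos hA hs
          rw [this]
          have hMm : (m : ℝ) + 2 = M := by simp only [M]; ring
          rw [hMm] at hN'
          have hMm' : (m : ℝ) + 1 = M - 1 := by simp only [M]; ring
          rw [hMm'] at hN'
          nlinarith
        have h4 : (b * A) ^ 2 / 4 ≤ S ^ 2 := by nlinarith [mul_pos hpos hA]
        have h5 : (b * A) ^ 2 / 4 ≤ M * (a * A * (S + b * A)) := by
          refine (h4.trans h3).trans ?_
          have : (S + a * A) * (S + b * A) ≤ a * A * (S + b * A) :=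
            mul_le_mul_of_nonneg_right (by linarith) hFj.le
          nlinarith
        have h6 : A * (a * A * b ^ 2) ≤ A * (4 * M * ((S + b * A) * a ^ 2)) := by
          nlinarith
        exact le_of_mul_le_mul_left h6 hA
      · have h3 : b * A / 2 ≤ S + b * A := by linarith
        have h4 : a * A * b ^ 2 ≤ 2 * ((S + b * A) * a ^ 2) := by
          have e1 : (a * b * A) * b ≤ (a * b * A) * a :=
            mul_le_mul_of_nonneg_left hij (by positivity)
          have e2 : b * A / 2 * a ^ 2 ≤ (S + b * A) * a ^ 2 :=
            mul_le_mul_of_nonneg_right h3 (sq_nonneg a)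
          nlinarith
        have : 0 < (S + b * A) * a ^ 2 := by positivity
        nlinarith

/-- The sum is (card - m) σ_m, and σ_m = F_j + l_j σ_{m-1}(l without l_j) ≤ F_j because l_j ≤ 0. -/
lemma IsGarding.sum_esym_erase_le (h : IsGarding (m + 1) s l) {j : ι} (hj : j ∈ s)
    (hneg : l j ≤ 0) :
    ∑ i ∈ s, esym m (s.erase i) l ≤ s.card * esym m (s.erase j) l := by
  calc ∑ i ∈ s, esym m (s.erase i) l = (s.card - m) * esym m s l := sum_esym_erase m s l
    _ ≤ s.card * esym m s l := by
      have := h m (Nat.le_succ m)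
      have hm0 : (0 : ℝ) ≤ m := m.cast_nonneg
      nlinarith
    _ ≤ s.card * esym m (s.erase j) l := by
      refine mul_le_mul_of_nonneg_left ?_ s.card.cast_nonneg
      cases m with
      | zero => simp
      | succ m =>
        rw [esym_erase m hj]
        have := (h.erase hj) m (Nat.le_succ m)
        nlinarith

/-- Terms `F_i λ_i` of one sign are controlled by a single one whose eigenvalue is comparable with
the largest possible size. -/
theorem exists_esym_erase_mul_le (m N : ℕ) {ε Λ : ℝ} (hε : 0 < ε) (hΛ : 0 < Λ) :
    ∃ C : ℝ, 0 < C ∧ ∀ (s : Finset ι) (l : ι → ℝ), s.card = N → IsGarding (m + 1) s l →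
      ∀ (σ B : ℝ), σ = 1 ∨ σ = -1 → 0 < B → (∀ i ∈ s, |l i| ≤ Λ * B) →
      ∀ j ∈ s, B / 8 ≤ σ * l j → ∀ i ∈ s,
        esym m (s.erase i) l * (σ * l i) ≤
          C * (esym m (s.erase j) l * (σ * l j)) + ε * B * ∑ i ∈ s, esym m (s.erase i) l := by
  have hm0 : (0 : ℝ) ≤ m := m.cast_nonneg
  have hN0 : (0 : ℝ) ≤ N := N.cast_nonneg
  -- One summand per regime. For σ = 1: if l_i ≥ l_j then F_i ≤ F_j and l_i ≤ 8Λ l_j; if εB < l_i <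
  -- l_j the comparison of F λ² applies with l_j/l_i ≤ Λ/ε; smaller l_i go into the ε term. For σ =
  -- -1 the negative l_j has a coefficient comparable with the whole sum.
  refine ⟨8 * Λ + 4 * (m + 1) * (Λ / ε) + 8 * N * Λ, by positivity, ?_⟩
  intro s l hcard h σ B hσ hB hl j hj hlj i hi
  have hF : ∀ a ∈ s, 0 < esym m (s.erase a) l := fun a ha => h.esym_erase_pos ha
  set T := ∑ i ∈ s, esym m (s.erase i) l
  have hFT : ∀ a ∈ s, esym m (s.erase a) l ≤ T := fun a ha =>
    Finset.single_le_sum (f := fun i => esym m (s.erase i) l) (fun b hb => (hF b hb).le) ha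
  have hFi := hF i hi
  have hFj := hF j hj
  have hT : 0 < T := hFi.trans_le (hFT i hi)
  have hX : 0 < esym m (s.erase j) l * (σ * l j) := mul_pos hFj (by linarith)
  have hεT : 0 < ε * B * T := by positivity
  have t1 : 0 ≤ 8 * Λ * (esym m (s.erase j) l * (σ * l j)) := by positivity
  have t2 : 0 ≤ 4 * (m + 1) * (Λ / ε) * (esym m (s.erase j) l * (σ * l j)) := by positivity
  have t3 : 0 ≤ 8 * N * Λ * (esym m (s.erase j) l * (σ * l j)) := by positivity
  have hli := abs_le.1 (hl i hi)
  have hlj' := abs_le.1 (hl j hj)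
  rcases hσ with rfl | rfl
  · simp only [one_mul] at *
    rcases le_or_gt (l i) (ε * B) with h1 | h1
    · have : esym m (s.erase i) l * l i ≤ ε * B * T := by
        calc _ ≤ esym m (s.erase i) l * (ε * B) := mul_le_mul_of_nonneg_left h1 hFi.le
          _ ≤ T * (ε * B) := mul_le_mul_of_nonneg_right (hFT i hi) (by positivity)
          _ = _ := by ring
      nlinarith
    · have hipos : 0 < l i := (by positivity : 0 < ε * B).trans h1
      rcases le_or_gt (l j) (l i) with h2 | h2
      · have h3 := h.esym_erase_anti hi hj h2
        have : esym m (s.erase i) l * l i ≤ 8 * Λ * (esym m (s.erase j) l * l j) := by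
          calc _ ≤ esym m (s.erase j) l * l i := mul_le_mul_of_nonneg_right h3 hipos.le
            _ ≤ esym m (s.erase j) l * (8 * Λ * l j) :=
              mul_le_mul_of_nonneg_left (by nlinarith) hFj.le
            _ = _ := by ring
        nlinarith
      · have h3 := h.esym_erase_mul_sq_le hi hj hipos h2.le
        have h4 : l j ≤ Λ / ε * l i := by
          rw [div_mul_eq_mul_div, le_div_iff₀ hε]
          nlinarith
        have h5 : esym m (s.erase i) l * l i ≤
            4 * (m + 1) * (Λ / ε) * (esym m (s.erase j) l * l j) := by
          refine le_of_mul_le_mul_right ?_ hipos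
          calc _ = esym m (s.erase i) l * l i ^ 2 := by ring
            _ ≤ _ := h3
            _ = 4 * (m + 1) * (esym m (s.erase j) l * l j) * l j := by ring
            _ ≤ 4 * (m + 1) * (esym m (s.erase j) l * l j) * (Λ / ε * l i) :=
              mul_le_mul_of_nonneg_left h4 (by positivity)
            _ = _ := by ring
        nlinarith
  · have h1 := h.sum_esym_erase_le hj (by linarith)
    rw [hcard] at h1
    have : esym m (s.erase i) l * (-1 * l i) ≤
        8 * N * Λ * (esym m (s.erase j) l * (-1 * l j)) := by
      calc esym m (s.erase i) l * (-1 * l i) ≤ esym m (s.erase i) l * (Λ * B) :=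
            mul_le_mul_of_nonneg_left (by linarith) hFi.le
        _ ≤ (N * esym m (s.erase j) l) * (Λ * B) :=
            mul_le_mul_of_nonneg_right ((hFT i hi).trans h1) (by positivity)
        _ ≤ (N * esym m (s.erase j) l) * (Λ * (8 * (-1 * l j))) := by
            refine mul_le_mul_of_nonneg_left (mul_le_mul_of_nonneg_left (by linarith) hΛ.le) ?_
            positivity
        _ = _ := by ring
    nlinarith

/-- The index is that of the largest eigenvalue. Positivity of σ_1 bounds the negative eigenvalues
by it. For the second bound, if σ_{m+1} without l_i is positive, Euler's identity there replaces
every other eigenvalue by l_i. -/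
lemma IsGarding.exists_max (h : IsGarding (m + 1) s l) :
    ∃ i ∈ s, (∀ j ∈ s, |l j| ≤ s.card * l i) ∧
      esym (m + 1) s l ≤ s.card * (esym m (s.erase i) l * l i) := by
  have hne : s.Nonempty := by
    rw [Finset.nonempty_iff_ne_empty]
    rintro rfl
    simpa using h (m + 1) le_rfl
  obtain ⟨i, hi, hmax⟩ := s.exists_max_image l hne
  have h1 : 0 < ∑ j ∈ s, l j := by
    rw [← esym_one]
    exact h 1 (by omega)
  have hcard : (1 : ℝ) ≤ s.card := by exact_mod_cast hne.card_pos
  have hpos : 0 < l i := by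
    by_contra! hle
    exact h1.not_ge (Finset.sum_nonpos fun j hj => (hmax j hj).trans hle)
  refine ⟨i, hi, fun j hj => ?_, ?_⟩
  · rw [abs_le]
    constructor
    · have h2 := Finset.sum_erase_add s l hj
      have h3 : ∑ a ∈ s.erase j, l a ≤ (s.erase j).card • l i :=
        Finset.sum_le_card_nsmul _ _ _ fun a ha => hmax a (Finset.mem_of_mem_erase ha)
      have h4 : ((s.erase j).card : ℝ) ≤ s.card := by
        exact_mod_cast Finset.card_le_card (Finset.erase_subset j s)
      rw [nsmul_eq_mul] at h3
      nlinarith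
    · nlinarith [hmax j hj]
  · have hF := h.esym_erase_pos hi
    have hFl : 0 < esym m (s.erase i) l * l i := mul_pos hF hpos
    rw [esym_erase m hi, mul_comm (l i)]
    rcases le_or_gt (esym (m + 1) (s.erase i) l) 0 with h2 | h2
    · nlinarith
    · have hg : IsGarding (m + 1) (s.erase i) l := by
        intro j hj
        rcases hj.lt_or_eq with hlt | rfl
        · exact h.erase hi j (Nat.lt_succ_iff.1 hlt)
        · exact h2
      have h3 := sum_mul_esym_erase m (s.erase i) l
      have h4 : ∑ j ∈ s.erase i, l j * esym m ((s.erase i).erase j) l ≤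
          ∑ j ∈ s.erase i, l i * esym m ((s.erase i).erase j) l :=
        Finset.sum_le_sum fun j hj => mul_le_mul_of_nonneg_right
          (hmax j (Finset.mem_of_mem_erase hj)) (hg.esym_erase_pos hj).le
      rw [← Finset.mul_sum, sum_esym_erase, Finset.card_erase_of_mem hi,
        Nat.cast_sub hne.card_pos, h3] at h4
      have hm0 : (0 : ℝ) ≤ m := m.cast_nonneg
      push_cast at h4
      nlinarith

/-- The good quadratic term Σ F_i λ_i² dominates any single eigenvalue; this is the absorption
behind the interior estimate. -/
lemma IsGarding.esym_mul_abs_le (h : IsGarding (m + 1) s l) {j : ι} (hj : j ∈ s) :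
    esym (m + 1) s l * |l j| ≤ s.card ^ 2 * ∑ i ∈ s, esym m (s.erase i) l * l i ^ 2 := by
  obtain ⟨i, hi, h1, h2⟩ := h.exists_max
  have h3 : esym m (s.erase i) l * l i ^ 2 ≤ ∑ i ∈ s, esym m (s.erase i) l * l i ^ 2 :=
    Finset.single_le_sum (f := fun i => esym m (s.erase i) l * l i ^ 2)
      (fun a ha => mul_nonneg (h.esym_erase_pos ha).le (sq_nonneg _)) hi
  have hσ := h (m + 1) le_rfl
  have hc : (0 : ℝ) ≤ s.card := s.card.cast_nonneg
  have hli : 0 ≤ l i := by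
    rcases hc.eq_or_lt with h0 | h0
    · rw [← h0] at h2
      linarith
    · have := (abs_nonneg _).trans (h1 j hj)
      exact nonneg_of_mul_nonneg_right this h0
  calc _ ≤ esym (m + 1) s l * (s.card * l i) := mul_le_mul_of_nonneg_left (h1 j hj) hσ.le
    _ ≤ s.card * (esym m (s.erase i) l * l i) * (s.card * l i) :=
      mul_le_mul_of_nonneg_right h2 (by positivity)
    _ = s.card ^ 2 * (esym m (s.erase i) l * l i ^ 2) := by ring
    _ ≤ _ := mul_le_mul_of_nonneg_left h3 (by positivity)

lemma esym_const (k : ℕ) (s : Finset ι) (c : ℝ) :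
    esym k s (fun _ => c) = s.card.choose k * c ^ k := by
  unfold esym
  rw [Finset.sum_congr rfl (g := fun _ => c ^ k), Finset.sum_const, Finset.card_powersetCard,
    nsmul_eq_mul]
  intro t ht
  rw [Finset.prod_const, (Finset.mem_powersetCard.1 ht).2]

/-- Tangent plane inequality at l, tested on the constant vector S: log σ_{m+1} is not smaller
there, so Σ F_i (S - l_i) ≥ 0. The use is a positive lower bound for Σ F_i. -/
lemma IsGarding.le_sum_esym_erase (h : IsGarding (m + 1) s l) (hm : m + 1 ≤ s.card) {S : ℝ}
    (hS : 1 ≤ S) (hle : esym (m + 1) s l ≤ S) :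
    esym (m + 1) s l ≤ S * ∑ i ∈ s, esym m (s.erase i) l := by
  have hpos := h (m + 1) le_rfl
  have hch : ∀ j ≤ m + 1, (1 : ℝ) ≤ s.card.choose j := fun j hj => by
    exact_mod_cast Nat.choose_pos (hj.trans hm)
  have hc : IsGarding (m + 1) s fun _ => S := by
    intro j hj
    rw [esym_const]
    have := hch j hj
    positivity
  have h1 := log_esym_le m s h hc
  have h2 : esym (m + 1) s l ≤ esym (m + 1) s fun _ => S := by
    rw [esym_const]
    have h3 : S ≤ S ^ (m + 1) := le_self_pow₀ hS (by omega)
    nlinarith [hch (m + 1) le_rfl]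
  have h3 := Real.log_le_log hpos h2
  have h4 : 0 ≤ (∑ i ∈ s, esym m (s.erase i) l * (S - l i)) / esym (m + 1) s l := by linarith
  have h5 : 0 ≤ ∑ i ∈ s, esym m (s.erase i) l * (S - l i) := by
    by_contra! hneg
    exact h4.not_gt (div_neg_of_neg_of_pos hneg hpos)
  have h6 : ∑ i ∈ s, esym m (s.erase i) l * (S - l i) =
      S * ∑ i ∈ s, esym m (s.erase i) l - (m + 1) * esym (m + 1) s l := by
    rw [← sum_mul_esym_erase, Finset.mul_sum, ← Finset.sum_sub_distrib]
    exact Finset.sum_congr rfl fun i _ => by ring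
  have hm0 : (0 : ℝ) ≤ m := m.cast_nonneg
  nlinarith

end Comparison

/-! ### Diagonal entries versus eigenvalues -/

section Schur

variable {n : ℕ}

lemma esym_comp_perm (k : ℕ) (l : Fin n → ℝ) (e : Equiv.Perm (Fin n)) :
    esym k Finset.univ (l ∘ e) = esym k Finset.univ l := by
  have h := Finset.map_univ_equiv e
  unfold esym
  conv_rhs => rw [← h, Finset.powersetCard_map, Finset.sum_map]
  refine Finset.sum_congr rfl fun t _ => ?_
  simp [Finset.mapEmbedding_apply]

lemma IsGarding.comp_perm {k : ℕ} {l : Fin n → ℝ} (h : IsGarding k Finset.univ l)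
    (e : Equiv.Perm (Fin n)) : IsGarding k Finset.univ (l ∘ e) := fun j hj => by
  rw [esym_comp_perm]
  exact h j hj

/-- A weak form of Schur's majorization theorem for the function `log σ_k`. -/
theorem IsGarding.of_doublyStochastic {k : ℕ} {l : Fin n → ℝ} (h : IsGarding k Finset.univ l)
    {D : Matrix (Fin n) (Fin n) ℝ} (hD : D ∈ doublyStochastic ℝ (Fin n)) :
    IsGarding k Finset.univ (D.mulVec l) ∧
      Real.log (esym k Finset.univ l) ≤ Real.log (esym k Finset.univ (D.mulVec l)) := by
  -- Birkhoff: `D.mulVec l` is a convex combination of permutations of `l`, and the symmetric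
  -- concave function takes one value on all of these.
  obtain ⟨w, hw0, hw1, hw⟩ := exists_eq_sum_perm_of_mem_doublyStochastic hD
  have hEq : D.mulVec l = ∑ e, w e • (l ∘ e) := by
    rw [← hw, Matrix.sum_mulVec]
    refine Finset.sum_congr rfl fun e _ => ?_
    rw [Matrix.smul_mulVec, Matrix.permMatrix_mulVec]
  have hmem : ∀ e ∈ (Finset.univ : Finset (Equiv.Perm (Fin n))),
      l ∘ e ∈ {v | IsGarding k Finset.univ v} := fun e _ => h.comp_perm e
  have hcon := concaveOn_log_esym k (Finset.univ : Finset (Fin n))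
  constructor
  · rw [hEq]
    exact (convex_setOf_isGarding k Finset.univ).sum_mem (fun e _ => hw0 e) hw1 hmem
  · have := hcon.le_map_sum (fun e _ => hw0 e) hw1 hmem
    simp only [esym_comp_perm, ← Finset.sum_smul, hw1, one_smul] at this
    rw [hEq]
    exact this

/-- Parseval in both bases. This matrix sends the eigenvalues of a form diagonal in `v` to its
diagonal entries in `b`. -/
lemma sq_inner_mem_doublyStochastic
    (v b : OrthonormalBasis (Fin n) ℝ (EuclideanSpace ℝ (Fin n))) :
    (Matrix.of fun i j => inner ℝ (v j) (b i) ^ 2) ∈ doublyStochastic ℝ (Fin n) := by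
  rw [mem_doublyStochastic_iff_sum]
  refine ⟨fun i j => sq_nonneg _, fun i => ?_, fun j => ?_⟩
  · have := v.sum_sq_norm_inner_right (b i)
    simpa using this
  · have := b.sum_sq_norm_inner_left (v j)
    simpa using this

end Schur

/-! ### Geometry of uniformly convex domains -/

/-- The Euclidean space of dimension `n`. -/
abbrev Euc (n : ℕ) := EuclideanSpace ℝ (Fin n)

/-- Composing ∇ρ with one fixed smooth field gives a global extension of the normal whose C³ bounds
depend on n and L alone, although ∇ρ may vanish inside Ω. As |∇ρ| ≥ 1 on ∂Ω, the threshold 3/4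
leaves a neighbourhood of the boundary where the extension is exactly ∇ρ/|∇ρ|. -/
lemma exists_contDiff_normalize (n : ℕ) : ∃ Ψ : Euc n → Euc n, ContDiff ℝ 3 Ψ ∧
    ∀ p, 3 / 4 ≤ ‖p‖ → Ψ p = ‖p‖⁻¹ • p := by
  refine ⟨fun p => (Real.smoothTransition (4 * ‖p‖ ^ 2 - 1) * ‖p‖⁻¹) • p, ?_, ?_⟩
  · rw [contDiff_iff_contDiffAt]
    intro p
    rcases eq_or_ne p 0 with rfl | hp
    · have : (fun p : Euc n => (Real.smoothTransition (4 * ‖p‖ ^ 2 - 1) * ‖p‖⁻¹) • p)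
          =ᶠ[𝓝 0] fun _ => 0 := by
        have hball : Metric.ball (0 : Euc n) (1 / 2) ∈ 𝓝 0 := Metric.ball_mem_nhds _ (by norm_num)
        filter_upwards [hball] with q hq
        rw [mem_ball_zero_iff] at hq
        rw [Real.smoothTransition.zero_of_nonpos, zero_mul, zero_smul]
        nlinarith [norm_nonneg q]
      exact contDiffAt_const.congr_of_eventuallyEq this
    · have h1 : ContDiffAt ℝ 3 (fun p : Euc n => ‖p‖) p := contDiffAt_norm ℝ hp
      have h2 : ContDiffAt ℝ 3 (fun p : Euc n => ‖p‖⁻¹) p := h1.inv (norm_ne_zero_iff.2 hp)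
      have h3 : ContDiffAt ℝ 3 (fun p : Euc n => Real.smoothTransition (4 * ‖p‖ ^ 2 - 1)) p :=
        (Real.smoothTransition.contDiff (n := 3)).contDiffAt.comp p
          ((contDiffAt_const.mul (h1.pow 2)).sub contDiffAt_const)
      exact (h3.mul h2).smul contDiffAt_id
  · intro p hp
    have : Real.smoothTransition (4 * ‖p‖ ^ 2 - 1) = 1 :=
      Real.smoothTransition.one_of_one_le (by nlinarith)
    simp only [this, one_mul]

/-- A fixed smooth vector field agreeing with `p / |p|` for `|p| ≥ 3/4`. -/
noncomputable def normalize (n : ℕ) : Euc n → Euc n := (exists_contDiff_normalize n).choose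

lemma contDiff_normalize (n : ℕ) : ContDiff ℝ 3 (normalize n) :=
  (exists_contDiff_normalize n).choose_spec.1

lemma normalize_eq {n : ℕ} {p : Euc n} (hp : 3 / 4 ≤ ‖p‖) : normalize n p = ‖p‖⁻¹ • p :=
  (exists_contDiff_normalize n).choose_spec.2 p hp

/-- The hypotheses on the domain, bundled. -/
structure UCDomain {n : ℕ} (Ω : Set (Euc n)) (ρ : Euc n → ℝ) (L κ : ℝ) : Prop where
  isOpen : IsOpen Ω
  nonempty : Ω.Nonempty
  bounded : Bornology.IsBounded Ω
  convex : Convex ℝ Ω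
  defining : IsC4DefiningFunction Ω ρ L
  curvature : PrincipalCurvaturesGE Ω ρ κ

/-- A smooth extension of the unit normal of the level sets of `ρ`. -/
noncomputable def normalField {n : ℕ} (ρ : Euc n → ℝ) (x : Euc n) : Euc n := normalize n (gradient ρ x)

lemma contDiff_gradient {n : ℕ} {ρ : Euc n → ℝ} (hρ : ContDiff ℝ 4 ρ) :
    ContDiff ℝ 3 (gradient ρ) :=
  (InnerProductSpace.toDual ℝ (Euc n)).symm.contDiff.comp (hρ.fderiv_right (m := 3) (by norm_num))

lemma norm_iteratedFDeriv_gradient {n : ℕ} (ρ : Euc n → ℝ) (x : Euc n) (j : ℕ) :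
    ‖iteratedFDeriv ℝ j (gradient ρ) x‖ = ‖iteratedFDeriv ℝ (j + 1) ρ x‖ := by
  rw [← norm_iteratedFDeriv_fderiv]
  exact (InnerProductSpace.toDual ℝ (Euc n)).symm.norm_iteratedFDeriv_comp_left _ x j

lemma norm_fderiv2_eq {E F : Type*} [NormedAddCommGroup E] [NormedSpace ℝ E]
    [NormedAddCommGroup F] [NormedSpace ℝ F] (g : E → F) (x : E) :
    ‖fderiv ℝ (fderiv ℝ g) x‖ = ‖iteratedFDeriv ℝ 2 g x‖ := by
  rw [← norm_iteratedFDeriv_one, norm_iteratedFDeriv_fderiv]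

lemma norm_fderiv3_eq {E F : Type*} [NormedAddCommGroup E] [NormedSpace ℝ E]
    [NormedAddCommGroup F] [NormedSpace ℝ F] (g : E → F) (x : E) :
    ‖fderiv ℝ (fderiv ℝ (fderiv ℝ g)) x‖ = ‖iteratedFDeriv ℝ 3 g x‖ := by
  rw [norm_fderiv2_eq, norm_iteratedFDeriv_fderiv]

lemma inner_fderiv_gradient {n : ℕ} {ρ : Euc n → ℝ} (hρ : ContDiff ℝ 4 ρ) (x e e' : Euc n) :
    inner ℝ (fderiv ℝ (gradient ρ) x e) e' = iteratedFDeriv ℝ 2 ρ x ![e, e'] := by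
  rw [iteratedFDeriv_two_apply]
  have h1 : DifferentiableAt ℝ (fderiv ℝ ρ) x :=
    (hρ.fderiv_right (m := 3) (by norm_num)).differentiable (by norm_num) x
  have h2 : DifferentiableAt ℝ (gradient ρ) x :=
    (contDiff_gradient hρ).differentiable (by norm_num) x
  have h3 := h2.hasFDerivAt.inner ℝ (hasFDerivAt_const e' x)
  have h4 := h1.hasFDerivAt.clm_apply (hasFDerivAt_const e' x)
  have h5 : (fun y => inner ℝ (gradient ρ y) e') = fun y => fderiv ℝ ρ y e' :=
    funext fun y => inner_gradient_left
  rw [h5] at h3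
  have h6 := congrArg (fun T : Euc n →L[ℝ] ℝ => T e) (h3.unique h4)
  simpa using h6

/-- The vector field `normalField ρ` is bounded in `C³` in terms of `L` and the dimension. -/
lemma exists_normalField_bound (n : ℕ) (L : ℝ) : ∃ C : ℝ, 1 ≤ C ∧
    ∀ (Ω : Set (Euc n)) (ρ : Euc n → ℝ), IsC4DefiningFunction Ω ρ L → ∀ x ∈ closure Ω,
      ‖normalField ρ x‖ ≤ C ∧ ‖fderiv ℝ (normalField ρ) x‖ ≤ C ∧
      ‖fderiv ℝ (fderiv ℝ (normalField ρ)) x‖ ≤ C ∧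
      ‖fderiv ℝ (fderiv ℝ (fderiv ℝ (normalField ρ))) x‖ ≤ C := by
  have hb : ∃ C₁ : ℝ, ∀ i ≤ 3, ∀ q ∈ Metric.closedBall (0 : Euc n) L,
      ‖iteratedFDeriv ℝ i (normalize n) q‖ ≤ C₁ := by
    have h : ∀ i : ℕ, i ≤ 3 → ∃ C₁ : ℝ, ∀ q ∈ Metric.closedBall (0 : Euc n) L,
        ‖iteratedFDeriv ℝ i (normalize n) q‖ ≤ C₁ := fun i hi =>
      (isCompact_closedBall (0 : Euc n) L).exists_bound_of_continuousOn
        ((contDiff_normalize n).continuous_iteratedFDeriv (by exact_mod_cast hi)).continuousOn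
    obtain ⟨a0, h0⟩ := h 0 (by norm_num)
    obtain ⟨a1, h1⟩ := h 1 (by norm_num)
    obtain ⟨a2, h2⟩ := h 2 (by norm_num)
    obtain ⟨a3, h3⟩ := h 3 (by norm_num)
    refine ⟨max (max a0 a1) (max a2 a3), fun i hi q hq => ?_⟩
    interval_cases i
    · exact (h0 q hq).trans ((le_max_left _ _).trans (le_max_left _ _))
    · exact (h1 q hq).trans ((le_max_right _ _).trans (le_max_left _ _))
    · exact (h2 q hq).trans ((le_max_left _ _).trans (le_max_right _ _))
    · exact (h3 q hq).trans ((le_max_right _ _).trans (le_max_right _ _))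
  obtain ⟨C₁, hC₁⟩ := hb
  -- The chain rule bound is j! C D^j with j ≤ 3, whence 6; the summand 1 secures 1 ≤ C.
  refine ⟨1 + 6 * |C₁| * (max 1 L) ^ 3, by
    have : (0 : ℝ) ≤ 6 * |C₁| * (max 1 L) ^ 3 := by positivity
    linarith, ?_⟩
  intro Ω ρ hρ x hx
  have hD : (1 : ℝ) ≤ max 1 L := le_max_left _ _
  have hgrad : ∀ i : ℕ, i ≤ 3 → ‖iteratedFDeriv ℝ i (gradient ρ) x‖ ≤ max 1 L := fun i hi => by
    rw [norm_iteratedFDeriv_gradient]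
    exact (hρ.norm_le (i + 1) (by omega) x hx).trans (le_max_right _ _)
  have hmem : gradient ρ x ∈ Metric.closedBall (0 : Euc n) L := by
    rw [mem_closedBall_zero_iff, ← norm_iteratedFDeriv_zero (𝕜 := ℝ),
      norm_iteratedFDeriv_gradient]
    exact hρ.norm_le 1 (by norm_num) x hx
  have key : ∀ j : ℕ, j ≤ 3 → ‖iteratedFDeriv ℝ j (normalField ρ) x‖ ≤
      1 + 6 * |C₁| * (max 1 L) ^ 3 := by
    intro j hj
    have h := norm_iteratedFDeriv_comp_le (n := j) (contDiff_normalize n)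
      (contDiff_gradient hρ.contDiff)
      (by exact_mod_cast hj) x (C := |C₁|) (D := max 1 L)
      (fun i hi => (hC₁ i (hi.trans hj) _ hmem).trans (le_abs_self _))
      (fun i hi1 hi => (hgrad i (hi.trans hj)).trans (le_self_pow₀ hD (by omega)))
    have h6 : ((j.factorial : ℕ) : ℝ) ≤ 6 := by
      have := Nat.factorial_le hj
      exact_mod_cast this
    have hpow : (max 1 L) ^ j ≤ (max 1 L) ^ 3 := pow_le_pow_right₀ hD hj
    calc _ ≤ _ := h
      _ ≤ 6 * |C₁| * (max 1 L) ^ 3 := by gcongr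
      _ ≤ _ := by linarith
  refine ⟨?_, ?_, ?_, ?_⟩
  · simpa using key 0 (by norm_num)
  · simpa only [norm_iteratedFDeriv_one] using key 1 (by norm_num)
  · simpa only [norm_fderiv2_eq] using key 2 (by norm_num)
  · simpa only [norm_fderiv3_eq] using key 3 (by norm_num)

lemma contDiff_normalField {n : ℕ} {ρ : Euc n → ℝ} (hρ : ContDiff ℝ 4 ρ) :
    ContDiff ℝ 3 (normalField ρ) :=
  (contDiff_normalize n).comp (contDiff_gradient hρ)

namespace UCDomain

variable {n : ℕ} {Ω : Set (Euc n)} {ρ : Euc n → ℝ} {L κ : ℝ} {p x : Euc n}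

lemma eq_zero_of_mem_frontier (h : UCDomain Ω ρ L κ) (hp : p ∈ frontier Ω) : ρ p = 0 := by
  rw [h.defining.frontier_eq] at hp
  exact hp

lemma mem_iff (h : UCDomain Ω ρ L κ) : x ∈ Ω ↔ ρ x < 0 := by
  conv_lhs => rw [h.defining.domain_eq]
  rfl

lemma nonpos_of_mem_closure (h : UCDomain Ω ρ L κ) (hx : x ∈ closure Ω) : ρ x ≤ 0 :=
  closure_minimal (fun _ hy => (h.mem_iff.1 hy).le)
    (isClosed_le h.defining.contDiff.continuous continuous_const) hx

lemma mem_frontier_of_eq_zero (h : UCDomain Ω ρ L κ) (hp : ρ p = 0) : p ∈ frontier Ω := by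
  rw [h.defining.frontier_eq]
  exact hp

lemma mem_or_mem_frontier (h : UCDomain Ω ρ L κ) (hx : x ∈ closure Ω) :
    x ∈ Ω ∨ x ∈ frontier Ω := by
  rcases (h.nonpos_of_mem_closure hx).lt_or_eq with h1 | h1
  · exact Or.inl (h.mem_iff.2 h1)
  · exact Or.inr (h.mem_frontier_of_eq_zero h1)

lemma convex_closure (h : UCDomain Ω ρ L κ) : Convex ℝ (closure Ω) := h.convex.closure

lemma isCompact_closure (h : UCDomain Ω ρ L κ) : IsCompact (closure Ω) :=
  h.bounded.isCompact_closure

lemma differentiable (h : UCDomain Ω ρ L κ) : Differentiable ℝ ρ :=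
  h.defining.contDiff.differentiable (by norm_num)

lemma differentiable_gradient (h : UCDomain Ω ρ L κ) : Differentiable ℝ (gradient ρ) :=
  (contDiff_gradient h.defining.contDiff).differentiable (by norm_num)

lemma one_le_norm_gradient (h : UCDomain Ω ρ L κ) (hp : p ∈ frontier Ω) : 1 ≤ ‖gradient ρ p‖ :=
  h.defining.one_le_norm_gradient p hp

lemma norm_gradient_le (h : UCDomain Ω ρ L κ) (hx : x ∈ closure Ω) : ‖gradient ρ x‖ ≤ L := by
  rw [← norm_iteratedFDeriv_zero (𝕜 := ℝ), norm_iteratedFDeriv_gradient]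
  exact h.defining.norm_le 1 (by norm_num) x hx

lemma norm_fderiv_gradient_le (h : UCDomain Ω ρ L κ) (hx : x ∈ closure Ω) :
    ‖fderiv ℝ (gradient ρ) x‖ ≤ L := by
  rw [← norm_iteratedFDeriv_one, norm_iteratedFDeriv_gradient]
  exact h.defining.norm_le 2 (by norm_num) x hx

lemma norm_fderiv2_gradient_le (h : UCDomain Ω ρ L κ) (hx : x ∈ closure Ω) :
    ‖fderiv ℝ (fderiv ℝ (gradient ρ)) x‖ ≤ L := by
  rw [norm_fderiv2_eq, norm_iteratedFDeriv_gradient]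
  exact h.defining.norm_le 3 (by norm_num) x hx

lemma norm_gradient_sub_le (h : UCDomain Ω ρ L κ) (hp : p ∈ closure Ω) (hx : x ∈ closure Ω) :
    ‖gradient ρ x - gradient ρ p‖ ≤ L * ‖x - p‖ :=
  h.convex_closure.norm_image_sub_le_of_norm_hasFDerivWithin_le
    (fun y _ => (h.differentiable_gradient y).hasFDerivAt.hasFDerivWithinAt)
    (fun _ hy => h.norm_fderiv_gradient_le hy) hp hx

lemma norm_fderiv_gradient_sub_le (h : UCDomain Ω ρ L κ) (hp : p ∈ closure Ω)
    (hx : x ∈ closure Ω) :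
    ‖fderiv ℝ (gradient ρ) x - fderiv ℝ (gradient ρ) p‖ ≤ L * ‖x - p‖ :=
  h.convex_closure.norm_image_sub_le_of_norm_hasFDerivWithin_le
    (fun y _ => (((contDiff_gradient h.defining.contDiff).fderiv_right (m := 2)
      (by norm_num)).differentiable (by norm_num) y).hasFDerivAt.hasFDerivWithinAt)
    (fun _ hy => h.norm_fderiv2_gradient_le hy) hp hx

lemma abs_sub_le (h : UCDomain Ω ρ L κ) (hp : p ∈ closure Ω) (hx : x ∈ closure Ω) :
    |ρ x - ρ p| ≤ L * ‖x - p‖ :=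
  h.convex_closure.norm_image_sub_le_of_norm_hasFDerivWithin_le
    (fun y _ => (h.differentiable y).hasFDerivAt.hasFDerivWithinAt)
    (fun y hy => by
      rw [← norm_iteratedFDeriv_one]
      exact h.defining.norm_le 1 (by norm_num) y hy) hp hx

lemma hasDerivAt_line (h : UCDomain Ω ρ L κ) (x v : Euc n) (t : ℝ) :
    HasDerivAt (fun t : ℝ => ρ (x + t • v)) (inner ℝ (gradient ρ (x + t • v)) v) t := by
  rw [inner_gradient_left]
  have h1 : HasDerivAt (fun t : ℝ => x + t • v) v t := by
    simpa using ((hasDerivAt_id t).smul_const v).const_add x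
  exact (h.differentiable _).hasFDerivAt.comp_hasDerivAt t h1

lemma hasDerivAt_gradient_line (h : UCDomain Ω ρ L κ) (x v w : Euc n) (t : ℝ) :
    HasDerivAt (fun t : ℝ => inner ℝ (gradient ρ (x + t • v)) w)
      (inner ℝ (fderiv ℝ (gradient ρ) (x + t • v) v) w) t := by
  have h1 : HasDerivAt (fun t : ℝ => x + t • v) v t := by
    simpa using ((hasDerivAt_id t).smul_const v).const_add x
  have h2 := (h.differentiable_gradient _).hasFDerivAt.comp_hasDerivAt t h1
  simpa using h2.inner ℝ (hasDerivAt_const t w)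

lemma inner_gradient_sub_nonpos (h : UCDomain Ω ρ L κ) (hp : p ∈ frontier Ω)
    (hx : x ∈ closure Ω) : inner ℝ (gradient ρ p) (x - p) ≤ 0 := by
  have hd := h.hasDerivAt_line p (x - p) 0
  simp only [zero_smul, add_zero] at hd
  have hslope := (hasDerivAt_iff_tendsto_slope.1 hd).mono_left
    (nhdsWithin_mono (0 : ℝ) (show Ioi (0 : ℝ) ⊆ {0}ᶜ from fun x hx => ne_of_gt hx))
  refine le_of_tendsto hslope ?_
  filter_upwards [Ioo_mem_nhdsGT (zero_lt_one' ℝ)] with t ht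
  have hmem : p + t • (x - p) ∈ closure Ω :=
    h.convex_closure.add_smul_sub_mem (frontier_subset_closure hp) hx ⟨ht.1.le, ht.2.le⟩
  rw [slope_def_field]
  simp only [zero_smul, add_zero, sub_zero, h.eq_zero_of_mem_frontier hp]
  exact div_nonpos_of_nonpos_of_nonneg (h.nonpos_of_mem_closure hmem) ht.1.le

/-- A small move from x along ∇ρ(p) stays in Ω and increases the product, so the weak inequality
cannot be an equality. -/
lemma inner_gradient_sub_neg (h : UCDomain Ω ρ L κ) (hp : p ∈ frontier Ω)
    (hx : x ∈ Ω) : inner ℝ (gradient ρ p) (x - p) < 0 := by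
  have hg : 0 < ‖gradient ρ p‖ := zero_lt_one.trans_le (h.one_le_norm_gradient hp)
  have hc : Tendsto (fun t : ℝ => x + t • gradient ρ p) (𝓝[>] 0) (𝓝 x) := by
    have : Continuous fun t : ℝ => x + t • gradient ρ p := by fun_prop
    simpa using (this.tendsto 0).mono_left nhdsWithin_le_nhds
  obtain ⟨t, ht, ht0⟩ := ((hc.eventually (h.isOpen.mem_nhds hx)).and self_mem_nhdsWithin).exists
  have h1 := h.inner_gradient_sub_nonpos hp (subset_closure ht)
  have h2 : x + t • gradient ρ p - p = (x - p) + t • gradient ρ p := by abel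
  rw [h2, inner_add_right, inner_smul_right, real_inner_self_eq_norm_sq] at h1
  have : 0 < t * ‖gradient ρ p‖ ^ 2 := mul_pos ht0 (by positivity)
  linarith

/-- Points `p + tτ - sν` of the boundary near `p`, in a tangential direction `τ`. -/
lemma exists_mem_frontier_near (h : UCDomain Ω ρ L κ) (hp : p ∈ frontier Ω) {τ : Euc n}
    (hτ : inner ℝ τ (gradient ρ p) = 0) {ε : ℝ} (hε : 0 < ε) :
    ∀ᶠ t in 𝓝[>] (0 : ℝ), ∃ s ∈ Icc 0 (ε * t), p + t • τ - s • gradient ρ p ∈ frontier Ω := by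
  have hd := h.hasDerivAt_line p (τ - ε • gradient ρ p) 0
  have hg : 0 < ‖gradient ρ p‖ := zero_lt_one.trans_le (h.one_le_norm_gradient hp)
  simp only [zero_smul, add_zero] at hd
  have hneg : inner ℝ (gradient ρ p) (τ - ε • gradient ρ p) < 0 := by
    rw [inner_sub_right, inner_smul_right, real_inner_self_eq_norm_sq, real_inner_comm, hτ]
    have : 0 < ε * ‖gradient ρ p‖ ^ 2 := by positivity
    linarith
  have hslope := (hasDerivAt_iff_tendsto_slope.1 hd).mono_left
    (nhdsWithin_mono (0 : ℝ) (show Ioi (0 : ℝ) ⊆ {0}ᶜ from fun x hx => ne_of_gt hx))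
  filter_upwards [hslope.eventually (Iio_mem_nhds hneg), self_mem_nhdsWithin] with t ht ht0
  have ht0' : (0 : ℝ) < t := ht0
  rw [slope_def_field] at ht
  simp only [zero_smul, add_zero, sub_zero, h.eq_zero_of_mem_frontier hp] at ht
  have h1 : ρ (p + t • τ - (ε * t) • gradient ρ p) ≤ 0 := by
    have e : p + t • τ - (ε * t) • gradient ρ p = p + t • (τ - ε • gradient ρ p) := by
      rw [smul_sub, smul_smul, mul_comm ε t]
      abel
    rw [e]
    have := (div_lt_iff₀ ht0').1 ht
    linarith
  -- p + tτ lies in the supporting hyperplane at p, so it is outside Ω. Together with `h1`, ρ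
  -- changes sign on the segment going inward from it.
  have h2 : 0 ≤ ρ (p + t • τ - (0 : ℝ) • gradient ρ p) := by
    by_contra! hlt
    have := h.inner_gradient_sub_neg hp (h.mem_iff.2 hlt)
    have e : p + t • τ - (0 : ℝ) • gradient ρ p - p = t • τ := by
      rw [zero_smul]
      abel
    rw [e, inner_smul_right, real_inner_comm, hτ] at this
    simp at this
  have hcont : ContinuousOn (fun s : ℝ => ρ (p + t • τ - s • gradient ρ p)) (Icc 0 (ε * t)) :=
    (h.defining.contDiff.continuous.comp (by fun_prop)).continuousOn
  obtain ⟨s, hs, hs0⟩ := intermediate_value_Icc' (by positivity : (0 : ℝ) ≤ ε * t) hcont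
    (⟨h1, h2⟩ : (0 : ℝ) ∈ Icc _ _)
  exact ⟨s, hs, h.mem_frontier_of_eq_zero hs0⟩

/-- Tangential derivatives of a function vanishing on the boundary vanish. -/
theorem tangential_derivative_eq_zero (h : UCDomain Ω ρ L κ) (hp : p ∈ frontier Ω) {τ : Euc n}
    (hτ : inner ℝ τ (gradient ρ p) = 0) {z : Euc n → ℝ} {z' : Euc n →L[ℝ] ℝ}
    (hz : HasFDerivWithinAt z z' (closure Ω) p) (hz0 : ∀ q ∈ frontier Ω, z q = 0) :
    z' τ = 0 := by
  have hG := norm_nonneg (gradient ρ p)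
  rw [← abs_eq_zero]
  refine le_antisymm (le_of_forall_pos_le_add fun δ hδ => ?_) (abs_nonneg _)
  -- The test points are p + tτ - s∇ρ(p) ∈ ∂Ω with 0 ≤ s ≤ εt. There z vanishes, so
  -- differentiability within the closure gives t|z'τ| ≤ εKt, where K collects the remainder and the
  -- normal component.
  set K : ℝ := (‖τ‖ + ‖gradient ρ p‖) + ‖z'‖ * ‖gradient ρ p‖ + 1 with hK
  have hKpos : 0 < K := by positivity
  set ε : ℝ := min 1 (δ / K) with hεdef
  have hε : 0 < ε := lt_min one_pos (by positivity)
  have hlittle := (hasFDerivWithinAt_iff_isLittleO.1 hz).def hε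
  rw [eventually_nhdsWithin_iff, Metric.eventually_nhds_iff] at hlittle
  obtain ⟨r, hr, hball⟩ := hlittle
  have hev : ∀ᶠ t in 𝓝[>] (0 : ℝ), t * (‖τ‖ + ‖gradient ρ p‖) < r := by
    have : Tendsto (fun t : ℝ => t * (‖τ‖ + ‖gradient ρ p‖)) (𝓝[>] 0) (𝓝 0) := by
      have : Continuous fun t : ℝ => t * (‖τ‖ + ‖gradient ρ p‖) := by fun_prop
      simpa using (this.tendsto 0).mono_left nhdsWithin_le_nhds
    exact this.eventually (Iio_mem_nhds hr)
  obtain ⟨t, ⟨⟨s, hs, hq⟩, htr⟩, ht0⟩ :=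
    (((h.exists_mem_frontier_near hp hτ hε).and hev).and self_mem_nhdsWithin).exists
  have ht0' : (0 : ℝ) < t := ht0
  have hst : s ≤ t := hs.2.trans (by
    have : ε ≤ 1 := min_le_left _ _
    nlinarith)
  have hv : p + t • τ - s • gradient ρ p - p = t • τ - s • gradient ρ p := by abel
  have hnorm : ‖t • τ - s • gradient ρ p‖ ≤ t * (‖τ‖ + ‖gradient ρ p‖) := by
    refine (norm_sub_le _ _).trans ?_
    rw [norm_smul, norm_smul, Real.norm_of_nonneg ht0'.le, Real.norm_of_nonneg hs.1]
    nlinarith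
  have h1 := hball (y := p + t • τ - s • gradient ρ p)
    (by rw [dist_eq_norm, hv]; exact hnorm.trans_lt htr) (frontier_subset_closure hq)
  rw [hz0 _ hq, hz0 _ hp, hv, sub_zero, zero_sub, norm_neg, map_sub, map_smul, map_smul,
    Real.norm_eq_abs, smul_eq_mul, smul_eq_mul] at h1
  have h2 : |z' (gradient ρ p)| ≤ ‖z'‖ * ‖gradient ρ p‖ := z'.le_opNorm _
  have h3 : t * |z' τ| ≤ |t * z' τ - s * z' (gradient ρ p)| + s * |z' (gradient ρ p)| := by
    have e := abs_sub_abs_le_abs_sub (t * z' τ) (s * z' (gradient ρ p))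
    rw [abs_mul, abs_mul, abs_of_pos ht0', abs_of_nonneg hs.1] at e
    linarith
  have h4 : t * |z' τ| ≤ t * (ε * K) := by
    have e1 : ε * ‖t • τ - s • gradient ρ p‖ ≤ ε * (t * (‖τ‖ + ‖gradient ρ p‖)) :=
      mul_le_mul_of_nonneg_left hnorm hε.le
    have e2 : s * |z' (gradient ρ p)| ≤ (ε * t) * (‖z'‖ * ‖gradient ρ p‖) :=
      mul_le_mul hs.2 h2 (abs_nonneg _) (by positivity)
    have e3 : 0 ≤ ε * t := by positivity
    rw [hK]
    nlinarith
  have h5 : |z' τ| ≤ ε * K := le_of_mul_le_mul_left h4 ht0'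
  have h6 : ε * K ≤ δ := by
    have : ε ≤ δ / K := min_le_right _ _
    rwa [le_div_iff₀ hKpos] at this
  linarith

end UCDomain

lemma add_half_le_of_second_deriv {f f' f'' : ℝ → ℝ} {c : ℝ}
    (h1 : ∀ t ∈ Icc (0 : ℝ) 1, HasDerivAt f (f' t) t)
    (h2 : ∀ t ∈ Icc (0 : ℝ) 1, HasDerivAt f' (f'' t) t) (h3 : ∀ t ∈ Icc (0 : ℝ) 1, c ≤ f'' t) :
    f 0 + f' 0 + c / 2 ≤ f 1 := by
  have hint : ∀ t ∈ interior (Icc (0 : ℝ) 1), t ∈ Icc (0 : ℝ) 1 := fun t ht => interior_subset ht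
  have mono1 : MonotoneOn (fun t => f' t - c * t) (Icc 0 1) := by
    refine monotoneOn_of_deriv_nonneg (convex_Icc 0 1)
      (fun t ht => ((h2 t ht).sub ((hasDerivAt_id t).const_mul c)).continuousAt.continuousWithinAt)
      (fun t ht => ((h2 t (hint t ht)).sub
        ((hasDerivAt_id t).const_mul c)).differentiableAt.differentiableWithinAt) fun t ht => ?_
    have hd : HasDerivAt (fun t => f' t - c * t) (f'' t - c * 1) t :=
      (h2 t (hint t ht)).sub ((hasDerivAt_id t).const_mul c)
    rw [hd.deriv]
    linarith [h3 t (hint t ht)]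
  have hd : ∀ t ∈ Icc (0 : ℝ) 1, HasDerivAt (fun t => f t - f' 0 * t - c / 2 * t ^ 2)
      (f' t - f' 0 - c * t) t := fun t ht => by
    refine (((h1 t ht).sub ((hasDerivAt_id t).const_mul (f' 0))).sub
      ((hasDerivAt_pow 2 t).const_mul (c / 2))).congr_deriv ?_
    simp
    ring
  have mono2 : MonotoneOn (fun t => f t - f' 0 * t - c / 2 * t ^ 2) (Icc 0 1) := by
    refine monotoneOn_of_deriv_nonneg (convex_Icc 0 1)
      (fun t ht => (hd t ht).continuousAt.continuousWithinAt)
      (fun t ht => (hd t (hint t ht)).differentiableAt.differentiableWithinAt) fun t ht => ?_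
    rw [(hd t (hint t ht)).deriv]
    have := mono1 (left_mem_Icc.2 zero_le_one) (hint t ht) (hint t ht).1
    simp only [mul_zero, sub_zero] at this
    linarith
  have := mono2 (left_mem_Icc.2 zero_le_one) (right_mem_Icc.2 zero_le_one) zero_le_one
  simp only at this
  linarith

namespace UCDomain

variable {n : ℕ} {Ω : Set (Euc n)} {ρ : Euc n → ℝ} {L κ : ℝ} {p x : Euc n}

lemma normalField_eq_outerNormal (h : UCDomain Ω ρ L κ) (hp : p ∈ frontier Ω) :
    normalField ρ p = outerNormal ρ p :=
  normalize_eq (by linarith [h.one_le_norm_gradient hp])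

lemma norm_gradient_smul_normalField (h : UCDomain Ω ρ L κ) (hp : p ∈ frontier Ω) :
    ‖gradient ρ p‖ • normalField ρ p = gradient ρ p := by
  rw [h.normalField_eq_outerNormal hp, outerNormal, smul_smul, mul_inv_cancel₀, one_smul]
  linarith [h.one_le_norm_gradient hp]

lemma inner_gradient_eq (h : UCDomain Ω ρ L κ) (hp : p ∈ frontier Ω) (e : Euc n) :
    inner ℝ (gradient ρ p) e = ‖gradient ρ p‖ * inner ℝ (normalField ρ p) e := by
  conv_lhs => rw [← h.norm_gradient_smul_normalField hp, real_inner_smul_left]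

/-- Makes `normalField ρ` equal to ∇ρ/|∇ρ| on a full neighbourhood of p, so that identities for the
unit normal may be differentiated at p. -/
lemma eventually_smul_normalField (h : UCDomain Ω ρ L κ) (hp : p ∈ frontier Ω) :
    ∀ᶠ y in 𝓝 p, 3 / 4 ≤ ‖gradient ρ y‖ := by
  have : Tendsto (fun y => ‖gradient ρ y‖) (𝓝 p) (𝓝 ‖gradient ρ p‖) :=
    (h.differentiable_gradient.continuous.norm).tendsto p
  refine (this.eventually (Ioi_mem_nhds (?_ : (3 / 4 : ℝ) < _))).mono fun y hy => le_of_lt hy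
  linarith [h.one_le_norm_gradient hp]

lemma norm_normalField (h : UCDomain Ω ρ L κ) (hp : p ∈ frontier Ω) :
    ‖normalField ρ p‖ = 1 := by
  rw [h.normalField_eq_outerNormal hp, outerNormal, norm_smul, norm_inv, norm_norm,
    inv_mul_cancel₀]
  linarith [h.one_le_norm_gradient hp]

lemma differentiable_normalField (h : UCDomain Ω ρ L κ) : Differentiable ℝ (normalField ρ) :=
  (contDiff_normalField h.defining.contDiff).differentiable (by norm_num)

lemma inner_fderiv_normalField_self (h : UCDomain Ω ρ L κ) (hp : p ∈ frontier Ω) (e : Euc n) :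
    inner ℝ (fderiv ℝ (normalField ρ) p e) (normalField ρ p) = 0 := by
  have h1 : (fun y => inner ℝ (normalField ρ y) (normalField ρ y)) =ᶠ[𝓝 p] fun _ => (1 : ℝ) := by
    filter_upwards [h.eventually_smul_normalField hp] with y hy
    rw [normalField, normalize_eq hy, real_inner_self_eq_norm_sq, norm_smul, norm_inv, norm_norm,
      inv_mul_cancel₀ (by linarith), one_pow]
  have hd := (h.differentiable_normalField p).hasFDerivAt
  have h2 := (hd.inner ℝ hd).unique ((hasFDerivAt_const (1 : ℝ) p).congr_of_eventuallyEq h1)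
  have h3 := congrArg (fun T : Euc n →L[ℝ] ℝ => T e) h2
  simp [real_inner_comm] at h3
  rw [real_inner_comm]
  exact h3

/-- Differentiate ∇ρ = |∇ρ| N: tested against a tangential vector, the derivative of |∇ρ|
disappears, and the second fundamental form D²ρ/|∇ρ| remains. -/
lemma le_inner_fderiv_normalField (h : UCDomain Ω ρ L κ) (hp : p ∈ frontier Ω) {τ : Euc n}
    (hτ : inner ℝ τ (normalField ρ p) = 0) :
    κ * ‖τ‖ ^ 2 ≤ inner ℝ (fderiv ℝ (normalField ρ) p τ) τ := by
  have hg : 0 < ‖gradient ρ p‖ := zero_lt_one.trans_le (h.one_le_norm_gradient hp)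
  have hτ' : inner ℝ τ (gradient ρ p) = 0 := by
    rw [real_inner_comm, h.inner_gradient_eq hp, real_inner_comm, hτ, mul_zero]
  have h1 : gradient ρ =ᶠ[𝓝 p] fun y => ‖gradient ρ y‖ • normalField ρ y := by
    filter_upwards [h.eventually_smul_normalField hp] with y hy
    rw [normalField, normalize_eq hy, smul_smul, mul_inv_cancel₀ (by linarith), one_smul]
  have hd := (h.differentiable_normalField p).hasFDerivAt
  have hdg := (h.differentiable_gradient p).hasFDerivAt
  have hnorm : DifferentiableAt ℝ (fun y => ‖gradient ρ y‖) p :=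
    (h.differentiable_gradient p).norm ℝ (norm_pos_iff.1 hg)
  have h2 := hdg.unique ((hnorm.hasFDerivAt.smul hd).congr_of_eventuallyEq h1)
  have h3 := congrArg (fun T : Euc n →L[ℝ] Euc n => inner ℝ (T τ) τ) h2
  simp only [add_apply, smul_apply,
    ContinuousLinearMap.smulRight_apply, inner_add_left, real_inner_smul_left] at h3
  rw [real_inner_comm τ (normalField ρ p), hτ, mul_zero, add_zero,
    inner_fderiv_gradient h.defining.contDiff] at h3
  have h4 := h.curvature p hp τ hτ'
  rw [h3, mul_div_cancel_left₀ _ hg.ne'] at h4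
  exact h4

/-- The Hessian of `(ρ + K ρ²) / |∇ρ(p)|` as a quadratic form. -/
noncomputable def hessForm (ρ : Euc n → ℝ) (K : ℝ) (p x e : Euc n) : ℝ :=
  ‖gradient ρ p‖⁻¹ * ((1 + 2 * K * ρ x) * inner ℝ (fderiv ℝ (gradient ρ) x e) e
    + 2 * K * inner ℝ (gradient ρ x) e ^ 2)

end UCDomain

set_option maxHeartbeats 1000000 in
/-- Near the boundary `ρ + K ρ²` is uniformly convex. -/
theorem exists_convexity_constants (L κ : ℝ) (hκ : 0 < κ) :
    ∃ K r₀ k₁ : ℝ, 0 ≤ K ∧ 0 < r₀ ∧ r₀ ≤ 1 ∧ 0 < k₁ ∧ k₁ ≤ 1 ∧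
      ∀ (n : ℕ) (Ω : Set (Euc n)) (ρ : Euc n → ℝ), UCDomain Ω ρ L κ → ∀ p ∈ frontier Ω,
        ∀ x ∈ closure Ω, ‖x - p‖ ≤ r₀ → 1 / 2 ≤ 1 + 2 * K * ρ x ∧
          ∀ e : Euc n, 2 * k₁ * ‖e‖ ^ 2 ≤ UCDomain.hessForm ρ K p x e := by
  set L' : ℝ := max 1 L with hL'
  have hL1 : 1 ≤ L' := le_max_left _ _
  -- The term 2K⟨∇ρ, e⟩² must supply convexity in the normal direction, which the curvature does not
  -- see: K pays for D²ρ(N,N) and for the mixed terms, split by Young's inequality against part of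
  -- κ. The radius r₀ makes the passage from p to x cost at most κ/4 and keeps 1 + 2Kρ ≥ 1/2.
  set K : ℝ := κ + L' + 4 * L' ^ 2 / κ with hK
  have hKpos : 0 < K := by positivity
  set D : ℝ := L' + 2 * K * L' ^ 2 + 2 * K * L' ^ 2 with hD
  have hDpos : 0 < D := by positivity
  set r₀ : ℝ := min 1 (min (1 / (4 * K * L')) (κ / (4 * D))) with hr
  have hr0 : 0 < r₀ := lt_min one_pos (lt_min (by positivity) (by positivity))
  refine ⟨K, r₀, min 1 (κ / (8 * L')), hKpos.le, hr0, min_le_left _ _,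
    lt_min one_pos (by positivity), min_le_left _ _, ?_⟩
  intro n Ω ρ h p hp x hx hxp
  have hpc := frontier_subset_closure hp
  have hLL' : L ≤ L' := le_max_right _ _
  have hg1 := h.one_le_norm_gradient hp
  have hgp : 0 < ‖gradient ρ p‖ := by linarith
  have hr1 : ‖x - p‖ ≤ 1 := hxp.trans (min_le_left _ _)
  have hnn := norm_nonneg (x - p)
  have hr2 : 4 * K * L' * ‖x - p‖ ≤ 1 := by
    have := hxp.trans ((min_le_right _ _).trans (min_le_left _ _))
    rw [le_div_iff₀ (by positivity)] at this
    linarith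
  have hr3 : D * ‖x - p‖ ≤ κ / 4 := by
    have := hxp.trans ((min_le_right _ _).trans (min_le_right _ _))
    rw [le_div_iff₀ (by positivity)] at this
    linarith
  have hρ0 := h.nonpos_of_mem_closure hx
  have hρx : -(L' * ‖x - p‖) ≤ ρ x := by
    have := (abs_le.1 (h.abs_sub_le hpc hx)).1
    rw [h.eq_zero_of_mem_frontier hp] at this
    nlinarith
  refine ⟨by nlinarith, fun e => ?_⟩
  have hHx : |inner ℝ (fderiv ℝ (gradient ρ) x e) e| ≤ L' * ‖e‖ ^ 2 := by
    calc _ ≤ ‖fderiv ℝ (gradient ρ) x e‖ * ‖e‖ := abs_real_inner_le_norm _ _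
      _ ≤ (L' * ‖e‖) * ‖e‖ := by
        gcongr
        exact ContinuousLinearMap.le_of_opNorm_le _ ((h.norm_fderiv_gradient_le hx).trans hLL') e
      _ = _ := by ring
  have hHp : ∀ a b : Euc n, |inner ℝ (fderiv ℝ (gradient ρ) p a) b| ≤ L' * ‖a‖ * ‖b‖ :=
    fun a b => by
    calc _ ≤ ‖fderiv ℝ (gradient ρ) p a‖ * ‖b‖ := abs_real_inner_le_norm _ _
      _ ≤ (L' * ‖a‖) * ‖b‖ := by
        gcongr
        exact ContinuousLinearMap.le_of_opNorm_le _ ((h.norm_fderiv_gradient_le hpc).trans hLL') a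
  have hHxp : inner ℝ (fderiv ℝ (gradient ρ) p e) e - L' * ‖x - p‖ * ‖e‖ ^ 2 ≤
      inner ℝ (fderiv ℝ (gradient ρ) x e) e := by
    have h1 : |inner ℝ ((fderiv ℝ (gradient ρ) x - fderiv ℝ (gradient ρ) p) e) e| ≤
        L' * ‖x - p‖ * ‖e‖ ^ 2 := by
      calc _ ≤ ‖(fderiv ℝ (gradient ρ) x - fderiv ℝ (gradient ρ) p) e‖ * ‖e‖ :=
            abs_real_inner_le_norm _ _
        _ ≤ (L' * ‖x - p‖ * ‖e‖) * ‖e‖ := by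
          gcongr
          refine ContinuousLinearMap.le_of_opNorm_le _ ((h.norm_fderiv_gradient_sub_le hpc hx).trans
            ?_) e
          gcongr
        _ = _ := by ring
    rw [sub_apply, inner_sub_left] at h1
    linarith [(abs_le.1 h1).1]
  -- decomposition of `e` into tangential and normal parts
  set N := normalField ρ p with hN
  have hNn : ‖N‖ = 1 := h.norm_normalField hp
  set c : ℝ := inner ℝ N e with hc
  set τ : Euc n := e - c • N with hτ
  have hτN : inner ℝ τ N = 0 := by
    rw [hτ, inner_sub_left, real_inner_smul_left, real_inner_self_eq_norm_sq, hNn,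
      real_inner_comm]
    simp [hc]
  have he : e = τ + c • N := by rw [hτ]; abel
  have hnorm : ‖e‖ ^ 2 = ‖τ‖ ^ 2 + c ^ 2 := by
    conv_lhs => rw [he]
    rw [norm_add_sq_real, real_inner_smul_right, hτN, norm_smul, hNn]
    simp
  have hτG : inner ℝ τ (gradient ρ p) = 0 := by
    rw [real_inner_comm, h.inner_gradient_eq hp, real_inner_comm, hτN, mul_zero]
  have hcurv : κ * ‖τ‖ ^ 2 ≤ inner ℝ (fderiv ℝ (gradient ρ) p τ) τ := by
    have h1 := h.curvature p hp τ hτG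
    rw [← inner_fderiv_gradient h.defining.contDiff, le_div_iff₀ hgp] at h1
    have : 0 ≤ κ * ‖τ‖ ^ 2 := by positivity
    nlinarith
  have hpe : κ / 2 * ‖e‖ ^ 2 - K * c ^ 2 ≤ inner ℝ (fderiv ℝ (gradient ρ) p e) e := by
    have e1 : inner ℝ (fderiv ℝ (gradient ρ) p e) e = inner ℝ (fderiv ℝ (gradient ρ) p τ) τ
        + c * inner ℝ (fderiv ℝ (gradient ρ) p τ) N + c * inner ℝ (fderiv ℝ (gradient ρ) p N) τ
        + c ^ 2 * inner ℝ (fderiv ℝ (gradient ρ) p N) N := by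
      conv_lhs => rw [he]
      rw [map_add, map_smul, inner_add_left, inner_add_right, inner_add_right,
        real_inner_smul_left, real_inner_smul_left, real_inner_smul_right, real_inner_smul_right]
      ring
    have b1 := hHp τ N
    have b2 := hHp N τ
    have b3 := hHp N N
    rw [hNn] at b1 b2 b3
    have b4 : |c * inner ℝ (fderiv ℝ (gradient ρ) p τ) N| ≤ |c| * (L' * ‖τ‖) := by
      rw [abs_mul]; gcongr; linarith
    have b5 : |c * inner ℝ (fderiv ℝ (gradient ρ) p N) τ| ≤ |c| * (L' * ‖τ‖) := by
      rw [abs_mul]; gcongr; linarith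
    have b6 : -(L' * c ^ 2) ≤ c ^ 2 * inner ℝ (fderiv ℝ (gradient ρ) p N) N := by
      nlinarith [(abs_le.1 b3).1, sq_nonneg c]
    have b7 : 2 * (|c| * (L' * ‖τ‖)) ≤ κ / 2 * ‖τ‖ ^ 2 + 2 * L' ^ 2 / κ * c ^ 2 := by
      have : κ / 2 * ‖τ‖ ^ 2 + 2 * L' ^ 2 / κ * c ^ 2 - 2 * (|c| * (L' * ‖τ‖)) =
          (κ * ‖τ‖ - 2 * L' * |c|) ^ 2 / (2 * κ) := by
        rw [← sq_abs c]
        field_simp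
        ring
      have h2 : 0 ≤ (κ * ‖τ‖ - 2 * L' * |c|) ^ 2 / (2 * κ) := by positivity
      linarith
    have b8 : 0 ≤ 2 * L' ^ 2 / κ * c ^ 2 := by positivity
    have b9 : 4 * L' ^ 2 / κ * c ^ 2 = 2 * (2 * L' ^ 2 / κ * c ^ 2) := by ring
    rw [e1, hnorm, hK]
    have b10 := mul_nonneg hκ.le (sq_nonneg c)
    have b11 : (κ + L' + 4 * L' ^ 2 / κ) * c ^ 2 =
        κ * c ^ 2 + L' * c ^ 2 + 2 * (2 * L' ^ 2 / κ * c ^ 2) := by ring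
    rw [b11, mul_add]
    linarith [(abs_le.1 b4).1, (abs_le.1 b5).1]
  have hgrad : c ^ 2 / 2 - (L' * ‖x - p‖) ^ 2 * ‖e‖ ^ 2 ≤ inner ℝ (gradient ρ x) e ^ 2 := by
    have h1 : |inner ℝ (gradient ρ x - gradient ρ p) e| ≤ L' * ‖x - p‖ * ‖e‖ :=
      (abs_real_inner_le_norm _ _).trans (by
        gcongr
        refine (h.norm_gradient_sub_le hpc hx).trans ?_
        gcongr)
    have h2 : inner ℝ (gradient ρ p) e = ‖gradient ρ p‖ * c := h.inner_gradient_eq hp e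
    rw [inner_sub_left, h2] at h1
    have h3 : (‖gradient ρ p‖ * c) ^ 2 ≤ 2 * inner ℝ (gradient ρ x) e ^ 2 +
        2 * (L' * ‖x - p‖ * ‖e‖) ^ 2 := by
      have := sq_le_sq' (abs_le.1 h1).1 (abs_le.1 h1).2
      nlinarith [sq_nonneg (2 * inner ℝ (gradient ρ x) e - ‖gradient ρ p‖ * c)]
    have h4 : c ^ 2 ≤ (‖gradient ρ p‖ * c) ^ 2 := by
      rw [mul_pow]
      exact le_mul_of_one_le_left (sq_nonneg c) (one_le_pow₀ hg1)
    rw [mul_pow] at h3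
    linarith
  have hmain : κ / 4 * ‖e‖ ^ 2 ≤ (1 + 2 * K * ρ x) * inner ℝ (fderiv ℝ (gradient ρ) x e) e
      + 2 * K * inner ℝ (gradient ρ x) e ^ 2 := by
    have a1 : -(2 * K * (L' * ‖x - p‖) * (L' * ‖e‖ ^ 2)) ≤
        2 * K * ρ x * inner ℝ (fderiv ℝ (gradient ρ) x e) e := by
      have : |2 * K * ρ x * inner ℝ (fderiv ℝ (gradient ρ) x e) e| ≤
          2 * K * (L' * ‖x - p‖) * (L' * ‖e‖ ^ 2) := by
        rw [abs_mul, abs_mul, abs_of_pos (by positivity : 0 < 2 * K)]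
        gcongr
        rw [abs_of_nonpos hρ0]
        linarith
      exact (abs_le.1 this).1
    have a2 : 2 * K * (L' * ‖x - p‖) ^ 2 * ‖e‖ ^ 2 ≤ 2 * K * L' ^ 2 * ‖x - p‖ * ‖e‖ ^ 2 := by
      have : ‖x - p‖ ^ 2 ≤ ‖x - p‖ := by nlinarith
      calc _ = 2 * K * L' ^ 2 * ‖e‖ ^ 2 * ‖x - p‖ ^ 2 := by ring
        _ ≤ 2 * K * L' ^ 2 * ‖e‖ ^ 2 * ‖x - p‖ := by gcongr
        _ = _ := by ring
    have a3 : D * ‖x - p‖ * ‖e‖ ^ 2 ≤ κ / 4 * ‖e‖ ^ 2 := by gcongr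
    have a4 := mul_le_mul_of_nonneg_left hgrad (by positivity : 0 ≤ 2 * K)
    rw [hD] at a3
    linarith
  have hgL : ‖gradient ρ p‖ ≤ L' := (h.norm_gradient_le hpc).trans hLL'
  rw [UCDomain.hessForm, ← div_eq_inv_mul, le_div_iff₀ hgp]
  refine le_trans ?_ hmain
  have m1 : min 1 (κ / (8 * L')) ≤ κ / (8 * L') := min_le_right _ _
  have m0 : 0 < min 1 (κ / (8 * L')) := lt_min one_pos (by positivity)
  calc 2 * min 1 (κ / (8 * L')) * ‖e‖ ^ 2 * ‖gradient ρ p‖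
      ≤ 2 * (κ / (8 * L')) * ‖e‖ ^ 2 * L' := by gcongr
    _ = κ / 4 * ‖e‖ ^ 2 := by
      field_simp
      ring

namespace UCDomain

variable {n : ℕ} {Ω : Set (Euc n)} {ρ : Euc n → ℝ} {L κ : ℝ} {p x : Euc n}

lemma hasDerivAt_convexified (h : UCDomain Ω ρ L κ) (K : ℝ) (p x v : Euc n) (t : ℝ) :
    HasDerivAt (fun t : ℝ => ‖gradient ρ p‖⁻¹ * (ρ (x + t • v) + K * ρ (x + t • v) ^ 2))
      (‖gradient ρ p‖⁻¹ * ((1 + 2 * K * ρ (x + t • v)) * inner ℝ (gradient ρ (x + t • v)) v))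
      t := by
  have h1 := h.hasDerivAt_line x v t
  refine ((h1.add ((h1.pow 2).const_mul K)).const_mul _).congr_deriv ?_
  push_cast
  ring

lemma hasDerivAt_convexified_deriv (h : UCDomain Ω ρ L κ) (K : ℝ) (p x v : Euc n) (t : ℝ) :
    HasDerivAt (fun t : ℝ => ‖gradient ρ p‖⁻¹ *
      ((1 + 2 * K * ρ (x + t • v)) * inner ℝ (gradient ρ (x + t • v)) v))
      (hessForm ρ K p (x + t • v) v) t := by
  have h1 := h.hasDerivAt_line x v t
  have h2 := h.hasDerivAt_gradient_line x v v t
  refine ((((h1.const_mul (2 * K)).const_add 1).mul h2).const_mul _).congr_deriv ?_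
  rw [hessForm]
  ring

end UCDomain

/-- Quantitative strict convexity of `Ω` at boundary points. -/
theorem exists_strict_convexity (L κ : ℝ) (hκ : 0 < κ) :
    ∃ r₀ k₁ : ℝ, 0 < r₀ ∧ 0 < k₁ ∧
      ∀ (n : ℕ) (Ω : Set (Euc n)) (ρ : Euc n → ℝ), UCDomain Ω ρ L κ → ∀ p ∈ frontier Ω,
        ∀ x ∈ closure Ω, k₁ * min r₀ ‖x - p‖ * ‖x - p‖ ≤ inner ℝ (normalField ρ p) (p - x) := by
  obtain ⟨K, r₀, k₁, hK, hr0, -, hk1, -, H⟩ := exists_convexity_constants L κ hκ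
  refine ⟨r₀, k₁, hr0, hk1, ?_⟩
  intro n Ω ρ h p hp x hx
  have hpc := frontier_subset_closure hp
  have hg : 0 < ‖gradient ρ p‖ := zero_lt_one.trans_le (h.one_le_norm_gradient hp)
  have local_est : ∀ y ∈ closure Ω, ‖y - p‖ ≤ r₀ →
      k₁ * ‖y - p‖ ^ 2 ≤ inner ℝ (normalField ρ p) (p - y) := by
    intro y hy hyp
    have hmem : ∀ t ∈ Icc (0 : ℝ) 1, p + t • (y - p) ∈ closure Ω := fun t ht =>
      h.convex_closure.add_smul_sub_mem hpc hy ht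
    -- Taylor along the segment from p to y: the convexified function is 0 at p, nonpositive at y,
    -- and has second derivative at least 2k₁|y - p|², so the linear term ⟨N, y - p⟩ must
    -- compensate.
    have h1 := add_half_le_of_second_deriv (c := 2 * k₁ * ‖y - p‖ ^ 2)
      (fun t _ => h.hasDerivAt_convexified K p p (y - p) t)
      (fun t _ => h.hasDerivAt_convexified_deriv K p p (y - p) t) (fun t ht => by
        refine (H n Ω ρ h p hp _ (hmem t ht) ?_).2 (y - p)
        rw [add_sub_cancel_left, norm_smul, Real.norm_of_nonneg ht.1]
        nlinarith [norm_nonneg (y - p), ht.2])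
    simp only [zero_smul, add_zero, one_smul, add_sub_cancel, h.eq_zero_of_mem_frontier hp,
      mul_zero, one_mul, zero_pow two_ne_zero] at h1
    have h2 : ρ y + K * ρ y ^ 2 ≤ 0 := by
      have h3 := (H n Ω ρ h p hp y hy hyp).1
      have h4 := h.nonpos_of_mem_closure hy
      nlinarith
    have h5 : ‖gradient ρ p‖⁻¹ * (ρ y + K * ρ y ^ 2) ≤ 0 :=
      mul_nonpos_of_nonneg_of_nonpos (inv_nonneg.2 hg.le) h2
    rw [h.inner_gradient_eq hp, inv_mul_cancel_left₀ hg.ne'] at h1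
    rw [← neg_sub y p, inner_neg_right]
    linarith
  rcases le_or_gt ‖x - p‖ r₀ with hle | hlt
  · rw [min_eq_right hle]
    have := local_est x hx hle
    nlinarith
  · rw [min_eq_left hlt.le]
    have hpos : 0 < ‖x - p‖ := hr0.trans hlt
    set t : ℝ := r₀ / ‖x - p‖ with ht
    have ht0 : 0 < t := by positivity
    have ht1 : t ≤ 1 := (div_le_one hpos).2 hlt.le
    have hnorm : ‖p + t • (x - p) - p‖ = r₀ := by
      rw [add_sub_cancel_left, norm_smul, Real.norm_of_nonneg ht0.le, ht, div_mul_cancel₀ _ hpos.ne']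
    have h1 := local_est (p + t • (x - p))
      (h.convex_closure.add_smul_sub_mem hpc hx ⟨ht0.le, ht1⟩) hnorm.le
    have e : p - (p + t • (x - p)) = t • (p - x) := by
      rw [smul_sub, smul_sub]
      abel
    rw [hnorm, e, real_inner_smul_right] at h1
    have h2 : t * (k₁ * r₀ * ‖x - p‖) ≤ t * inner ℝ (normalField ρ p) (p - x) := by
      have : t * (k₁ * r₀ * ‖x - p‖) = k₁ * r₀ ^ 2 := by
        rw [ht]
        field_simp
      linarith
    exact le_of_mul_le_mul_left h2 ht0

/-- Maximize ⟨e, ·⟩. Every v with ⟨∇ρ(p), v⟩ < 0 points into Ω, hence ⟨e, v⟩ ≤ 0 for all such v,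
which forces the unit vectors e and N(p) to coincide. -/
lemma UCDomain.exists_support_point {n : ℕ} {Ω : Set (Euc n)} {ρ : Euc n → ℝ} {L κ : ℝ}
    (h : UCDomain Ω ρ L κ) {e : Euc n} (he : ‖e‖ = 1) :
    ∃ p ∈ frontier Ω, normalField ρ p = e ∧ ∀ x ∈ closure Ω, inner ℝ e x ≤ inner ℝ e p := by
  obtain ⟨p, hp, hmax⟩ := h.isCompact_closure.exists_isMaxOn h.nonempty.closure
    (f := fun x => inner ℝ e x) (by fun_prop)
  have hmax' : ∀ x ∈ closure Ω, inner ℝ e x ≤ inner ℝ e p := fun x hx => hmax hx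
  have small : ∀ v : Euc n, inner ℝ e v > 0 → ∀ᶠ t in 𝓝[>] (0 : ℝ), p + t • v ∉ closure Ω := by
    intro v hv
    filter_upwards [self_mem_nhdsWithin] with t ht hmem
    have := hmax' _ hmem
    rw [inner_add_right, real_inner_smul_right] at this
    have : 0 < t * inner ℝ e v := mul_pos ht hv
    linarith
  have hpf : p ∈ frontier Ω := by
    refine (h.mem_or_mem_frontier hp).resolve_left fun hpΩ => ?_
    have hc : Tendsto (fun t : ℝ => p + t • e) (𝓝[>] 0) (𝓝 p) := by
      have : Continuous fun t : ℝ => p + t • e := by fun_prop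
      simpa using (this.tendsto 0).mono_left nhdsWithin_le_nhds
    obtain ⟨t, ht, ht'⟩ := ((hc.eventually (h.isOpen.mem_nhds hpΩ)).and
      (small e (by rw [real_inner_self_eq_norm_sq, he]; norm_num))).exists
    exact ht' (subset_closure ht)
  have hg : 0 < ‖gradient ρ p‖ := zero_lt_one.trans_le (h.one_le_norm_gradient hpf)
  have inward : ∀ v : Euc n, inner ℝ (gradient ρ p) v < 0 → inner ℝ e v ≤ 0 := by
    intro v hv
    by_contra! hpos
    have hd := h.hasDerivAt_line p v 0
    simp only [zero_smul, add_zero] at hd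
    have hslope := (hasDerivAt_iff_tendsto_slope.1 hd).mono_left
      (nhdsWithin_mono (0 : ℝ) (show Ioi (0 : ℝ) ⊆ {0}ᶜ from fun x hx => ne_of_gt hx))
    obtain ⟨t, ⟨ht1, ht2⟩, ht0⟩ := (((hslope.eventually (Iio_mem_nhds hv)).and
      (small v hpos)).and self_mem_nhdsWithin).exists
    rw [slope_def_field] at ht1
    simp only [zero_smul, add_zero, sub_zero, h.eq_zero_of_mem_frontier hpf] at ht1
    refine ht2 (subset_closure (h.mem_iff.2 ?_))
    have := (div_lt_iff₀ (show (0 : ℝ) < t from ht0)).1 ht1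
    linarith
  refine ⟨p, hpf, ?_, hmax'⟩
  set N := normalField ρ p with hN
  have hNn : ‖N‖ = 1 := h.norm_normalField hpf
  set c : ℝ := inner ℝ N e with hc
  have hc0 : 0 ≤ c := by
    have := inward (-N) (by
      rw [inner_neg_right, h.inner_gradient_eq hpf, real_inner_self_eq_norm_sq, ← hN, hNn]
      linarith)
    rw [inner_neg_right, real_inner_comm] at this
    linarith
  have hcc : 1 - c ^ 2 ≤ 0 := by
    refine le_of_forall_pos_le_add fun δ hδ => ?_
    have h1 := inward (e - c • N - δ • N) (by
      rw [inner_sub_right, inner_sub_right, real_inner_smul_right, real_inner_smul_right,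
        h.inner_gradient_eq hpf, h.inner_gradient_eq hpf, real_inner_self_eq_norm_sq, ← hN, hNn,
        ← hc]
      have := mul_pos hδ hg
      linarith)
    rw [inner_sub_right, inner_sub_right, real_inner_smul_right, real_inner_smul_right,
      real_inner_self_eq_norm_sq, he, real_inner_comm, ← hc] at h1
    have hc1 : c ≤ 1 := by
      have := real_inner_le_norm N e
      rw [hNn, he] at this
      linarith
    nlinarith
  have hc1 : c ≤ 1 := by
    have := real_inner_le_norm N e
    rw [hNn, he] at this
    linarith
  have hceq : c = 1 := le_antisymm hc1 (by nlinarith)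
  rw [hceq] at hc
  exact (inner_eq_one_iff_of_norm_eq_one hNn he).1 hc.symm

/-- A uniformly convex domain has controlled diameter. -/
theorem exists_diameter_bound (L κ : ℝ) (hκ : 0 < κ) :
    ∃ D : ℝ, 0 < D ∧ ∀ (n : ℕ) (Ω : Set (Euc n)) (ρ : Euc n → ℝ), 2 ≤ n → UCDomain Ω ρ L κ →
      ∀ x ∈ closure Ω, ∀ y ∈ closure Ω, ‖x - y‖ ≤ D := by
  obtain ⟨r₀, k₁, hr0, hk1, H⟩ := exists_strict_convexity L κ hκ
  -- By strict convexity the support point moves by at most r₀ when the normal turns by less than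
  -- 2k₁r₀. A half turn takes m such steps, so the width in every direction is at most m r₀.
  obtain ⟨m, hm⟩ := exists_nat_gt (Real.pi / (2 * k₁ * r₀))
  have hm0 : (0 : ℝ) < m := lt_of_le_of_lt (by positivity) hm
  refine ⟨m * r₀, by positivity, ?_⟩
  intro n Ω ρ hn h x hx y hy
  have hmr : 0 < (m : ℝ) * r₀ := by positivity
  rcases eq_or_ne x y with rfl | hxy
  · simpa using hmr.le
  have hd : 0 < ‖x - y‖ := norm_pos_iff.2 (sub_ne_zero.2 hxy)
  set a : Euc n := ‖x - y‖⁻¹ • (x - y) with ha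
  have han : ‖a‖ = 1 := by rw [ha, norm_smul, norm_inv, norm_norm, inv_mul_cancel₀ hd.ne']
  -- The half turn from a to -a needs a second dimension; this is where 2 ≤ n enters.
  obtain ⟨b, hbn, hab⟩ : ∃ b : Euc n, ‖b‖ = 1 ∧ inner ℝ a b = 0 := by
    have hfin : Module.finrank ℝ (Submodule.span ℝ {a})ᗮ = n - 1 := by
      have h1 := (Submodule.span ℝ {a}).finrank_add_finrank_orthogonal
      rw [finrank_span_singleton (norm_ne_zero_iff.1 (by rw [han]; norm_num)),
        finrank_euclideanSpace_fin] at h1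
      omega
    have hnt : Nontrivial (Submodule.span ℝ {a})ᗮ :=
      Module.nontrivial_of_finrank_pos (R := ℝ) (by omega)
    obtain ⟨⟨w, hw⟩, hw0⟩ := exists_ne (0 : (Submodule.span ℝ {a})ᗮ)
    have hw0' : w ≠ 0 := fun hw' => hw0 (by simp [hw'])
    refine ⟨‖w‖⁻¹ • w, ?_, ?_⟩
    · rw [norm_smul, norm_inv, norm_norm, inv_mul_cancel₀ (norm_ne_zero_iff.2 hw0')]
    · rw [real_inner_smul_right, Submodule.mem_orthogonal_singleton_iff_inner_right.1 hw, mul_zero]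
  set E : ℝ → Euc n := fun t => Real.cos t • a + Real.sin t • b with hE
  have hinner : ∀ s t, inner ℝ (E s) (E t) = Real.cos (s - t) := by
    intro s t
    simp only [hE, inner_add_left, inner_add_right, real_inner_smul_left, real_inner_smul_right,
      hab, real_inner_comm a b, real_inner_self_eq_norm_sq, han, hbn]
    rw [Real.cos_sub]
    ring
  have hEn : ∀ t, ‖E t‖ = 1 := by
    intro t
    have h1 := hinner t t
    rw [real_inner_self_eq_norm_sq, sub_self, Real.cos_zero] at h1
    exact (pow_eq_one_iff_of_nonneg (norm_nonneg _) two_ne_zero).1 h1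
  have hElip : ∀ s t, ‖E s - E t‖ ≤ |s - t| := by
    intro s t
    have h1 : ‖E s - E t‖ ^ 2 ≤ |s - t| ^ 2 := by
      rw [norm_sub_sq_real, hEn, hEn, hinner, sq_abs]
      linarith [Real.one_sub_sq_div_two_le_cos (x := s - t)]
    exact (sq_le_sq₀ (norm_nonneg _) (abs_nonneg _)).1 h1
  choose P hPf hPN hPmax using fun t => h.exists_support_point (hEn t)
  have step : ∀ s t, |s - t| < 2 * k₁ * r₀ → ‖P s - P t‖ ≤ r₀ := by
    intro s t hst
    by_contra! hlt
    have h1 := H n Ω ρ h (P s) (hPf s) (P t) (frontier_subset_closure (hPf t))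
    have h2 := H n Ω ρ h (P t) (hPf t) (P s) (frontier_subset_closure (hPf s))
    rw [norm_sub_rev (P t) (P s), min_eq_left hlt.le, hPN] at h1
    rw [min_eq_left hlt.le, hPN] at h2
    have h3 : inner ℝ (E s) (P s - P t) + inner ℝ (E t) (P t - P s) =
        inner ℝ (E s - E t) (P s - P t) := by
      rw [inner_sub_left, ← neg_sub (P s) (P t), inner_neg_right]
      ring
    have h4 : inner ℝ (E s - E t) (P s - P t) ≤ |s - t| * ‖P s - P t‖ :=
      (real_inner_le_norm _ _).trans (by gcongr; exact hElip s t)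
    have hpos : 0 < ‖P s - P t‖ := hr0.trans hlt
    nlinarith
  have chain : ∀ j : ℕ, ‖P (j * (Real.pi / m)) - P 0‖ ≤ j * r₀ := by
    intro j
    induction j with
    | zero => simp
    | succ j ih =>
      have h1 := step ((j + 1 : ℕ) * (Real.pi / m)) (j * (Real.pi / m)) (by
        have : ((j + 1 : ℕ) : ℝ) * (Real.pi / m) - j * (Real.pi / m) = Real.pi / m := by
          push_cast
          ring
        rw [this, abs_of_pos (by positivity), div_lt_iff₀ hm0]
        rw [div_lt_iff₀ (by positivity)] at hm
        linarith)
      calc _ ≤ ‖P ((j + 1 : ℕ) * (Real.pi / m)) - P (j * (Real.pi / m))‖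
            + ‖P (j * (Real.pi / m)) - P 0‖ := norm_sub_le_norm_sub_add_norm_sub _ _ _
        _ ≤ r₀ + j * r₀ := add_le_add h1 ih
        _ = _ := by push_cast; ring
  have h1 := chain m
  rw [mul_div_cancel₀ _ hm0.ne'] at h1
  have e0 : E 0 = a := by simp [hE]
  have epi : E Real.pi = -a := by simp [hE]
  have h2 := hPmax 0 x hx
  have h3 := hPmax Real.pi y hy
  rw [e0] at h2
  rw [epi, inner_neg_left, inner_neg_left] at h3
  have h4 : inner ℝ a (x - y) = ‖x - y‖ := by
    rw [ha, real_inner_smul_left, real_inner_self_eq_norm_sq]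
    field_simp
  have h5 : inner ℝ a (P 0 - P Real.pi) ≤ ‖P Real.pi - P 0‖ := by
    have := real_inner_le_norm a (P 0 - P Real.pi)
    rw [han, one_mul, norm_sub_rev] at this
    exact this
  rw [inner_sub_right] at h4 h5
  linarith

/-! ### Second derivatives of curves at the origin -/

section SecondDerivative

variable {E V W X : Type*} [NormedAddCommGroup E] [NormedSpace ℝ E] [NormedAddCommGroup V]
  [NormedSpace ℝ V] [NormedAddCommGroup W] [NormedSpace ℝ W] [NormedAddCommGroup X]
  [NormedSpace ℝ X]

/-- The curve `a` is twice differentiable at `0`, with first and second derivatives `a₁`, `a₂`. -/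
def HasD2 (a : ℝ → V) (a₁ a₂ : V) : Prop :=
  ∃ a' : ℝ → V, (∀ᶠ t in 𝓝 0, HasDerivAt a (a' t) t) ∧ a' 0 = a₁ ∧ HasDerivAt a' a₂ 0

lemma HasD2.congr {a : ℝ → V} {a₁ a₂ b₁ b₂ : V} (h : HasD2 a a₁ a₂) (h1 : a₁ = b₁)
    (h2 : a₂ = b₂) : HasD2 a b₁ b₂ := h1 ▸ h2 ▸ h

lemma HasD2.const (c : V) : HasD2 (fun _ => c) 0 0 :=
  ⟨fun _ => 0, Eventually.of_forall fun t => hasDerivAt_const t c, rfl, hasDerivAt_const 0 0⟩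

lemma HasD2.add {a b : ℝ → V} {a₁ a₂ b₁ b₂ : V} (ha : HasD2 a a₁ a₂) (hb : HasD2 b b₁ b₂) :
    HasD2 (fun t => a t + b t) (a₁ + b₁) (a₂ + b₂) := by
  obtain ⟨a', h1, rfl, h2⟩ := ha
  obtain ⟨b', h3, rfl, h4⟩ := hb
  exact ⟨fun t => a' t + b' t, by filter_upwards [h1, h3] with t ht ht' using ht.add ht', rfl,
    h2.add h4⟩

lemma HasD2.sub {a b : ℝ → V} {a₁ a₂ b₁ b₂ : V} (ha : HasD2 a a₁ a₂) (hb : HasD2 b b₁ b₂) :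
    HasD2 (fun t => a t - b t) (a₁ - b₁) (a₂ - b₂) := by
  obtain ⟨a', h1, rfl, h2⟩ := ha
  obtain ⟨b', h3, rfl, h4⟩ := hb
  exact ⟨fun t => a' t - b' t, by filter_upwards [h1, h3] with t ht ht' using ht.sub ht', rfl,
    h2.sub h4⟩

lemma HasD2.sum {ι : Type*} (s : Finset ι) {a : ι → ℝ → V} {a₁ a₂ : ι → V}
    (h : ∀ i, HasD2 (a i) (a₁ i) (a₂ i)) :
    HasD2 (fun t => ∑ i ∈ s, a i t) (∑ i ∈ s, a₁ i) (∑ i ∈ s, a₂ i) := by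
  classical
  induction s using Finset.induction_on with
  | empty => simpa using HasD2.const (0 : V)
  | insert i s hi ih =>
    simp only [Finset.sum_insert hi]
    exact (h i).add ih

lemma HasD2.clm (T : V →L[ℝ] W) {a : ℝ → V} {a₁ a₂ : V} (ha : HasD2 a a₁ a₂) :
    HasD2 (fun t => T (a t)) (T a₁) (T a₂) := by
  obtain ⟨a', h1, rfl, h2⟩ := ha
  exact ⟨fun t => T (a' t), by
    filter_upwards [h1] with t ht using T.hasFDerivAt.comp_hasDerivAt t ht, rfl,
    T.hasFDerivAt.comp_hasDerivAt 0 h2⟩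

lemma HasD2.bilin (B : V →L[ℝ] W →L[ℝ] X) {a : ℝ → V} {b : ℝ → W} {a₁ a₂ : V} {b₁ b₂ : W}
    (ha : HasD2 a a₁ a₂) (hb : HasD2 b b₁ b₂) :
    HasD2 (fun t => B (a t) (b t)) (B a₁ (b 0) + B (a 0) b₁)
      (B a₂ (b 0) + (2 : ℝ) • B a₁ b₁ + B (a 0) b₂) := by
  obtain ⟨a', h1, rfl, h2⟩ := ha
  obtain ⟨b', h3, rfl, h4⟩ := hb
  have key : ∀ {f : ℝ → V} {g : ℝ → W} {f' : V} {g' : W} {t : ℝ}, HasDerivAt f f' t →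
      HasDerivAt g g' t → HasDerivAt (fun t => B (f t) (g t)) (B f' (g t) + B (f t) g') t := by
    intro f g f' g' t hf hg
    exact (B.hasFDerivAt.comp_hasDerivAt t hf).clm_apply hg
  refine ⟨fun t => B (a' t) (b t) + B (a t) (b' t), ?_, rfl, ?_⟩
  · filter_upwards [h1, h3] with t ht ht' using key ht ht'
  · refine ((key h2 h3.self_of_nhds).add (key h1.self_of_nhds h4)).congr_deriv ?_
    rw [two_smul]
    abel

lemma HasD2.mul {a b : ℝ → ℝ} {a₁ a₂ b₁ b₂ : ℝ} (ha : HasD2 a a₁ a₂) (hb : HasD2 b b₁ b₂) :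
    HasD2 (fun t => a t * b t) (a₁ * b 0 + a 0 * b₁) (a₂ * b 0 + 2 * (a₁ * b₁) + a 0 * b₂) :=
  HasD2.bilin (ContinuousLinearMap.mul ℝ ℝ) ha hb

lemma HasD2.const_mul (c : ℝ) {a : ℝ → ℝ} {a₁ a₂ : ℝ} (ha : HasD2 a a₁ a₂) :
    HasD2 (fun t => c * a t) (c * a₁) (c * a₂) :=
  HasD2.clm (ContinuousLinearMap.mul ℝ ℝ c) ha

lemma HasD2.comp {g : V → W} {g' : V → V →L[ℝ] W} {g'' : V →L[ℝ] V →L[ℝ] W} {a : ℝ → V}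
    {a₁ a₂ : V} (ha : HasD2 a a₁ a₂) (h1 : ∀ᶠ y in 𝓝 (a 0), HasFDerivAt g (g' y) y)
    (h2 : HasFDerivAt g' g'' (a 0)) :
    HasD2 (fun t => g (a t)) (g' (a 0) a₁) (g'' a₁ a₁ + g' (a 0) a₂) := by
  obtain ⟨a', h3, rfl, h4⟩ := ha
  have hc : ContinuousAt a 0 := h3.self_of_nhds.continuousAt
  refine ⟨fun t => g' (a t) (a' t), ?_, rfl, ?_⟩
  · filter_upwards [h3, hc.eventually h1] with t ht ht' using ht'.comp_hasDerivAt t ht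
  · exact (h2.comp_hasDerivAt 0 h3.self_of_nhds).clm_apply h4

lemma HasD2.line (x e : E) : HasD2 (fun t : ℝ => x + t • e) e 0 :=
  ⟨fun _ => e, Eventually.of_forall fun t => by
    simpa using ((hasDerivAt_id t).smul_const e).const_add x, rfl, hasDerivAt_const 0 e⟩

lemma HasD2.along {g : E → W} {g' : E → E →L[ℝ] W} {g'' : E →L[ℝ] E →L[ℝ] W} {x : E} (e : E)
    (h1 : ∀ᶠ y in 𝓝 x, HasFDerivAt g (g' y) y) (h2 : HasFDerivAt g' g'' x) :
    HasD2 (fun t : ℝ => g (x + t • e)) (g' x e) (g'' e e) := by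
  have h := (HasD2.line x e).comp (g := g) (g' := g') (g'' := g'') (by simpa using h1)
    (by simpa using h2)
  simpa using h

/-- The second derivative is assumed only at 0. If it were positive, 0 would also be a local
minimum, so the curve would be locally constant and its second derivative 0. -/
lemma HasD2.eq_zero_and_nonpos {a : ℝ → ℝ} {a₁ a₂ : ℝ} (h : HasD2 a a₁ a₂)
    (hmax : IsLocalMax a 0) : a₁ = 0 ∧ a₂ ≤ 0 := by
  obtain ⟨a', h1, rfl, h2⟩ := h
  have h0 : a' 0 = 0 := hmax.hasDerivAt_eq_zero h1.self_of_nhds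
  refine ⟨h0, ?_⟩
  by_contra! hpos
  have hd : deriv a =ᶠ[𝓝 0] a' := h1.mono fun t ht => ht.deriv
  have hdd : deriv (deriv a) 0 = a₂ := (h2.congr_of_eventuallyEq hd).deriv
  have hmin : IsLocalMin a 0 := isLocalMin_of_deriv_deriv_pos (hdd.symm ▸ hpos)
    (hd.self_of_nhds.trans h0) h1.self_of_nhds.continuousAt
  have hconst : a =ᶠ[𝓝 0] fun _ => a 0 := by
    filter_upwards [hmax, hmin] with t ht ht' using le_antisymm ht ht'
  have hz : deriv a =ᶠ[𝓝 0] fun _ => 0 := by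
    have := hconst.deriv
    simpa using this
  have : deriv (deriv a) 0 = 0 := by
    rw [hz.deriv_eq]
    simp
  linarith

lemma HasD2.eq_zero_and_nonneg {a : ℝ → ℝ} {a₁ a₂ : ℝ} (h : HasD2 a a₁ a₂)
    (hmin : IsLocalMin a 0) : a₁ = 0 ∧ 0 ≤ a₂ := by
  have h1 := ((HasD2.const (0 : ℝ)).sub h).eq_zero_and_nonpos (by
    filter_upwards [hmin] with t ht
    simpa using ht)
  constructor <;> linarith [h1.1, h1.2]

/-- A curve whose value, first and second derivatives at `0` are bounded by `C`, `C` and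
`C (1 + μ)`. -/
def BoundedD2 (a : ℝ → V) (C μ : ℝ) : Prop :=
  ∃ a₁ a₂ : V, HasD2 a a₁ a₂ ∧ ‖a 0‖ ≤ C ∧ ‖a₁‖ ≤ C ∧ ‖a₂‖ ≤ C * (1 + μ)

lemma BoundedD2.mono {a : ℝ → V} {C D μ : ℝ} (h : BoundedD2 a C μ) (hμ : 0 ≤ μ) (hCD : C ≤ D) :
    BoundedD2 a D μ := by
  obtain ⟨a₁, a₂, h1, h2, h3, h4⟩ := h
  exact ⟨a₁, a₂, h1, h2.trans hCD, h3.trans hCD, h4.trans (by gcongr)⟩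

lemma BoundedD2.const (c : V) {C μ : ℝ} (hμ : 0 ≤ μ) (hc : ‖c‖ ≤ C) :
    BoundedD2 (fun _ => c) C μ := by
  have hC : 0 ≤ C := (norm_nonneg _).trans hc
  exact ⟨0, 0, HasD2.const c, hc, by simpa using hC, by
    rw [norm_zero]
    positivity⟩

lemma BoundedD2.sub {a b : ℝ → V} {C D μ : ℝ} (ha : BoundedD2 a C μ) (hb : BoundedD2 b D μ) :
    BoundedD2 (fun t => a t - b t) (C + D) μ := by
  obtain ⟨a₁, a₂, h1, h2, h3, h4⟩ := ha
  obtain ⟨b₁, b₂, k1, k2, k3, k4⟩ := hb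
  refine ⟨_, _, h1.sub k1, (norm_sub_le _ _).trans (by linarith),
    (norm_sub_le _ _).trans (by linarith), (norm_sub_le _ _).trans (by linarith)⟩

lemma BoundedD2.clm (T : V →L[ℝ] W) {K : ℝ} (hT : ‖T‖ ≤ K) {a : ℝ → V} {C μ : ℝ}
    (ha : BoundedD2 a C μ) : BoundedD2 (fun t => T (a t)) (K * C) μ := by
  obtain ⟨a₁, a₂, h1, h2, h3, h4⟩ := ha
  have hK : 0 ≤ K := (norm_nonneg _).trans hT
  refine ⟨_, _, h1.clm T, (T.le_of_opNorm_le hT _).trans (by gcongr),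
    (T.le_of_opNorm_le hT _).trans (by gcongr), (T.le_of_opNorm_le hT _).trans ?_⟩
  rw [mul_assoc]
  gcongr

/-- The factor 4 comes from the second derivative: CD(1 + μ) twice, plus 2CD from the product of
first derivatives. -/
lemma BoundedD2.bilin (B : V →L[ℝ] W →L[ℝ] X) (hB : ‖B‖ ≤ 1) {a : ℝ → V} {b : ℝ → W}
    {C D μ : ℝ} (hμ : 0 ≤ μ) (ha : BoundedD2 a C μ) (hb : BoundedD2 b D μ) :
    BoundedD2 (fun t => B (a t) (b t)) (4 * (C * D)) μ := by
  obtain ⟨a₁, a₂, h1, h2, h3, h4⟩ := ha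
  obtain ⟨b₁, b₂, k1, k2, k3, k4⟩ := hb
  have hC : 0 ≤ C := (norm_nonneg _).trans h2
  have hD : 0 ≤ D := (norm_nonneg _).trans k2
  have key : ∀ {x : V} {y : W} {c d : ℝ}, ‖x‖ ≤ c → ‖y‖ ≤ d → ‖B x y‖ ≤ c * d := by
    intro x y c d hx hy
    have hc : 0 ≤ c := (norm_nonneg x).trans hx
    calc ‖B x y‖ ≤ ‖B‖ * ‖x‖ * ‖y‖ := B.le_opNorm₂ x y
      _ ≤ 1 * c * d := by gcongr
      _ = c * d := by ring
  have hCD : 0 ≤ C * D := mul_nonneg hC hD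
  have hCDμ : 0 ≤ C * D * μ := mul_nonneg hCD hμ
  refine ⟨_, _, h1.bilin B k1, (key h2 k2).trans (by linarith), ?_, ?_⟩
  · refine (norm_add_le _ _).trans ?_
    linarith [key h3 k2, key h2 k3]
  · refine (norm_add₃_le).trans ?_
    rw [norm_smul, Real.norm_of_nonneg zero_le_two]
    have e1 := key h4 k2
    have e2 := key h3 k3
    have e3 := key h2 k4
    nlinarith

lemma BoundedD2.clm_apply {a : ℝ → V →L[ℝ] W} {b : ℝ → V} {C D μ : ℝ} (hμ : 0 ≤ μ)
    (ha : BoundedD2 a C μ) (hb : BoundedD2 b D μ) :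
    BoundedD2 (fun t => a t (b t)) (4 * (C * D)) μ :=
  ha.bilin (ContinuousLinearMap.id ℝ (V →L[ℝ] W)) ContinuousLinearMap.norm_id_le hμ hb

lemma BoundedD2.smul {a : ℝ → ℝ} {b : ℝ → V} {C D μ : ℝ} (hμ : 0 ≤ μ)
    (ha : BoundedD2 a C μ) (hb : BoundedD2 b D μ) :
    BoundedD2 (fun t => a t • b t) (4 * (C * D)) μ :=
  ha.bilin (ContinuousLinearMap.lsmul ℝ ℝ) ContinuousLinearMap.opNorm_lsmul_le hμ hb

lemma BoundedD2.mul {a b : ℝ → ℝ} {C D μ : ℝ} (hμ : 0 ≤ μ)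
    (ha : BoundedD2 a C μ) (hb : BoundedD2 b D μ) :
    BoundedD2 (fun t => a t * b t) (4 * (C * D)) μ :=
  ha.smul hμ hb

/-- The second derivative g''(a₁,a₁) + g'(a₂) grows only linearly in μ, the bound for a₂. In the
application μ is an eigenvalue of D²u in absolute value, and linear growth is what Σ F_i λ_i² can
absorb. -/
lemma BoundedD2.comp {g : V → W} {g' : V → V →L[ℝ] W} {g'' : V →L[ℝ] V →L[ℝ] W} {a : ℝ → V}
    {a₁ a₂ : V} {K A μ : ℝ} (hμ : 0 ≤ μ) (ha : HasD2 a a₁ a₂) (hA : 1 ≤ A) (h₁ : ‖a₁‖ ≤ A)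
    (h₂ : ‖a₂‖ ≤ μ) (h1 : ∀ᶠ y in 𝓝 (a 0), HasFDerivAt g (g' y) y)
    (h2 : HasFDerivAt g' g'' (a 0)) (b0 : ‖g (a 0)‖ ≤ K) (b1 : ‖g' (a 0)‖ ≤ K)
    (b2 : ‖g''‖ ≤ K) : BoundedD2 (fun t => g (a t)) (K * A ^ 2) μ := by
  have hK : 0 ≤ K := (norm_nonneg _).trans b0
  have hA2 : 1 ≤ A ^ 2 := one_le_pow₀ hA
  refine ⟨_, _, ha.comp h1 h2, b0.trans (le_mul_of_one_le_right hK hA2), ?_, ?_⟩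
  · calc _ ≤ K * ‖a₁‖ := ContinuousLinearMap.le_of_opNorm_le _ b1 _
      _ ≤ K * A ^ 2 := by
        gcongr
        nlinarith
  · refine (norm_add_le _ _).trans ?_
    have e1 : ‖g'' a₁ a₁‖ ≤ K * A ^ 2 := by
      calc _ ≤ ‖g''‖ * ‖a₁‖ * ‖a₁‖ := g''.le_opNorm₂ _ _
        _ ≤ K * A * A := by gcongr
        _ = _ := by ring
    have e2 : ‖g' (a 0) a₂‖ ≤ K * A ^ 2 * μ := by
      calc _ ≤ K * ‖a₂‖ := ContinuousLinearMap.le_of_opNorm_le _ b1 _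
        _ ≤ K * μ := by gcongr
        _ ≤ K * A ^ 2 * μ := by
          gcongr
          exact le_mul_of_one_le_right hK hA2
    linarith

lemma BoundedD2.along {g : E → W} {g' : E → E →L[ℝ] W} {g'' : E →L[ℝ] E →L[ℝ] W} {x e : E}
    {K μ : ℝ} (hμ : 0 ≤ μ) (he : ‖e‖ = 1) (h1 : ∀ᶠ y in 𝓝 x, HasFDerivAt g (g' y) y)
    (h2 : HasFDerivAt g' g'' x) (b0 : ‖g x‖ ≤ K) (b1 : ‖g' x‖ ≤ K) (b2 : ‖g''‖ ≤ K) :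
    BoundedD2 (fun t : ℝ => g (x + t • e)) K μ := by
  have h := BoundedD2.comp (g := g) (g' := g') (g'' := g'') (K := K) (A := 1) hμ
    (HasD2.line x e) le_rfl he.le (by simpa using hμ) (by simpa using h1) (by simpa using h2)
    (by simpa using b0) (by simpa using b1) b2
  simpa using h

end SecondDerivative

/-! ### Derivatives up to the boundary -/

section Within

variable {E V : Type*} [NormedAddCommGroup E] [NormedSpace ℝ E] [NormedAddCommGroup V]
  [NormedSpace ℝ V]

/-- The derivative of `g` within `S`, as a function. -/
noncomputable def D (S : Set E) (g : E → V) : E → E →L[ℝ] V := fderivWithin ℝ g S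

variable {S Ω : Set E} {g : E → V} {x : E}

lemma contDiffOn_D {m m' : WithTop ℕ∞} (hS : UniqueDiffOn ℝ S) (h : ContDiffOn ℝ m' g S)
    (hm : m + 1 ≤ m') : ContDiffOn ℝ m (D S g) S := h.fderivWithin hS hm

/-- At points of Ω derivatives within the closure are ordinary derivatives. One notation thus serves
both the C⁴ regularity inside and the C³ regularity up to the boundary. -/
lemma contDiffOn_D_of_isOpen {m m' : WithTop ℕ∞} (hΩ : IsOpen Ω) (hΩS : Ω ⊆ S)
    (h : ContDiffOn ℝ m' g Ω) (hm : m + 1 ≤ m') : ContDiffOn ℝ m (D S g) Ω :=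
  (h.fderiv_of_isOpen hΩ hm).congr fun _ hy =>
    fderivWithin_of_mem_nhds (mem_of_superset (hΩ.mem_nhds hy) hΩS)

lemma hasFDerivWithinAt_D {m : WithTop ℕ∞} (h : ContDiffOn ℝ m g S) (hm : 1 ≤ m) (hx : x ∈ S) :
    HasFDerivWithinAt g (D S g x) S x :=
  (h.differentiableOn (fun h0 => by simp [h0] at hm) x hx).hasFDerivWithinAt

lemma hasFDerivAt_D {m : WithTop ℕ∞} (hΩ : IsOpen Ω) (hΩS : Ω ⊆ S) (h : ContDiffOn ℝ m g Ω)
    (hm : 1 ≤ m) (hx : x ∈ Ω) : HasFDerivAt g (D S g x) x := by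
  have h1 : DifferentiableAt ℝ g x :=
    (h.differentiableOn (fun h0 => by simp [h0] at hm) x hx).differentiableAt (hΩ.mem_nhds hx)
  rw [D, fderivWithin_of_mem_nhds (mem_of_superset (hΩ.mem_nhds hx) hΩS)]
  exact h1.hasFDerivAt

lemma D_D_symm (hS : UniqueDiffOn ℝ S) (hSi : S ⊆ closure (interior S))
    (h : ContDiffOn ℝ 2 g S) (hx : x ∈ S) (a b : E) :
    D S (D S g) x a b = D S (D S g) x b a :=
  ((h x hx).isSymmSndFDerivWithinAt (by simp) hS (hSi hx) hx).eq a b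

lemma norm_D_eq (hS : UniqueDiffOn ℝ S) (hx : x ∈ S) :
    ‖D S g x‖ = ‖iteratedFDerivWithin ℝ 1 g S x‖ :=
  (norm_iteratedFDerivWithin_one g (hS x hx)).symm

lemma norm_D_D_eq (hS : UniqueDiffOn ℝ S) (hx : x ∈ S) :
    ‖D S (D S g) x‖ = ‖iteratedFDerivWithin ℝ 2 g S x‖ := by
  rw [norm_D_eq hS hx]
  exact norm_iteratedFDerivWithin_fderivWithin hS hx

lemma norm_D_D_D_eq (hS : UniqueDiffOn ℝ S) (hx : x ∈ S) :
    ‖D S (D S (D S g)) x‖ = ‖iteratedFDerivWithin ℝ 3 g S x‖ := by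
  rw [norm_D_D_eq hS hx]
  exact norm_iteratedFDerivWithin_fderivWithin hS hx

end Within

/-- All the hypotheses of the boundary value problem, bundled; the order of the equation
is `m + 1`. -/
structure Solution {n : ℕ} (m : ℕ) (Ω : Set (Euc n)) (ρ u : Euc n → ℝ) (f φ : Euc n × ℝ → ℝ)
    (L κ M f₀ Lf Lφ : ℝ) : Prop where
  dom : UCDomain Ω ρ L κ
  f_contDiff : ContDiffOn ℝ 2 f (closure Ω ×ˢ (univ : Set ℝ))
  f_pos : ∀ x ∈ closure Ω, ∀ z : ℝ, 0 < f (x, z)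
  φ_contDiff : ContDiffOn ℝ 3 φ (closure Ω ×ˢ (univ : Set ℝ))
  φ_anti : ∀ x ∈ closure Ω, Antitone fun z : ℝ => φ (x, z)
  u_contDiff : ContDiffOn ℝ 4 u Ω
  u_contDiff' : ContDiffOn ℝ 3 u (closure Ω)
  admissible : IsAdmissible (m + 1) Ω u
  equation : ∀ x ∈ Ω, sigma (m + 1) (hessianEigenvalues u x) = f (x, u x)
  boundary : ∀ x ∈ frontier Ω, fderivWithin ℝ u (closure Ω) x (outerNormal ρ x) = φ (x, u x)
  u_norm : CNormLE 1 u (closure Ω) (closure Ω) M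
  f_norm : CNormLE 2 f (closure Ω ×ˢ (univ : Set ℝ)) (valueRange Ω u) Lf
  f_lower : ∀ p ∈ valueRange Ω u, f₀ ≤ f p
  φ_norm : CNormLE 3 φ (closure Ω ×ˢ (univ : Set ℝ)) (valueRange Ω u) Lφ

/-! ### Regularity of the solution and of the data; diagonalization of the Hessian -/

namespace Solution

variable {n m : ℕ} {Ω : Set (Euc n)} {ρ u : Euc n → ℝ} {f φ : Euc n × ℝ → ℝ}
  {L κ M f₀ Lf Lφ : ℝ} {x : Euc n}

section

variable (h : Solution m Ω ρ u f φ L κ M f₀ Lf Lφ)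
include h

lemma interior_nonempty : (interior (closure Ω)).Nonempty :=
  h.dom.nonempty.mono (h.dom.isOpen.subset_interior_iff.2 subset_closure)

lemma uniqueDiffOn : UniqueDiffOn ℝ (closure Ω) :=
  uniqueDiffOn_convex h.dom.convex_closure h.interior_nonempty

lemma closure_subset : closure Ω ⊆ closure (interior (closure Ω)) :=
  closure_mono (h.dom.isOpen.subset_interior_iff.2 subset_closure)

lemma uniqueDiffOn_prod : UniqueDiffOn ℝ (closure Ω ×ˢ (univ : Set ℝ)) :=
  h.uniqueDiffOn.prod uniqueDiffOn_univ

/-! Regularity of `u` -/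

lemma contDiffOn_D1 : ContDiffOn ℝ 2 (D (closure Ω) u) (closure Ω) :=
  contDiffOn_D h.uniqueDiffOn h.u_contDiff' (by norm_num)

lemma contDiffOn_D2 : ContDiffOn ℝ 1 (D (closure Ω) (D (closure Ω) u)) (closure Ω) :=
  contDiffOn_D h.uniqueDiffOn h.contDiffOn_D1 (by norm_num)

lemma hasFDerivWithinAt_u (hx : x ∈ closure Ω) :
    HasFDerivWithinAt u (D (closure Ω) u x) (closure Ω) x :=
  hasFDerivWithinAt_D h.u_contDiff' (by norm_num) hx

lemma hasFDerivWithinAt_D1 (hx : x ∈ closure Ω) :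
    HasFDerivWithinAt (D (closure Ω) u) (D (closure Ω) (D (closure Ω) u) x) (closure Ω) x :=
  hasFDerivWithinAt_D h.contDiffOn_D1 (by norm_num) hx

lemma hasFDerivWithinAt_D2 (hx : x ∈ closure Ω) :
    HasFDerivWithinAt (D (closure Ω) (D (closure Ω) u))
      (D (closure Ω) (D (closure Ω) (D (closure Ω) u)) x) (closure Ω) x :=
  hasFDerivWithinAt_D h.contDiffOn_D2 le_rfl hx

lemma hasFDerivAt_u (hx : x ∈ Ω) : HasFDerivAt u (D (closure Ω) u x) x :=
  hasFDerivAt_D h.dom.isOpen subset_closure h.u_contDiff (by norm_num) hx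

lemma hasFDerivAt_D1 (hx : x ∈ Ω) :
    HasFDerivAt (D (closure Ω) u) (D (closure Ω) (D (closure Ω) u) x) x :=
  hasFDerivAt_D h.dom.isOpen subset_closure (contDiffOn_D_of_isOpen (m := 3) h.dom.isOpen
    subset_closure h.u_contDiff (by norm_num)) (by norm_num) hx

lemma contDiffOn_D2_interior : ContDiffOn ℝ 2 (D (closure Ω) (D (closure Ω) u)) Ω :=
  contDiffOn_D_of_isOpen h.dom.isOpen subset_closure
    (contDiffOn_D_of_isOpen (m := 3) h.dom.isOpen subset_closure h.u_contDiff (by norm_num))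
    (by norm_num)

lemma hasFDerivAt_D2 (hx : x ∈ Ω) :
    HasFDerivAt (D (closure Ω) (D (closure Ω) u))
      (D (closure Ω) (D (closure Ω) (D (closure Ω) u)) x) x :=
  hasFDerivAt_D h.dom.isOpen subset_closure h.contDiffOn_D2_interior (by norm_num) hx

lemma hasFDerivAt_D3 (hx : x ∈ Ω) :
    HasFDerivAt (D (closure Ω) (D (closure Ω) (D (closure Ω) u)))
      (D (closure Ω) (D (closure Ω) (D (closure Ω) (D (closure Ω) u))) x) x :=
  hasFDerivAt_D h.dom.isOpen subset_closure (contDiffOn_D_of_isOpen (m := 1) h.dom.isOpen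
    subset_closure h.contDiffOn_D2_interior (by norm_num)) (by norm_num) hx

lemma D2_symm (hx : x ∈ closure Ω) (a b : Euc n) :
    D (closure Ω) (D (closure Ω) u) x a b = D (closure Ω) (D (closure Ω) u) x b a :=
  D_D_symm h.uniqueDiffOn h.closure_subset (h.u_contDiff'.of_le (by norm_num)) hx a b

lemma D3_symm_left (hx : x ∈ closure Ω) (a b c : Euc n) :
    D (closure Ω) (D (closure Ω) (D (closure Ω) u)) x a b c =
      D (closure Ω) (D (closure Ω) (D (closure Ω) u)) x b a c := by
  rw [D_D_symm h.uniqueDiffOn h.closure_subset h.contDiffOn_D1 hx a b]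

lemma D3_symm_right (hx : x ∈ closure Ω) (a b c : Euc n) :
    D (closure Ω) (D (closure Ω) (D (closure Ω) u)) x a b c =
      D (closure Ω) (D (closure Ω) (D (closure Ω) u)) x a c b := by
  have key : ∀ b c : Euc n, HasFDerivWithinAt (fun y => D (closure Ω) (D (closure Ω) u) y b c)
      ((ContinuousLinearMap.apply ℝ ℝ c ∘L ContinuousLinearMap.apply ℝ (Euc n →L[ℝ] ℝ) b) ∘L
        D (closure Ω) (D (closure Ω) (D (closure Ω) u)) x) (closure Ω) x := fun b c =>
    (ContinuousLinearMap.apply ℝ ℝ c ∘L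
      ContinuousLinearMap.apply ℝ (Euc n →L[ℝ] ℝ) b).hasFDerivAt.comp_hasFDerivWithinAt x
        (h.hasFDerivWithinAt_D2 hx)
  have h1 := (key b c).congr (fun y hy => (h.D2_symm hy c b)) (h.D2_symm hx c b)
  have h2 := (h.uniqueDiffOn x hx).eq h1 (key c b)
  exact congrArg (fun T : Euc n →L[ℝ] ℝ => T a) h2

/-- Composed of transpositions of neighbouring arguments: the first is symmetry of the second
derivative of D²u, the others are derivatives of the symmetries of D³u. -/
lemma D4_symm (hx : x ∈ Ω) (a b : Euc n) :
    D (closure Ω) (D (closure Ω) (D (closure Ω) (D (closure Ω) u))) x a a b b =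
      D (closure Ω) (D (closure Ω) (D (closure Ω) (D (closure Ω) u))) x b b a a := by
  have hxc := subset_closure hx
  have hev : ∀ᶠ y in 𝓝 x, y ∈ Ω := h.dom.isOpen.mem_nhds hx
  have s12 : ∀ a b c d : Euc n,
      D (closure Ω) (D (closure Ω) (D (closure Ω) (D (closure Ω) u))) x a b c d =
      D (closure Ω) (D (closure Ω) (D (closure Ω) (D (closure Ω) u))) x b a c d := by
    intro a b c d
    have h2 : ContDiffAt ℝ 2 (D (closure Ω) (D (closure Ω) u)) x :=
      h.contDiffOn_D2_interior.contDiffAt (h.dom.isOpen.mem_nhds hx)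
    have h3 := (h2.isSymmSndFDerivAt (by simp)).eq a b
    have h4 : D (closure Ω) (D (closure Ω) (D (closure Ω) (D (closure Ω) u))) x =
        fderiv ℝ (fderiv ℝ (D (closure Ω) (D (closure Ω) u))) x := by
      have : fderiv ℝ (D (closure Ω) (D (closure Ω) u)) =ᶠ[𝓝 x]
          D (closure Ω) (D (closure Ω) (D (closure Ω) u)) :=
        hev.mono fun y hy => (h.hasFDerivAt_D2 hy).fderiv
      rw [this.fderiv_eq, (h.hasFDerivAt_D3 hx).fderiv]
    rw [h4, h3]
  have key : ∀ b c d : Euc n, HasFDerivAt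
      (fun y => D (closure Ω) (D (closure Ω) (D (closure Ω) u)) y b c d)
      ((ContinuousLinearMap.apply ℝ ℝ d ∘L ContinuousLinearMap.apply ℝ (Euc n →L[ℝ] ℝ) c ∘L
        ContinuousLinearMap.apply ℝ (Euc n →L[ℝ] Euc n →L[ℝ] ℝ) b) ∘L
        D (closure Ω) (D (closure Ω) (D (closure Ω) (D (closure Ω) u))) x) x := fun b c d =>
    (ContinuousLinearMap.apply ℝ ℝ d ∘L ContinuousLinearMap.apply ℝ (Euc n →L[ℝ] ℝ) c ∘L
        ContinuousLinearMap.apply ℝ (Euc n →L[ℝ] Euc n →L[ℝ] ℝ) b).hasFDerivAt.comp x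
        (h.hasFDerivAt_D3 hx)
  have s23 : ∀ a b c d : Euc n,
      D (closure Ω) (D (closure Ω) (D (closure Ω) (D (closure Ω) u))) x a b c d =
      D (closure Ω) (D (closure Ω) (D (closure Ω) (D (closure Ω) u))) x a c b d := by
    intro a b c d
    have h1 := (key b c d).congr_of_eventuallyEq
      (hev.mono fun y hy => h.D3_symm_left (subset_closure hy) c b d)
    exact congrArg (fun T : Euc n →L[ℝ] ℝ => T a) (h1.unique (key c b d))
  have s34 : ∀ a b c d : Euc n,
      D (closure Ω) (D (closure Ω) (D (closure Ω) (D (closure Ω) u))) x a b c d =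
      D (closure Ω) (D (closure Ω) (D (closure Ω) (D (closure Ω) u))) x a b d c := by
    intro a b c d
    have h1 := (key b c d).congr_of_eventuallyEq
      (hev.mono fun y hy => h.D3_symm_right (subset_closure hy) b d c)
    exact congrArg (fun T : Euc n →L[ℝ] ℝ => T a) (h1.unique (key b d c))
  rw [s23 a a b b, s12 a b a b, s34 b a a b, s23 b a b a]

lemma abs_u_le (hx : x ∈ closure Ω) : |u x| ≤ M := by
  have := h.u_norm 0 (by norm_num) x hx
  simpa using this

lemma norm_D1_le (hx : x ∈ closure Ω) : ‖D (closure Ω) u x‖ ≤ M := by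
  rw [norm_D_eq h.uniqueDiffOn hx]
  exact h.u_norm 1 le_rfl x hx

/-- The supremum in `supAbs` runs over the open set only, so continuity must carry the bound to the
closure; `u_norm` supplies the boundedness that makes the `sSup` meaningful. -/
lemma mem_valueRange (hx : x ∈ closure Ω) : (x, u x) ∈ valueRange Ω u := by
  refine ⟨hx, ?_⟩
  have hb : BddAbove ((fun x => |u x|) '' Ω) :=
    ⟨M, by rintro _ ⟨y, hy, rfl⟩; exact h.abs_u_le (subset_closure hy)⟩
  have hle : ∀ y ∈ Ω, u y ∈ Icc (-supAbs Ω u) (supAbs Ω u) := fun y hy =>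
    abs_le.1 (le_csSup hb ⟨y, hy, rfl⟩)
  have hcont : ContinuousWithinAt u Ω x :=
    (h.u_contDiff'.continuousOn x hx).mono subset_closure
  exact closure_minimal (by rintro _ ⟨y, hy, rfl⟩; exact hle y hy) isClosed_Icc
    (hcont.mem_closure_image hx)

/-! Regularity of the data -/

lemma isOpen_prod : IsOpen (Ω ×ˢ (univ : Set ℝ)) := h.dom.isOpen.prod isOpen_univ

omit h in
lemma prod_subset : Ω ×ˢ (univ : Set ℝ) ⊆ closure Ω ×ˢ (univ : Set ℝ) :=
  prod_mono subset_closure subset_rfl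

lemma eventually_mem_prod (hx : x ∈ Ω) (z : ℝ) : ∀ᶠ q in 𝓝 (x, z), q ∈ Ω ×ˢ (univ : Set ℝ) :=
  h.isOpen_prod.mem_nhds ⟨hx, mem_univ z⟩

lemma norm_f_le (hx : x ∈ closure Ω) : |f (x, u x)| ≤ Lf ∧
    ‖D (closure Ω ×ˢ univ) f (x, u x)‖ ≤ Lf ∧
    ‖D (closure Ω ×ˢ univ) (D (closure Ω ×ˢ univ) f) (x, u x)‖ ≤ Lf := by
  have hmem := h.mem_valueRange hx
  have hS : (x, u x) ∈ closure Ω ×ˢ (univ : Set ℝ) := ⟨hx, mem_univ _⟩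
  refine ⟨?_, ?_, ?_⟩
  · simpa using h.f_norm 0 (by norm_num) _ hmem
  · rw [norm_D_eq h.uniqueDiffOn_prod hS]
    exact h.f_norm 1 (by norm_num) _ hmem
  · rw [norm_D_D_eq h.uniqueDiffOn_prod hS]
    exact h.f_norm 2 (by norm_num) _ hmem

lemma norm_φ_le (hx : x ∈ closure Ω) : |φ (x, u x)| ≤ Lφ ∧
    ‖D (closure Ω ×ˢ univ) φ (x, u x)‖ ≤ Lφ ∧
    ‖D (closure Ω ×ˢ univ) (D (closure Ω ×ˢ univ) φ) (x, u x)‖ ≤ Lφ ∧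
    ‖D (closure Ω ×ˢ univ) (D (closure Ω ×ˢ univ) (D (closure Ω ×ˢ univ) φ)) (x, u x)‖ ≤ Lφ := by
  have hmem := h.mem_valueRange hx
  have hS : (x, u x) ∈ closure Ω ×ˢ (univ : Set ℝ) := ⟨hx, mem_univ _⟩
  refine ⟨?_, ?_, ?_, ?_⟩
  · simpa using h.φ_norm 0 (by norm_num) _ hmem
  · rw [norm_D_eq h.uniqueDiffOn_prod hS]
    exact h.φ_norm 1 (by norm_num) _ hmem
  · rw [norm_D_D_eq h.uniqueDiffOn_prod hS]
    exact h.φ_norm 2 (by norm_num) _ hmem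
  · rw [norm_D_D_D_eq h.uniqueDiffOn_prod hS]
    exact h.φ_norm 3 (by norm_num) _ hmem

lemma hasFDerivAt_f {q : Euc n × ℝ} (hq : q ∈ Ω ×ˢ (univ : Set ℝ)) :
    HasFDerivAt f (D (closure Ω ×ˢ univ) f q) q :=
  hasFDerivAt_D h.isOpen_prod prod_subset (h.f_contDiff.mono prod_subset) (by norm_num) hq

lemma hasFDerivAt_Df {q : Euc n × ℝ} (hq : q ∈ Ω ×ˢ (univ : Set ℝ)) :
    HasFDerivAt (D (closure Ω ×ˢ univ) f) (D (closure Ω ×ˢ univ) (D (closure Ω ×ˢ univ) f) q) q :=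
  hasFDerivAt_D h.isOpen_prod prod_subset (contDiffOn_D_of_isOpen (m := 1) h.isOpen_prod
    prod_subset (h.f_contDiff.mono prod_subset) (by norm_num)) (by norm_num) hq

lemma hasFDerivAt_φ {q : Euc n × ℝ} (hq : q ∈ Ω ×ˢ (univ : Set ℝ)) :
    HasFDerivAt φ (D (closure Ω ×ˢ univ) φ q) q :=
  hasFDerivAt_D h.isOpen_prod prod_subset (h.φ_contDiff.mono prod_subset) (by norm_num) hq

lemma hasFDerivAt_Dφ {q : Euc n × ℝ} (hq : q ∈ Ω ×ˢ (univ : Set ℝ)) :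
    HasFDerivAt (D (closure Ω ×ˢ univ) φ) (D (closure Ω ×ˢ univ) (D (closure Ω ×ˢ univ) φ) q) q :=
  hasFDerivAt_D h.isOpen_prod prod_subset (contDiffOn_D_of_isOpen (m := 2) h.isOpen_prod
    prod_subset (h.φ_contDiff.mono prod_subset) (by norm_num)) (by norm_num) hq

lemma hasFDerivAt_DDφ {q : Euc n × ℝ} (hq : q ∈ Ω ×ˢ (univ : Set ℝ)) :
    HasFDerivAt (D (closure Ω ×ˢ univ) (D (closure Ω ×ˢ univ) φ))
      (D (closure Ω ×ˢ univ) (D (closure Ω ×ˢ univ) (D (closure Ω ×ˢ univ) φ)) q) q :=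
  hasFDerivAt_D h.isOpen_prod prod_subset (contDiffOn_D_of_isOpen (m := 1) h.isOpen_prod
    prod_subset (contDiffOn_D_of_isOpen (m := 2) h.isOpen_prod
    prod_subset (h.φ_contDiff.mono prod_subset) (by norm_num)) (by norm_num)) (by norm_num) hq

lemma hasFDerivWithinAt_φ (hx : x ∈ closure Ω) (z : ℝ) :
    HasFDerivWithinAt φ (D (closure Ω ×ˢ univ) φ (x, z)) (closure Ω ×ˢ univ) (x, z) :=
  hasFDerivWithinAt_D h.φ_contDiff (by norm_num) ⟨hx, mem_univ z⟩

lemma hasFDerivWithinAt_Dφ (hx : x ∈ closure Ω) (z : ℝ) :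
    HasFDerivWithinAt (D (closure Ω ×ˢ univ) φ)
      (D (closure Ω ×ˢ univ) (D (closure Ω ×ˢ univ) φ) (x, z)) (closure Ω ×ˢ univ) (x, z) :=
  hasFDerivWithinAt_D (contDiffOn_D (m := 2) h.uniqueDiffOn_prod h.φ_contDiff (by norm_num))
    (by norm_num) ⟨hx, mem_univ z⟩

lemma Dφ_vertical_nonpos (hx : x ∈ closure Ω) (z : ℝ) :
    D (closure Ω ×ˢ univ) φ (x, z) (0, 1) ≤ 0 := by
  have h1 : HasDerivAt (fun t : ℝ => (x, t)) ((0 : Euc n), (1 : ℝ)) z :=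
    (hasDerivAt_const z x).prodMk (hasDerivAt_id z)
  have h2 : HasDerivWithinAt (φ ∘ fun t : ℝ => (x, t))
      (D (closure Ω ×ˢ univ) φ (x, z) (0, 1)) univ z :=
    HasFDerivWithinAt.comp_hasDerivWithinAt z (h.hasFDerivWithinAt_φ hx z) h1.hasDerivWithinAt
      (fun t _ => ⟨hx, mem_univ _⟩)
  rw [hasDerivWithinAt_univ] at h2
  rw [← h2.deriv]
  exact (h.φ_anti x hx).deriv_nonpos

/-! The equation -/

lemma hessian_apply (hx : x ∈ Ω) (i j : Fin n) : hessian u x i j =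
    D (closure Ω) (D (closure Ω) u) x (EuclideanSpace.single i 1) (EuclideanSpace.single j 1) := by
  have hev : ∀ᶠ y in 𝓝 x, y ∈ Ω := h.dom.isOpen.mem_nhds hx
  have h1 : fderiv ℝ u =ᶠ[𝓝 x] D (closure Ω) u := hev.mono fun y hy => (h.hasFDerivAt_u hy).fderiv
  rw [hessian, Matrix.of_apply, iteratedFDeriv_two_apply, h1.fderiv_eq,
    (h.hasFDerivAt_D1 hx).fderiv]
  rfl

lemma exists_eigenbasis (hx : x ∈ Ω) : ∃ (e : OrthonormalBasis (Fin n) ℝ (Euc n))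
    (l : Fin n → ℝ), IsGarding (m + 1) Finset.univ l ∧ esym (m + 1) Finset.univ l = f (x, u x) ∧
      ∀ i w, D (closure Ω) (D (closure Ω) u) x (e i) w = l i * inner ℝ (e i) w := by
  have hxc := subset_closure hx
  have hH : (hessian u x).IsHermitian := by
    refine Matrix.IsHermitian.ext fun i j => ?_
    rw [h.hessian_apply hx, h.hessian_apply hx, h.D2_symm hxc]
    rfl
  have hl : hessianEigenvalues u x = hH.eigenvalues := by
    rw [hessianEigenvalues, dif_pos hH]
  refine ⟨hH.eigenvectorBasis, hH.eigenvalues, fun j hj => ?_, ?_, fun i w => ?_⟩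
  · rcases Nat.eq_zero_or_pos j with rfl | hj0
    · simp
    · have := h.admissible x hx j hj0 hj
      rwa [hl] at this
  · rw [← hl]
    exact h.equation x hx
  · have hsum : ∀ a : Euc n, a = ∑ j, a j • EuclideanSpace.single j (1 : ℝ) := fun a => by
      ext k
      simp [Finset.sum_apply, Pi.single_apply]
    have hexp : D (closure Ω) (D (closure Ω) u) x (hH.eigenvectorBasis i) w =
        ∑ k, w k * ((hessian u x).mulVec (hH.eigenvectorBasis i) k) := by
      conv_lhs => rw [hsum w, hsum (hH.eigenvectorBasis i)]
      simp only [map_sum, map_smul, smul_eq_mul, sum_apply, smul_apply]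
      refine Finset.sum_congr rfl fun k _ => ?_
      rw [Matrix.mulVec, dotProduct, Finset.mul_sum]
      rw [Finset.mul_sum]
      refine Finset.sum_congr rfl fun j _ => ?_
      rw [h.hessian_apply hx k j, h.D2_symm hxc (EuclideanSpace.single k 1)]
      ring
    rw [hexp, hH.mulVec_eigenvectorBasis, PiLp.inner_apply, Finset.mul_sum]
    refine Finset.sum_congr rfl fun k _ => ?_
    simp
    ring

end

end Solution

/-! ### The equation differentiated once and twice -/

namespace Solution

variable {n m : ℕ} {Ω : Set (Euc n)} {ρ u : Euc n → ℝ} {f φ : Euc n × ℝ → ℝ}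
  {L κ M f₀ Lf Lφ : ℝ} {x : Euc n}

local notation "∂ᵤ" => D (closure Ω)
local notation "∂ₚ" => D (SProd.sprod (closure Ω) (univ : Set ℝ))

/-- The coefficients `∂σ_{m+1}/∂λ_i` of the linearized equation. -/
noncomputable def coeff (m : ℕ) (l : Fin n → ℝ) (i : Fin n) : ℝ :=
  esym m (Finset.univ.erase i) l

/-- The eigenvalues `l` and eigenvectors `e` of the Hessian of the solution at `x`. -/
structure IsEigenframe (m : ℕ) (Ω : Set (Euc n)) (u : Euc n → ℝ) (f : Euc n × ℝ → ℝ) (x : Euc n)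
    (e : OrthonormalBasis (Fin n) ℝ (Euc n)) (l : Fin n → ℝ) : Prop where
  garding : IsGarding (m + 1) Finset.univ l
  esym_eq : esym (m + 1) Finset.univ l = f (x, u x)
  eigen : ∀ i w, D (closure Ω) (D (closure Ω) u) x (e i) w = l i * inner ℝ (e i) w

variable {e : OrthonormalBasis (Fin n) ℝ (Euc n)} {l : Fin n → ℝ}

lemma IsEigenframe.coeff_pos (he : IsEigenframe m Ω u f x e l) (i : Fin n) : 0 < coeff m l i :=
  he.garding.esym_erase_pos (Finset.mem_univ i)

lemma IsEigenframe.apply_self (he : IsEigenframe m Ω u f x e l) (i : Fin n) :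
    ∂ᵤ (∂ᵤ u) x (e i) (e i) = l i := by
  rw [he.eigen, real_inner_self_eq_norm_sq, e.orthonormal.1 i]
  ring

lemma IsEigenframe.norm_apply (he : IsEigenframe m Ω u f x e l) (i : Fin n) :
    ‖∂ᵤ (∂ᵤ u) x (e i)‖ ≤ |l i| := by
  refine ContinuousLinearMap.opNorm_le_bound _ (abs_nonneg _) fun w => ?_
  rw [he.eigen, Real.norm_eq_abs, abs_mul]
  gcongr
  have := abs_real_inner_le_norm (e i) w
  rwa [e.orthonormal.1 i, one_mul] at this

lemma IsEigenframe.apply_eq_sum (he : IsEigenframe m Ω u f x e l) (w : Euc n) :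
    ∂ᵤ (∂ᵤ u) x w w = ∑ j, inner ℝ (e j) w ^ 2 * l j := by
  conv_lhs => rw [← e.sum_repr' w]
  simp only [map_sum, map_smul, sum_apply, smul_apply, smul_eq_mul, he.eigen]
  refine Finset.sum_congr rfl fun i _ => ?_
  rw [Finset.sum_eq_single i]
  · rw [real_inner_self_eq_norm_sq, e.orthonormal.1 i]
    ring
  · intro j _ hj
    rw [e.orthonormal.2 hj]
    ring
  · simp

section

variable (h : Solution m Ω ρ u f φ L κ M f₀ Lf Lφ)
include h

lemma exists_isEigenframe (hx : x ∈ Ω) : ∃ (e : OrthonormalBasis (Fin n) ℝ (Euc n))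
    (l : Fin n → ℝ), IsEigenframe m Ω u f x e l := by
  obtain ⟨e, l, h1, h2, h3⟩ := h.exists_eigenbasis hx
  exact ⟨e, l, h1, h2, h3⟩

/-- The tangent plane inequality for log σ_{m+1} at the eigenvalues of x is evaluated at the
diagonal of D²u(y) in the frame of x. By Schur's theorem passing from the eigenvalues at y to that
diagonal does not decrease log σ_{m+1}. The frame stays fixed while y varies. -/
lemma log_sub_log_le (hx : x ∈ Ω) (he : IsEigenframe m Ω u f x e l) {y : Euc n} (hy : y ∈ Ω) :
    f (x, u x) * (Real.log (f (y, u y)) - Real.log (f (x, u x))) ≤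
      ∑ i, coeff m l i * (∂ᵤ (∂ᵤ u) y (e i) (e i) - l i) := by
  obtain ⟨v, l', he'⟩ := h.exists_isEigenframe hy
  have hpos := h.f_pos x (subset_closure hx) (u x)
  obtain ⟨h1, h2⟩ := he'.garding.of_doublyStochastic (sq_inner_mem_doublyStochastic v e)
  have h3 := log_esym_le m Finset.univ he.garding h1
  have hdiag : ∀ i, (Matrix.of fun i j => inner ℝ (v j) (e i) ^ 2).mulVec l' i =
      ∂ᵤ (∂ᵤ u) y (e i) (e i) := fun i => by
    rw [he'.apply_eq_sum]
    rfl
  simp only [hdiag] at h3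
  rw [he'.esym_eq] at h2
  rw [he.esym_eq] at h3
  have h4 : Real.log (f (y, u y)) - Real.log (f (x, u x)) ≤
      (∑ i, coeff m l i * (∂ᵤ (∂ᵤ u) y (e i) (e i) - l i)) / f (x, u x) := by
    have h5 := h2.trans h3
    simp only [coeff]
    linarith
  rw [le_div_iff₀ hpos] at h4
  linarith

lemma hasD2_u (hx : x ∈ Ω) (ξ : Euc n) :
    HasD2 (fun t : ℝ => u (x + t • ξ)) (∂ᵤ u x ξ) (∂ᵤ (∂ᵤ u) x ξ ξ) :=
  HasD2.along ξ ((h.dom.isOpen.eventually_mem hx).mono fun _ hy => h.hasFDerivAt_u hy)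
    (h.hasFDerivAt_D1 hx)

lemma hasD2_D1 (hx : x ∈ Ω) (ξ : Euc n) :
    HasD2 (fun t : ℝ => ∂ᵤ u (x + t • ξ)) (∂ᵤ (∂ᵤ u) x ξ) (∂ᵤ (∂ᵤ (∂ᵤ u)) x ξ ξ) :=
  HasD2.along ξ ((h.dom.isOpen.eventually_mem hx).mono fun _ hy => h.hasFDerivAt_D1 hy)
    (h.hasFDerivAt_D2 hx)

lemma hasD2_D2 (hx : x ∈ Ω) (ξ a b : Euc n) :
    HasD2 (fun t : ℝ => ∂ᵤ (∂ᵤ u) (x + t • ξ) a b) (∂ᵤ (∂ᵤ (∂ᵤ u)) x ξ a b)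
      (∂ᵤ (∂ᵤ (∂ᵤ (∂ᵤ u))) x ξ ξ a b) :=
  HasD2.clm (ContinuousLinearMap.apply ℝ ℝ b ∘L ContinuousLinearMap.apply ℝ (Euc n →L[ℝ] ℝ) a)
    (HasD2.along ξ ((h.dom.isOpen.eventually_mem hx).mono fun _ hy => h.hasFDerivAt_D2 hy)
      (h.hasFDerivAt_D3 hx))

lemma hasD2_graph (hx : x ∈ Ω) (ξ : Euc n) :
    HasD2 (fun t : ℝ => (x + t • ξ, u (x + t • ξ))) (ξ, ∂ᵤ u x ξ)
      (0, ∂ᵤ (∂ᵤ u) x ξ ξ) := by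
  obtain ⟨a', h1, h2, h3⟩ := h.hasD2_u hx ξ
  obtain ⟨b', k1, k2, k3⟩ := HasD2.line x ξ
  exact ⟨fun t => (b' t, a' t), by filter_upwards [h1, k1] with t ht ht' using ht'.prodMk ht,
    by simp only [h2, k2], k3.prodMk h3⟩

lemma hasD2_f (hx : x ∈ Ω) (ξ : Euc n) :
    HasD2 (fun t : ℝ => f (x + t • ξ, u (x + t • ξ))) (∂ₚ f (x, u x) (ξ, ∂ᵤ u x ξ))
      (∂ₚ (∂ₚ f) (x, u x) (ξ, ∂ᵤ u x ξ) (ξ, ∂ᵤ u x ξ) +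
        ∂ₚ f (x, u x) (0, ∂ᵤ (∂ᵤ u) x ξ ξ)) := by
  have h1 := (h.hasD2_graph hx ξ).comp (g := f) (g' := ∂ₚ f) (g'' := ∂ₚ (∂ₚ f) (x, u x))
    (by
      simp only [zero_smul, add_zero]
      exact (h.eventually_mem_prod hx _).mono fun q hq => h.hasFDerivAt_f hq)
    (by
      simp only [zero_smul, add_zero]
      exact h.hasFDerivAt_Df ⟨hx, mem_univ _⟩)
  simpa using h1

/-- The first and second derivatives of the equation; concavity of the operator enters in the
second one. -/
lemma linearized_equation (hx : x ∈ Ω) (he : IsEigenframe m Ω u f x e l) (ξ : Euc n) :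
    ∑ i, coeff m l i * ∂ᵤ (∂ᵤ (∂ᵤ u)) x ξ (e i) (e i) = ∂ₚ f (x, u x) (ξ, ∂ᵤ u x ξ) ∧
    ∂ₚ (∂ₚ f) (x, u x) (ξ, ∂ᵤ u x ξ) (ξ, ∂ᵤ u x ξ) + ∂ₚ f (x, u x) (0, ∂ᵤ (∂ᵤ u) x ξ ξ)
      - 4 * (∂ₚ f (x, u x) (ξ, ∂ᵤ u x ξ)) ^ 2 / f (x, u x) ≤
      ∑ i, coeff m l i * ∂ᵤ (∂ᵤ (∂ᵤ (∂ᵤ u))) x ξ ξ (e i) (e i) := by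
  have hpos := h.f_pos x (subset_closure hx) (u x)
  set c := f (x, u x) with hc
  have hsum := HasD2.sum Finset.univ fun i =>
    (h.hasD2_D2 hx ξ (e i) (e i)).const_mul (coeff m l i)
  have hf := h.hasD2_f hx ξ
  have hdiff := hf.sub (HasD2.const c)
  have hψ := (hsum.sub hdiff).add ((hdiff.mul hdiff).const_mul (2 / c))
  have hf0 : (fun t : ℝ => f (x + t • ξ, u (x + t • ξ))) 0 = c := by simp [hc]
  -- With a and c the values of f along the line and at x: log(a/c) ≥ 1 - c/a, and c(1 - c/a) ≥ (a -
  -- c) - (2/c)(a - c)² as soon as a > c/2. So the supporting inequality yields a minimum at t = 0,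
  -- whose first-order condition is the linearized equation and whose second-order condition is the
  -- twice differentiated one, with the loss 4f_ξ²/f.
  have hmin : IsLocalMin (fun t : ℝ =>
      (∑ i, coeff m l i * ∂ᵤ (∂ᵤ u) (x + t • ξ) (e i) (e i) - (f (x + t • ξ, u (x + t • ξ)) - c)) +
      2 / c * ((f (x + t • ξ, u (x + t • ξ)) - c) * (f (x + t • ξ, u (x + t • ξ)) - c))) 0 := by
    have hline : Tendsto (fun t : ℝ => x + t • ξ) (𝓝 0) (𝓝 x) := by
      have : Continuous fun t : ℝ => x + t • ξ := by fun_prop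
      simpa using this.tendsto 0
    have hfc : ∀ᶠ t in 𝓝 (0 : ℝ), c / 2 < f (x + t • ξ, u (x + t • ξ)) := by
      obtain ⟨a', h1, -, -⟩ := hf
      have := h1.self_of_nhds.continuousAt.tendsto
      simp only [zero_smul, add_zero] at this
      exact this.eventually (Ioi_mem_nhds (by rw [← hc]; linarith))
    filter_upwards [hline.eventually (h.dom.isOpen.eventually_mem hx), hfc] with t ht hft
    have h1 := h.log_sub_log_le hx he ht
    set a := f (x + t • ξ, u (x + t • ξ))
    have ha : 0 < a := by linarith
    rw [← hc, ← Real.log_div ha.ne' hpos.ne'] at h1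
    have h2 := Real.one_sub_inv_le_log_of_pos (div_pos ha hpos)
    rw [inv_div] at h2
    have h3 : (a - c) - 2 / c * ((a - c) * (a - c)) ≤ c * (1 - c / a) := by
      have : c * (1 - c / a) - ((a - c) - 2 / c * ((a - c) * (a - c))) =
          (a - c) ^ 2 * (2 * a - c) / (a * c) := by
        field_simp
        ring
      have h4 : 0 ≤ (a - c) ^ 2 * (2 * a - c) / (a * c) :=
        div_nonneg (mul_nonneg (sq_nonneg _) (by linarith)) (by positivity)
      linarith
    have h5 := mul_le_mul_of_nonneg_left h2 hpos.le
    have h6 : ∑ i, coeff m l i * (∂ᵤ (∂ᵤ u) (x + t • ξ) (e i) (e i) - l i) =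
        ∑ i, coeff m l i * ∂ᵤ (∂ᵤ u) (x + t • ξ) (e i) (e i) - ∑ i, coeff m l i * l i := by
      rw [← Finset.sum_sub_distrib]
      exact Finset.sum_congr rfl fun i _ => by ring
    simp only [zero_smul, add_zero, ← hc, sub_self, mul_zero, he.apply_self, sub_zero]
    linarith
  obtain ⟨h1, h2⟩ := hψ.eq_zero_and_nonneg hmin
  simp only [zero_smul, add_zero, ← hc, sub_self, mul_zero, zero_mul, sub_zero] at h1 h2
  refine ⟨by linarith, ?_⟩
  have h3 : 2 / c * (2 * (∂ₚ f (x, u x) (ξ, ∂ᵤ u x ξ) * ∂ₚ f (x, u x) (ξ, ∂ᵤ u x ξ))) =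
      4 * (∂ₚ f (x, u x) (ξ, ∂ᵤ u x ξ)) ^ 2 / c := by ring
  simp only [zero_add] at h2
  linarith

lemma M_nonneg : 0 ≤ M := by
  obtain ⟨y, hy⟩ := h.dom.nonempty
  exact (abs_nonneg _).trans (h.abs_u_le (subset_closure hy))

lemma Lf_nonneg : 0 ≤ Lf := by
  obtain ⟨y, hy⟩ := h.dom.nonempty
  exact (abs_nonneg _).trans (h.norm_f_le (subset_closure hy)).1

lemma Lφ_nonneg : 0 ≤ Lφ := by
  obtain ⟨y, hy⟩ := h.dom.nonempty
  exact (abs_nonneg _).trans (h.norm_φ_le (subset_closure hy)).1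

lemma norm_graph_le (hx : x ∈ closure Ω) (ξ : Euc n) :
    ‖((ξ, ∂ᵤ u x ξ) : Euc n × ℝ)‖ ≤ (1 + M) * ‖ξ‖ := by
  have hM := h.M_nonneg
  rw [Prod.norm_def]
  refine max_le ?_ ?_
  · nlinarith [norm_nonneg ξ]
  · have := ContinuousLinearMap.le_of_opNorm_le _ (h.norm_D1_le hx) ξ
    simp only at this ⊢
    nlinarith [norm_nonneg ξ]

lemma abs_sum_D3_le (hx : x ∈ Ω) (he : IsEigenframe m Ω u f x e l) (ξ : Euc n) :
    |∑ i, coeff m l i * ∂ᵤ (∂ᵤ (∂ᵤ u)) x ξ (e i) (e i)| ≤ Lf * (1 + M) * ‖ξ‖ := by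
  rw [(h.linearized_equation hx he ξ).1]
  have h1 := ContinuousLinearMap.le_of_opNorm_le _ (h.norm_f_le (subset_closure hx)).2.1
    (ξ, ∂ᵤ u x ξ)
  refine h1.trans ?_
  rw [mul_assoc]
  exact mul_le_mul_of_nonneg_left (h.norm_graph_le (subset_closure hx) ξ) h.Lf_nonneg

lemma le_sum_D4 (hf₀ : 0 < f₀) (hx : x ∈ Ω) (he : IsEigenframe m Ω u f x e l) {ξ : Euc n}
    (hξ : ‖ξ‖ = 1) :
    -(Lf * (1 + M) ^ 2 + 4 * (Lf * (1 + M)) ^ 2 / f₀ + Lf * |∂ᵤ (∂ᵤ u) x ξ ξ|) ≤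
      ∑ i, coeff m l i * ∂ᵤ (∂ᵤ (∂ᵤ (∂ᵤ u))) x ξ ξ (e i) (e i) := by
  refine le_trans ?_ (h.linearized_equation hx he ξ).2
  have hxc := subset_closure hx
  have hpos := h.f_pos x hxc (u x)
  have hM := h.M_nonneg
  have hLf := h.Lf_nonneg
  obtain ⟨-, b1, b2⟩ := h.norm_f_le hxc
  have hg := h.norm_graph_le hxc ξ
  rw [hξ, mul_one] at hg
  have e1 : |∂ₚ (∂ₚ f) (x, u x) (ξ, ∂ᵤ u x ξ) (ξ, ∂ᵤ u x ξ)| ≤ Lf * (1 + M) ^ 2 := by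
    calc _ ≤ ‖∂ₚ (∂ₚ f) (x, u x)‖ * ‖((ξ, ∂ᵤ u x ξ) : Euc n × ℝ)‖ *
          ‖((ξ, ∂ᵤ u x ξ) : Euc n × ℝ)‖ := (∂ₚ (∂ₚ f) (x, u x)).le_opNorm₂ _ _
      _ ≤ Lf * (1 + M) * (1 + M) := by gcongr
      _ = _ := by ring
  have e2 : |∂ₚ f (x, u x) (0, ∂ᵤ (∂ᵤ u) x ξ ξ)| ≤ Lf * |∂ᵤ (∂ᵤ u) x ξ ξ| := by
    refine (ContinuousLinearMap.le_of_opNorm_le _ b1 _).trans ?_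
    rw [Prod.norm_def]
    simp
  have e3 : |∂ₚ f (x, u x) (ξ, ∂ᵤ u x ξ)| ≤ Lf * (1 + M) :=
    (ContinuousLinearMap.le_of_opNorm_le _ b1 _).trans (by gcongr)
  have e4 : 4 * (∂ₚ f (x, u x) (ξ, ∂ᵤ u x ξ)) ^ 2 / f (x, u x) ≤
      4 * (Lf * (1 + M)) ^ 2 / f₀ := by
    have hlow := h.f_lower _ (h.mem_valueRange hxc)
    have : (∂ₚ f (x, u x) (ξ, ∂ᵤ u x ξ)) ^ 2 ≤ (Lf * (1 + M)) ^ 2 :=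
      sq_le_sq' (abs_le.1 e3).1 (abs_le.1 e3).2
    gcongr
  linarith [(abs_le.1 e1).1, (abs_le.1 e2).1]

end

end Solution

/-- The projection of `ξ` onto the orthogonal complement of the normal field. -/
noncomputable def tangentialPart {n : ℕ} (ρ : Euc n → ℝ) (ξ x : Euc n) : Euc n :=
  ξ - inner ℝ ξ (normalField ρ x) • normalField ρ x

/-! ### The auxiliary function and its interior maxima -/

namespace Solution

variable {n m : ℕ} {Ω : Set (Euc n)} {ρ u : Euc n → ℝ} {f φ : Euc n × ℝ → ℝ}
  {L κ M f₀ Lf Lφ : ℝ} {x : Euc n}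

set_option hygiene false in
local notation "∂ᵤ" => D (closure Ω)
set_option hygiene false in
local notation "∂ₚ" => D (SProd.sprod (closure Ω) (univ : Set ℝ))

/-- The value of `D²u(ζ, ν)` on the boundary, `ζ` the tangential part of `ξ`, as computed from
the tangentially differentiated boundary condition. -/
noncomputable def mixedTerm (Ω : Set (Euc n)) (ρ u : Euc n → ℝ) (φ : Euc n × ℝ → ℝ)
    (ξ x : Euc n) : ℝ :=
  ∂ₚ φ (x, u x) (tangentialPart ρ ξ x, ∂ᵤ u x (tangentialPart ρ ξ x)) -
    ∂ᵤ u x (fderiv ℝ (normalField ρ) x (tangentialPart ρ ξ x))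

/-- The coefficient of `Du` in `2⟨ξ,ν⟩ mixedTerm`. -/
noncomputable def crossVec (Ω : Set (Euc n)) (ρ u : Euc n → ℝ) (φ : Euc n × ℝ → ℝ)
    (ξ x : Euc n) : Euc n :=
  (2 * inner ℝ ξ (normalField ρ x)) • (∂ₚ φ (x, u x) (0, 1) • tangentialPart ρ ξ x -
    fderiv ℝ (normalField ρ) x (tangentialPart ρ ξ x))

/-- The term of order zero in `2⟨ξ,ν⟩ mixedTerm`. -/
noncomputable def crossScal (Ω : Set (Euc n)) (ρ u : Euc n → ℝ) (φ : Euc n × ℝ → ℝ)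
    (ξ x : Euc n) : ℝ :=
  (2 * inner ℝ ξ (normalField ρ x)) * ∂ₚ φ (x, u x) (tangentialPart ρ ξ x, 0)

/-- The factor Du is separated from coefficients that involve only x, u and the data. Hence third
derivatives of u enter the second derivative of the cross term only as D³u(e, e, `crossVec`), which
the linearized equation controls. -/
lemma crossVec_add_crossScal (Ω : Set (Euc n)) (ρ u : Euc n → ℝ) (φ : Euc n × ℝ → ℝ)
    (ξ x : Euc n) : ∂ᵤ u x (crossVec Ω ρ u φ ξ x) + crossScal Ω ρ u φ ξ x =
      2 * inner ℝ ξ (normalField ρ x) * mixedTerm Ω ρ u φ ξ x := by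
  have h1 : ∂ₚ φ (x, u x) (tangentialPart ρ ξ x, ∂ᵤ u x (tangentialPart ρ ξ x)) =
      ∂ₚ φ (x, u x) (tangentialPart ρ ξ x, 0) +
        ∂ᵤ u x (tangentialPart ρ ξ x) * ∂ₚ φ (x, u x) (0, 1) := by
    rw [← smul_eq_mul (∂ᵤ u x _), ← map_smul, ← map_add]
    simp
  rw [crossVec, crossScal, mixedTerm, h1]
  simp only [map_smul, map_sub, smul_eq_mul]
  ring

/-- The auxiliary function of Lions, Trudinger and Urbas. -/
noncomputable def auxFun (Ω : Set (Euc n)) (ρ u : Euc n → ℝ) (φ : Euc n × ℝ → ℝ) (y₀ : Euc n)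
    (K₁ K₂ : ℝ) (ξ x : Euc n) : ℝ :=
  ∂ᵤ (∂ᵤ u) x ξ ξ - (∂ᵤ u x (crossVec Ω ρ u φ ξ x) + crossScal Ω ρ u φ ξ x) +
    K₁ / 2 * inner ℝ (x - y₀) (x - y₀) +
    K₂ / 2 * ∑ j, ∂ᵤ u x (EuclideanSpace.single j 1) * ∂ᵤ u x (EuclideanSpace.single j 1)

/-- A bound for the curves `t ↦ crossVec (x + t e)` and `t ↦ crossScal (x + t e)`. -/
lemma exists_cross_bound (n : ℕ) (L M Lφ : ℝ) : ∃ C : ℝ, 1 ≤ C ∧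
    ∀ (m : ℕ) (Ω : Set (Euc n)) (ρ u : Euc n → ℝ) (f φ : Euc n × ℝ → ℝ) (κ f₀ Lf : ℝ),
      Solution m Ω ρ u f φ L κ M f₀ Lf Lφ → ∀ x ∈ Ω, ∀ (e ξ : Euc n) (μ : ℝ), ‖e‖ = 1 → ‖ξ‖ = 1 →
        ‖∂ᵤ (∂ᵤ u) x e e‖ ≤ μ →
        BoundedD2 (fun t : ℝ => crossVec Ω ρ u φ ξ (x + t • e)) C μ ∧
        BoundedD2 (fun t : ℝ => crossScal Ω ρ u φ ξ (x + t • e)) C μ := by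
  obtain ⟨cN, hcN, HN⟩ := exists_normalField_bound n L
  set Z : ℝ := 1 + 4 * (1 * cN * cN) with hZ
  set P : ℝ := Lφ * (1 + M) ^ 2 with hP
  set A : ℝ := 4 * (2 * (1 * cN) * (4 * (4 * (P * 1) * Z) + 4 * (cN * Z))) with hA
  set B : ℝ := 4 * (2 * (1 * cN) * (4 * (P * (1 * Z)))) with hB
  refine ⟨max 1 (max A B), le_max_left _ _, ?_⟩
  intro m Ω ρ u f φ κ f₀ Lf h x hx e ξ μ he hξ hμe
  have hμ : 0 ≤ μ := (norm_nonneg _).trans hμe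
  have hxc := subset_closure hx
  obtain ⟨n0, n1, n2, n3⟩ := HN Ω ρ h.dom.defining x hxc
  have hNc := contDiff_normalField h.dom.defining.contDiff
  have hd1 : ∀ y, HasFDerivAt (normalField ρ) (fderiv ℝ (normalField ρ) y) y := fun y =>
    (hNc.differentiable (by norm_num) y).hasFDerivAt
  have hNc1 : ContDiff ℝ 2 (fderiv ℝ (normalField ρ)) := hNc.fderiv_right (by norm_num)
  have hd2 : ∀ y, HasFDerivAt (fderiv ℝ (normalField ρ))
      (fderiv ℝ (fderiv ℝ (normalField ρ)) y) y := fun y =>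
    (hNc1.differentiable (by norm_num) y).hasFDerivAt
  have hNc2 : ContDiff ℝ 1 (fderiv ℝ (fderiv ℝ (normalField ρ))) :=
    hNc1.fderiv_right (by norm_num)
  have hd3 : ∀ y, HasFDerivAt (fderiv ℝ (fderiv ℝ (normalField ρ)))
      (fderiv ℝ (fderiv ℝ (fderiv ℝ (normalField ρ))) y) y := fun y =>
    (hNc2.differentiable (by norm_num) y).hasFDerivAt
  have bN : BoundedD2 (fun t : ℝ => normalField ρ (x + t • e)) cN μ :=
    BoundedD2.along hμ he (Eventually.of_forall hd1) (hd2 x) n0 n1 n2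
  have bDN : BoundedD2 (fun t : ℝ => fderiv ℝ (normalField ρ) (x + t • e)) cN μ :=
    BoundedD2.along hμ he (Eventually.of_forall hd2) (hd3 x) n1 n2 n3
  have bin : BoundedD2 (fun t : ℝ => inner ℝ ξ (normalField ρ (x + t • e))) (1 * cN) μ :=
    bN.clm (innerSL ℝ ξ) (by rw [innerSL_apply_norm, hξ])
  have bζ : BoundedD2 (fun t : ℝ => tangentialPart ρ ξ (x + t • e)) Z μ :=
    (BoundedD2.const ξ hμ hξ.le).sub (bin.smul hμ bN)
  obtain ⟨-, p1, p2, p3⟩ := h.norm_φ_le hxc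
  have hM := h.M_nonneg
  have hgraph := h.norm_graph_le hxc e
  rw [he, mul_one] at hgraph
  have bφ : BoundedD2 (fun t : ℝ => ∂ₚ φ (x + t • e, u (x + t • e))) P μ := by
    refine BoundedD2.comp (g := ∂ₚ φ) (g' := ∂ₚ (∂ₚ φ)) (g'' := ∂ₚ (∂ₚ (∂ₚ φ)) (x, u x)) hμ
      (h.hasD2_graph hx e) (by linarith) hgraph ?_ ?_ ?_ ?_ ?_ ?_
    · rw [Prod.norm_def]
      exact max_le (by simpa using hμ) hμe
    · simp only [zero_smul, add_zero]
      exact (h.eventually_mem_prod hx _).mono fun q hq => h.hasFDerivAt_Dφ hq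
    · simp only [zero_smul, add_zero]
      exact h.hasFDerivAt_DDφ ⟨hx, mem_univ _⟩
    · simpa using p1
    · simpa using p2
    · exact p3
  have hnorm01 : ‖((0, 1) : Euc n × ℝ)‖ ≤ 1 := by simp [Prod.norm_def]
  have bφz : BoundedD2 (fun t : ℝ => ∂ₚ φ (x + t • e, u (x + t • e)) (0, 1)) (4 * (P * 1)) μ :=
    bφ.clm_apply hμ (BoundedD2.const _ hμ hnorm01)
  have bvec := ((bin.clm (ContinuousLinearMap.mul ℝ ℝ 2) (K := 2) (by simp)).smul hμ
    ((bφz.smul hμ bζ).sub (bDN.clm_apply hμ bζ)))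
  have bscal := ((bin.clm (ContinuousLinearMap.mul ℝ ℝ 2) (K := 2) (by simp)).mul hμ
    (bφ.clm_apply hμ (bζ.clm (ContinuousLinearMap.inl ℝ (Euc n) ℝ)
      (ContinuousLinearMap.norm_inl_le_one ℝ (Euc n) ℝ))))
  exact ⟨bvec.mono hμ ((le_max_left _ _).trans (le_max_right _ _)),
    bscal.mono hμ ((le_max_right _ _).trans (le_max_right _ _))⟩

lemma sum_sq_D2 {e : OrthonormalBasis (Fin n) ℝ (Euc n)} {l : Fin n → ℝ}
    (he : IsEigenframe m Ω u f x e l) (i : Fin n) :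
    ∑ j, ∂ᵤ (∂ᵤ u) x (e i) (EuclideanSpace.single j 1) *
      ∂ᵤ (∂ᵤ u) x (e i) (EuclideanSpace.single j 1) = l i ^ 2 := by
  have h1 : ∑ j, (e i) j ^ 2 = 1 := by
    have h2 := EuclideanSpace.norm_sq_eq (e i)
    rw [e.orthonormal.1 i] at h2
    simpa using h2.symm
  simp only [he.eigen, EuclideanSpace.inner_single_right, one_mul]
  calc _ = l i ^ 2 * ∑ j, (e i) j ^ 2 := by
        rw [Finset.mul_sum]
        refine Finset.sum_congr rfl fun j _ => ?_
        simp
        ring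
    _ = l i ^ 2 := by rw [h1, mul_one]

set_option maxHeartbeats 1000000 in
/-- The interior maximum principle for the auxiliary function. -/
theorem exists_interior_bound (n m : ℕ) (L M f₀ Lf Lφ : ℝ) (hf₀ : 0 < f₀) :
    ∃ K₁ K₂ C : ℝ, 0 ≤ K₁ ∧ 0 ≤ K₂ ∧ 0 ≤ C ∧
    ∀ (Ω : Set (Euc n)) (ρ u : Euc n → ℝ) (f φ : Euc n × ℝ → ℝ) (κ : ℝ),
      Solution m Ω ρ u f φ L κ M f₀ Lf Lφ → ∀ x ∈ Ω, ∀ (ξ y₀ : Euc n), ‖ξ‖ = 1 →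
        IsLocalMax (auxFun Ω ρ u φ y₀ K₁ K₂ ξ) x → ∂ᵤ (∂ᵤ u) x ξ ξ ≤ C := by
  obtain ⟨Ca, hCa, H⟩ := exists_cross_bound n L M Lφ
  -- C₃(1 + |λ_i|) bounds the second derivative of the cross term apart from D³u. K₁ absorbs C₃ and
  -- the remainder in C₃|λ| ≤ λ²/2 + C₃²/2; K₂ holds 1/2 for this λ² and, by `esym_mul_abs_le`,
  -- enough to dominate (Lf + 1)|u_ξξ|, that is, the term Lf|u_ξξ| from the equation with |u_ξξ| to
  -- spare.
  set C₃ : ℝ := (2 + |M|) * Ca + Ca with hC3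
  set K₁ : ℝ := C₃ + C₃ ^ 2 / 2 with hK1
  set K₂ : ℝ := 1 / 2 + (|Lf| + 1) * n ^ 2 / f₀ with hK2
  set A₀ : ℝ := Lf * (1 + M) ^ 2 + 4 * (Lf * (1 + M)) ^ 2 / f₀ with hA0
  set C : ℝ := A₀ + Lf * (1 + M) * Ca + K₂ * (n * (M * (Lf * (1 + M)))) with hC
  have hC3pos : 0 ≤ C₃ := by positivity
  have hK2pos : 0 ≤ K₂ := by positivity
  refine ⟨K₁, K₂, |C|, by positivity, hK2pos, abs_nonneg _, ?_⟩
  intro Ω ρ u f φ κ h x hx ξ y₀ hξ hmax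
  have hxc := subset_closure hx
  have hM := h.M_nonneg
  have hLf := h.Lf_nonneg
  obtain ⟨e, l, he⟩ := h.exists_isEigenframe hx
  have hF := he.coeff_pos
  set a₀ := crossVec Ω ρ u φ ξ x with ha₀
  -- the second derivatives in the eigendirections
  have key : ∀ i, ∂ᵤ (∂ᵤ (∂ᵤ (∂ᵤ u))) x ξ ξ (e i) (e i) - ∂ᵤ (∂ᵤ (∂ᵤ u)) x a₀ (e i) (e i)
      - C₃ * (1 + |l i|) + K₁ + K₂ * (l i ^ 2 + ∑ j, ∂ᵤ u x (EuclideanSpace.single j 1) *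
        ∂ᵤ (∂ᵤ (∂ᵤ u)) x (EuclideanSpace.single j 1) (e i) (e i)) ≤ 0 ∧ ‖a₀‖ ≤ Ca := by
    intro i
    have hei : ‖e i‖ = 1 := e.orthonormal.1 i
    have hμ : (0 : ℝ) ≤ |l i| := abs_nonneg _
    obtain ⟨⟨a₁, a₂, ha, na0, na1, na2⟩, ⟨b₁, b₂, hb, nb0, nb1, nb2⟩⟩ :=
      H m Ω ρ u f φ κ f₀ Lf h x hx (e i) ξ |l i| hei hξ (by rw [he.apply_self, Real.norm_eq_abs])
    have hD1 := h.hasD2_D1 hx (e i)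
    have h1 := HasD2.bilin (ContinuousLinearMap.id ℝ (Euc n →L[ℝ] ℝ)) hD1 ha
    have h2 := (HasD2.bilin (innerSL ℝ (E := Euc n)) ((HasD2.line x (e i)).sub (HasD2.const y₀))
      ((HasD2.line x (e i)).sub (HasD2.const y₀))).congr (b₂ := (2 : ℝ)) rfl (by
        change inner ℝ ((0 : Euc n) - 0) _ + (2 : ℝ) • inner ℝ (e i - 0) (e i - 0) +
          inner ℝ _ ((0 : Euc n) - 0) = 2
        simp [hei])
    have h3 : ∀ j, HasD2 (fun t : ℝ => ∂ᵤ u (x + t • e i) (EuclideanSpace.single j 1))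
        (∂ᵤ (∂ᵤ u) x (e i) (EuclideanSpace.single j 1))
        (∂ᵤ (∂ᵤ (∂ᵤ u)) x (e i) (e i) (EuclideanSpace.single j 1)) := fun j =>
      HasD2.clm (ContinuousLinearMap.apply ℝ ℝ (EuclideanSpace.single j 1)) hD1
    have h4 := HasD2.sum Finset.univ fun j => (h3 j).mul (h3 j)
    have hv := (((h.hasD2_D2 hx (e i) ξ ξ).sub (h1.add hb)).add (h2.const_mul (K₁ / 2))).add
      (h4.const_mul (K₂ / 2))
    have hline : Tendsto (fun t : ℝ => x + t • e i) (𝓝 0) (𝓝 x) := by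
      have : Continuous fun t : ℝ => x + t • e i := by fun_prop
      simpa using this.tendsto 0
    have hmax' : IsLocalMax (fun t : ℝ => auxFun Ω ρ u φ y₀ K₁ K₂ ξ (x + t • e i)) 0 := by
      filter_upwards [hline.eventually hmax] with t ht
      simpa using ht
    have h5 := (hv.eq_zero_and_nonpos hmax').2
    simp only [zero_smul, add_zero] at h5 na0
    refine ⟨?_, na0⟩
    rw [h.D4_symm hx (e i) ξ] at h5
    have hsum : ∑ j, (∂ᵤ (∂ᵤ (∂ᵤ u)) x (e i) (e i) (EuclideanSpace.single j 1) *
        ∂ᵤ u x (EuclideanSpace.single j 1) +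
        2 * (∂ᵤ (∂ᵤ u) x (e i) (EuclideanSpace.single j 1) *
          ∂ᵤ (∂ᵤ u) x (e i) (EuclideanSpace.single j 1)) +
        ∂ᵤ u x (EuclideanSpace.single j 1) *
          ∂ᵤ (∂ᵤ (∂ᵤ u)) x (e i) (e i) (EuclideanSpace.single j 1)) =
        2 * (l i ^ 2 + ∑ j, ∂ᵤ u x (EuclideanSpace.single j 1) *
          ∂ᵤ (∂ᵤ (∂ᵤ u)) x (EuclideanSpace.single j 1) (e i) (e i)) := by
      rw [← sum_sq_D2 he i, ← Finset.sum_add_distrib, Finset.mul_sum]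
      refine Finset.sum_congr rfl fun j _ => ?_
      rw [h.D3_symm_right hxc (e i) (e i), h.D3_symm_left hxc (e i)]
      ring
    rw [hsum] at h5
    have e1 : ∂ᵤ (∂ᵤ (∂ᵤ u)) x (e i) (e i) a₀ = ∂ᵤ (∂ᵤ (∂ᵤ u)) x a₀ (e i) (e i) := by
      rw [h.D3_symm_right hxc (e i) (e i), h.D3_symm_left hxc (e i)]
    have e2 : |∂ᵤ (∂ᵤ u) x (e i) a₁| ≤ |l i| * Ca :=
      (ContinuousLinearMap.le_of_opNorm_le _ (he.norm_apply i) a₁).trans (by gcongr)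
    have e3 : |∂ᵤ u x a₂| ≤ M * (Ca * (1 + |l i|)) :=
      (ContinuousLinearMap.le_of_opNorm_le _ (h.norm_D1_le hxc) a₂).trans (by gcongr)
    have e4 : |b₂| ≤ Ca * (1 + |l i|) := nb2
    simp only [ContinuousLinearMap.id_apply, smul_eq_mul] at h5
    rw [← ha₀, e1] at h5
    rw [hC3, abs_of_nonneg hM]
    have hCa0 : 0 ≤ Ca := by linarith
    have hlC : 0 ≤ |l i| * Ca := mul_nonneg hμ hCa0
    linarith [(abs_le.1 e2).2, (abs_le.1 e3).2, (abs_le.1 e4).2]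
  have hn : Nonempty (Fin n) := by
    by_contra hne
    rw [not_nonempty_iff] at hne
    have : ξ = 0 := by
      ext i
      exact hne.elim i
    rw [this, norm_zero] at hξ
    norm_num at hξ
  have ha₀n : ‖a₀‖ ≤ Ca := (key hn.some).2
  set T := ∑ i, coeff m l i with hT
  set Q := ∑ i, coeff m l i * l i ^ 2 with hQ
  have hQ0 : 0 ≤ Q := Finset.sum_nonneg fun i _ => mul_nonneg (hF i).le (sq_nonneg _)
  have hsumkey : ∑ i, coeff m l i * (∂ᵤ (∂ᵤ (∂ᵤ (∂ᵤ u))) x ξ ξ (e i) (e i)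
      - ∂ᵤ (∂ᵤ (∂ᵤ u)) x a₀ (e i) (e i)
      - C₃ * (1 + |l i|) + K₁ + K₂ * (l i ^ 2 + ∑ j, ∂ᵤ u x (EuclideanSpace.single j 1) *
        ∂ᵤ (∂ᵤ (∂ᵤ u)) x (EuclideanSpace.single j 1) (e i) (e i))) ≤ 0 :=
    Finset.sum_nonpos fun i _ => mul_nonpos_of_nonneg_of_nonpos (hF i).le (key i).1
  have hexp : ∑ i, coeff m l i * (∂ᵤ (∂ᵤ (∂ᵤ (∂ᵤ u))) x ξ ξ (e i) (e i)
      - ∂ᵤ (∂ᵤ (∂ᵤ u)) x a₀ (e i) (e i)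
      - C₃ * (1 + |l i|) + K₁ + K₂ * (l i ^ 2 + ∑ j, ∂ᵤ u x (EuclideanSpace.single j 1) *
        ∂ᵤ (∂ᵤ (∂ᵤ u)) x (EuclideanSpace.single j 1) (e i) (e i))) =
      ∑ i, coeff m l i * ∂ᵤ (∂ᵤ (∂ᵤ (∂ᵤ u))) x ξ ξ (e i) (e i)
      - ∑ i, coeff m l i * ∂ᵤ (∂ᵤ (∂ᵤ u)) x a₀ (e i) (e i)
      - C₃ * T - C₃ * ∑ i, coeff m l i * |l i| + K₁ * T + K₂ * Q
      + K₂ * ∑ j, ∂ᵤ u x (EuclideanSpace.single j 1) *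
        ∑ i, coeff m l i * ∂ᵤ (∂ᵤ (∂ᵤ u)) x (EuclideanSpace.single j 1) (e i) (e i) := by
    have hswap : ∑ j, ∂ᵤ u x (EuclideanSpace.single j 1) *
        ∑ i, coeff m l i * ∂ᵤ (∂ᵤ (∂ᵤ u)) x (EuclideanSpace.single j 1) (e i) (e i) =
        ∑ i, coeff m l i * ∑ j, ∂ᵤ u x (EuclideanSpace.single j 1) *
          ∂ᵤ (∂ᵤ (∂ᵤ u)) x (EuclideanSpace.single j 1) (e i) (e i) := by
      simp only [Finset.mul_sum]
      rw [Finset.sum_comm]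
      refine Finset.sum_congr rfl fun i _ => Finset.sum_congr rfl fun j _ => ?_
      ring
    rw [hswap, hT, hQ, Finset.mul_sum, Finset.mul_sum, Finset.mul_sum, Finset.mul_sum,
      Finset.mul_sum, ← Finset.sum_sub_distrib, ← Finset.sum_sub_distrib,
      ← Finset.sum_sub_distrib, ← Finset.sum_add_distrib, ← Finset.sum_add_distrib,
      ← Finset.sum_add_distrib]
    refine Finset.sum_congr rfl fun i _ => ?_
    ring
  rw [hexp] at hsumkey
  have e1 := h.le_sum_D4 hf₀ hx he hξ
  have e2 : ∑ i, coeff m l i * ∂ᵤ (∂ᵤ (∂ᵤ u)) x a₀ (e i) (e i) ≤ Lf * (1 + M) * Ca :=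
    (le_abs_self _).trans ((h.abs_sum_D3_le hx he a₀).trans (by gcongr))
  have e3 : C₃ * ∑ i, coeff m l i * |l i| ≤ Q / 2 + C₃ ^ 2 / 2 * T := by
    rw [hQ, hT, Finset.mul_sum, Finset.sum_div, Finset.mul_sum, ← Finset.sum_add_distrib]
    refine Finset.sum_le_sum fun i _ => ?_
    have : 0 ≤ coeff m l i * (|l i| - C₃) ^ 2 := mul_nonneg (hF i).le (sq_nonneg _)
    rw [← sq_abs (l i)]
    linarith
  have e4 : -(n * (M * (Lf * (1 + M)))) ≤ ∑ j, ∂ᵤ u x (EuclideanSpace.single j 1) *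
        ∑ i, coeff m l i * ∂ᵤ (∂ᵤ (∂ᵤ u)) x (EuclideanSpace.single j 1) (e i) (e i) := by
    have : ∀ j ∈ (Finset.univ : Finset (Fin n)), -(M * (Lf * (1 + M))) ≤
        ∂ᵤ u x (EuclideanSpace.single j 1) *
        ∑ i, coeff m l i * ∂ᵤ (∂ᵤ (∂ᵤ u)) x (EuclideanSpace.single j 1) (e i) (e i) := by
      intro j _
      have hs : ‖(EuclideanSpace.single j 1 : Euc n)‖ = 1 := by simp
      have c1 := ContinuousLinearMap.le_of_opNorm_le _ (h.norm_D1_le hxc)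
        (EuclideanSpace.single j 1)
      have c2 := h.abs_sum_D3_le hx he (EuclideanSpace.single j 1)
      rw [hs, mul_one] at c1 c2
      have c3 : |∂ᵤ u x (EuclideanSpace.single j 1) *
        ∑ i, coeff m l i * ∂ᵤ (∂ᵤ (∂ᵤ u)) x (EuclideanSpace.single j 1) (e i) (e i)| ≤
          M * (Lf * (1 + M)) := by
        rw [abs_mul]
        gcongr
        exact c1
      exact (abs_le.1 c3).1
    have h6 := Finset.card_nsmul_le_sum _ _ _ this
    rw [Finset.card_univ, Fintype.card_fin, nsmul_eq_mul] at h6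
    linarith
  -- u_ξξ is an average of the eigenvalues, each of which is controlled by Q = Σ F_i λ_i² through
  -- the lower bound of f.
  have e5 : f₀ * |∂ᵤ (∂ᵤ u) x ξ ξ| ≤ n ^ 2 * Q := by
    have hlj : ∀ j, f₀ * |l j| ≤ n ^ 2 * Q := by
      intro j
      have h6 := he.garding.esym_mul_abs_le (Finset.mem_univ j)
      rw [he.esym_eq, Finset.card_univ, Fintype.card_fin] at h6
      refine le_trans ?_ h6
      have := h.f_lower _ (h.mem_valueRange hxc)
      gcongr
    have hone : ∑ j, inner ℝ (e j) ξ ^ 2 = 1 := by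
      have := e.sum_sq_norm_inner_right ξ
      simpa [hξ] using this
    rw [he.apply_eq_sum]
    calc f₀ * |∑ j, inner ℝ (e j) ξ ^ 2 * l j|
        ≤ f₀ * ∑ j, |inner ℝ (e j) ξ ^ 2 * l j| := by
          gcongr
          exact Finset.abs_sum_le_sum_abs _ _
      _ = ∑ j, inner ℝ (e j) ξ ^ 2 * (f₀ * |l j|) := by
          rw [Finset.mul_sum]
          refine Finset.sum_congr rfl fun j _ => ?_
          rw [abs_mul, abs_of_nonneg (sq_nonneg _)]
          ring
      _ ≤ ∑ j, inner ℝ (e j) ξ ^ 2 * (n ^ 2 * Q) := by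
          refine Finset.sum_le_sum fun j _ => ?_
          exact mul_le_mul_of_nonneg_left (hlj j) (sq_nonneg _)
      _ = n ^ 2 * Q := by rw [← Finset.sum_mul, hone, one_mul]
  have e6 : (Lf + 1) * |∂ᵤ (∂ᵤ u) x ξ ξ| ≤ (K₂ - 1 / 2) * Q := by
    have : (K₂ - 1 / 2) * Q = (Lf + 1) * (n ^ 2 * Q) / f₀ := by
      rw [hK2, abs_of_nonneg hLf]
      ring
    rw [this, le_div_iff₀ hf₀]
    nlinarith
  have e7 := mul_le_mul_of_nonneg_left e4 hK2pos
  have e8 : |∂ᵤ (∂ᵤ u) x ξ ξ| ≤ C := by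
    rw [hC, hA0]
    rw [hK1] at hsumkey
    linarith
  exact (le_abs_self _).trans (e8.trans (le_abs_self _))

end Solution

/-! ### Differentiating the boundary condition along the boundary -/

lemma inner_tangentialPart {n : ℕ} {Ω : Set (Euc n)} {ρ : Euc n → ℝ} {L κ : ℝ} {p : Euc n}
    (h : UCDomain Ω ρ L κ) (hp : p ∈ frontier Ω) (ξ : Euc n) :
    inner ℝ (tangentialPart ρ ξ p) (normalField ρ p) = 0 := by
  rw [tangentialPart, inner_sub_left, real_inner_smul_left, real_inner_self_eq_norm_sq,
    h.norm_normalField hp]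
  ring

lemma UCDomain.inner_gradient_eq_zero {n : ℕ} {Ω : Set (Euc n)} {ρ : Euc n → ℝ} {L κ : ℝ}
    {p : Euc n} (h : UCDomain Ω ρ L κ) (hp : p ∈ frontier Ω) {τ : Euc n}
    (hτ : inner ℝ τ (normalField ρ p) = 0) : inner ℝ τ (gradient ρ p) = 0 := by
  rw [real_inner_comm, h.inner_gradient_eq hp, real_inner_comm, hτ, mul_zero]

lemma UCDomain.neg_normal_mem_posTangentConeAt {n : ℕ} {Ω : Set (Euc n)} {ρ : Euc n → ℝ}
    {L κ : ℝ} {p : Euc n} (h : UCDomain Ω ρ L κ) (hp : p ∈ frontier Ω) :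
    ∃ t : ℝ, 0 < t ∧ -(t • normalField ρ p) ∈ posTangentConeAt (closure Ω) p := by
  have h1 := h.hasDerivAt_line p (-normalField ρ p) 0
  rw [zero_smul, add_zero, inner_neg_right, h.inner_gradient_eq hp, real_inner_self_eq_norm_sq,
    h.norm_normalField hp] at h1
  have h2 : -(‖gradient ρ p‖ * 1 ^ 2) < 0 := by
    have := h.one_le_norm_gradient hp
    linarith
  have h3 := (hasDerivAt_iff_tendsto_slope.1 h1).eventually (Iio_mem_nhds h2)
  have h4 : ∀ᶠ t in 𝓝[>] (0 : ℝ), slope (fun t : ℝ => ρ (p + t • -normalField ρ p)) 0 t < 0 :=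
    h3.filter_mono (nhdsWithin_mono _ fun t ht => (ne_of_gt ht))
  obtain ⟨t, ht, ht0⟩ := (h4.and self_mem_nhdsWithin).exists
  have ht0' : 0 < t := ht0
  refine ⟨t, ht0', mem_posTangentConeAt_of_segment_subset ?_⟩
  refine h.convex_closure.segment_subset (frontier_subset_closure hp) (subset_closure ?_)
  rw [h.mem_iff]
  rw [slope_def_field, zero_smul, add_zero, h.eq_zero_of_mem_frontier hp, sub_zero, sub_zero,
    div_neg_iff] at ht
  rcases ht with ht | ht
  · linarith [ht.2]
  · simpa using ht.1

namespace Solution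

variable {n m : ℕ} {Ω : Set (Euc n)} {ρ u : Euc n → ℝ} {f φ : Euc n × ℝ → ℝ}
  {L κ M f₀ Lf Lφ : ℝ} {x p : Euc n}

set_option hygiene false in
local notation "∂ᵤ" => D (closure Ω)
set_option hygiene false in
local notation "∂ₚ" => D (SProd.sprod (closure Ω) (univ : Set ℝ))

section

variable (h : Solution m Ω ρ u f φ L κ M f₀ Lf Lφ)
include h

lemma boundary_normalField (hp : p ∈ frontier Ω) :
    ∂ᵤ u p (normalField ρ p) - φ (p, u p) = 0 := by
  rw [h.dom.normalField_eq_outerNormal hp, D, h.boundary p hp, sub_self]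

lemma hasFDerivWithinAt_normalField (x : Euc n) :
    HasFDerivWithinAt (normalField ρ) (fderiv ℝ (normalField ρ) x) (closure Ω) x :=
  (h.dom.differentiable_normalField x).hasFDerivAt.hasFDerivWithinAt

lemma hasFDerivWithinAt_fderiv_normalField (x : Euc n) :
    HasFDerivWithinAt (fderiv ℝ (normalField ρ)) (fderiv ℝ (fderiv ℝ (normalField ρ)) x)
      (closure Ω) x :=
  ((((contDiff_normalField h.dom.defining.contDiff).fderiv_right (m := 2)
    (by norm_num)).differentiable (by norm_num) x).hasFDerivAt).hasFDerivWithinAt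

/-- The obliqueness defect of the boundary condition, extended to the closure of the domain. -/
lemma hasFDerivWithinAt_defect (hx : x ∈ closure Ω) :
    ∃ w' : Euc n →L[ℝ] ℝ, HasFDerivWithinAt
      (fun y => ∂ᵤ u y (normalField ρ y) - φ (y, u y)) w' (closure Ω) x ∧
      ∀ e, w' e = ∂ᵤ (∂ᵤ u) x e (normalField ρ x) + ∂ᵤ u x (fderiv ℝ (normalField ρ) x e) -
        ∂ₚ φ (x, u x) (e, ∂ᵤ u x e) := by
  have h1 := (h.hasFDerivWithinAt_D1 hx).clm_apply (h.hasFDerivWithinAt_normalField x)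
  have h2 := (hasFDerivWithinAt_id x (closure Ω)).prodMk (h.hasFDerivWithinAt_u hx)
  have h3 := (h.hasFDerivWithinAt_φ hx (u x)).comp x h2
    (show MapsTo (fun y => (y, u y)) (closure Ω) (closure Ω ×ˢ univ) from
      fun y hy => ⟨hy, mem_univ _⟩)
  refine ⟨_, h1.sub h3, fun e => ?_⟩
  simp
  ring

/-- The tangential derivative of the boundary condition. -/
lemma D2_tangential_normal (hp : p ∈ frontier Ω) (ξ : Euc n) :
    ∂ᵤ (∂ᵤ u) p (tangentialPart ρ ξ p) (normalField ρ p) = mixedTerm Ω ρ u φ ξ p := by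
  obtain ⟨w', h1, h2⟩ := h.hasFDerivWithinAt_defect (frontier_subset_closure hp)
  have h3 := h.dom.tangential_derivative_eq_zero hp (h.dom.inner_gradient_eq_zero hp
    (inner_tangentialPart h.dom hp ξ)) h1 fun q hq => h.boundary_normalField hq
  rw [h2] at h3
  rw [mixedTerm]
  linarith

/-- The middle term is the one subtracted in `auxFun`; without it the form has no coupling between
tangential and normal directions. -/
lemma D2_decomposition (hp : p ∈ frontier Ω) (ξ : Euc n) :
    ∂ᵤ (∂ᵤ u) p ξ ξ = ∂ᵤ (∂ᵤ u) p (tangentialPart ρ ξ p) (tangentialPart ρ ξ p) +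
      2 * inner ℝ ξ (normalField ρ p) * mixedTerm Ω ρ u φ ξ p +
      inner ℝ ξ (normalField ρ p) ^ 2 * ∂ᵤ (∂ᵤ u) p (normalField ρ p) (normalField ρ p) := by
  have h1 := h.D2_tangential_normal hp ξ
  have h2 := h.D2_symm (frontier_subset_closure hp) (normalField ρ p) (tangentialPart ρ ξ p)
  have h3 : ξ = tangentialPart ρ ξ p + inner ℝ ξ (normalField ρ p) • normalField ρ p := by
    simp [tangentialPart]
  conv_lhs => rw [h3]
  simp only [map_add, map_smul, add_apply, smul_apply, smul_eq_mul]
  rw [h2, h1]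
  ring

lemma hasFDerivWithinAt_tangentialPart (ξ x : Euc n) :
    ∃ T : Euc n →L[ℝ] Euc n, HasFDerivWithinAt (tangentialPart ρ ξ) T (closure Ω) x ∧
      ∀ e, T e = -(inner ℝ ξ (normalField ρ x) • fderiv ℝ (normalField ρ) x e +
        inner ℝ ξ (fderiv ℝ (normalField ρ) x e) • normalField ρ x) := by
  have h1 := h.hasFDerivWithinAt_normalField x
  have h2 : HasFDerivWithinAt (fun y => inner ℝ ξ (normalField ρ y)) _ (closure Ω) x :=
    (innerSL ℝ ξ).hasFDerivAt.comp_hasFDerivWithinAt x h1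
  refine ⟨_, (h2.smul h1).const_sub ξ, fun e => ?_⟩
  simp

lemma hasFDerivWithinAt_mixedTerm (hx : x ∈ closure Ω) (ξ : Euc n) :
    ∃ Y' : Euc n →L[ℝ] ℝ, HasFDerivWithinAt (mixedTerm Ω ρ u φ ξ) Y' (closure Ω) x ∧
      ∀ e T, T = -(inner ℝ ξ (normalField ρ x) • fderiv ℝ (normalField ρ) x e +
        inner ℝ ξ (fderiv ℝ (normalField ρ) x e) • normalField ρ x) →
      Y' e = ∂ₚ (∂ₚ φ) (x, u x) (e, ∂ᵤ u x e)
          (tangentialPart ρ ξ x, ∂ᵤ u x (tangentialPart ρ ξ x)) +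
        ∂ₚ φ (x, u x) (T, ∂ᵤ (∂ᵤ u) x e (tangentialPart ρ ξ x) + ∂ᵤ u x T) -
        (∂ᵤ (∂ᵤ u) x e (fderiv ℝ (normalField ρ) x (tangentialPart ρ ξ x)) +
          ∂ᵤ u x (fderiv ℝ (fderiv ℝ (normalField ρ)) x e (tangentialPart ρ ξ x) +
            fderiv ℝ (normalField ρ) x T)) := by
  obtain ⟨T', h1, hT'⟩ := h.hasFDerivWithinAt_tangentialPart ξ x
  have h2 := (hasFDerivWithinAt_id x (closure Ω)).prodMk (h.hasFDerivWithinAt_u hx)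
  have h3 := (h.hasFDerivWithinAt_Dφ hx (u x)).comp x h2
    (show MapsTo (fun y => (y, u y)) (closure Ω) (closure Ω ×ˢ univ) from
      fun y hy => ⟨hy, mem_univ _⟩)
  have h4 := (h.hasFDerivWithinAt_D1 hx).clm_apply h1
  have h5 := h3.clm_apply (h1.prodMk h4)
  have h6 := (h.hasFDerivWithinAt_D1 hx).clm_apply
    ((h.hasFDerivWithinAt_fderiv_normalField x).clm_apply h1)
  refine ⟨_, h5.sub h6, ?_⟩
  rintro e T rfl
  rw [← hT']
  simp only [sub_apply, add_apply, ContinuousLinearMap.comp_apply, ContinuousLinearMap.flip_apply,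
    ContinuousLinearMap.prod_apply, Function.comp_apply, ContinuousLinearMap.id_apply, map_add, id]
  rw [add_comm (∂ᵤ u x (T' e))]
  ring

/-- The second tangential derivative of the boundary condition. -/
lemma D3_tangential_normal (hp : p ∈ frontier Ω) {ξ : Euc n}
    (hξ : inner ℝ ξ (normalField ρ p) = 0) {s : ℝ}
    (hs : s = inner ℝ ξ (fderiv ℝ (normalField ρ) p ξ)) :
    ∂ᵤ (∂ᵤ (∂ᵤ u)) p ξ ξ (normalField ρ p) =
      s * ∂ᵤ (∂ᵤ u) p (normalField ρ p) (normalField ρ p) -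
      2 * ∂ᵤ (∂ᵤ u) p ξ (fderiv ℝ (normalField ρ) p ξ) +
      ∂ₚ φ (p, u p) (0, 1) * ∂ᵤ (∂ᵤ u) p ξ ξ +
      ∂ₚ (∂ₚ φ) (p, u p) (ξ, ∂ᵤ u p ξ) (ξ, ∂ᵤ u p ξ) -
      s * ∂ₚ φ (p, u p) (normalField ρ p, ∂ᵤ u p (normalField ρ p)) -
      ∂ᵤ u p (fderiv ℝ (fderiv ℝ (normalField ρ)) p ξ ξ) +
      s * ∂ᵤ u p (fderiv ℝ (normalField ρ) p (normalField ρ p)) := by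
  have hpc := frontier_subset_closure hp
  obtain ⟨T', h1, hT'⟩ := h.hasFDerivWithinAt_tangentialPart ξ p
  obtain ⟨Y', h2, hY'⟩ := h.hasFDerivWithinAt_mixedTerm hpc ξ
  -- The identity of `D2_tangential_normal` holds all along ∂Ω for fixed ξ, because the tangential
  -- part is taken at the moving point; its difference is differentiated in the direction ξ. The
  -- tangential part itself changes by -sN, which produces the term s u_νν.
  have h3 := (((h.hasFDerivWithinAt_D2 hpc).clm_apply h1).clm_apply
    (h.hasFDerivWithinAt_normalField p)).sub h2
  have h4 := h.dom.tangential_derivative_eq_zero hp (h.dom.inner_gradient_eq_zero hp hξ) h3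
    fun q hq => by
      simp only [Pi.sub_apply]
      rw [h.D2_tangential_normal hq ξ, sub_self]
  have hζ : tangentialPart ρ ξ p = ξ := by rw [tangentialPart, hξ, zero_smul, sub_zero]
  have hT : T' ξ = -(s • normalField ρ p) := by rw [hT', hξ, ← hs, zero_smul, zero_add]
  have h5 : ∂ₚ φ (p, u p) (-(s • normalField ρ p), ∂ᵤ (∂ᵤ u) p ξ ξ +
      ∂ᵤ u p (-(s • normalField ρ p))) = ∂ₚ φ (p, u p) (0, 1) * ∂ᵤ (∂ᵤ u) p ξ ξ -
      s * ∂ₚ φ (p, u p) (normalField ρ p, ∂ᵤ u p (normalField ρ p)) := by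
    rw [mul_comm (∂ₚ φ (p, u p) (0, 1)), ← smul_eq_mul, ← smul_eq_mul, ← map_smul, ← map_smul,
      ← map_sub]
    simp [sub_eq_add_neg]
  simp only [sub_apply, add_apply, ContinuousLinearMap.comp_apply,
    ContinuousLinearMap.flip_apply] at h4
  rw [hY' ξ _ (hT' ξ), hT, hζ, h5] at h4
  simp only [map_neg, map_smul, neg_apply, smul_apply, smul_eq_mul, map_add] at h4
  linarith

end

end Solution

/-! ### Bounding the full Hessian by the double normal derivative -/

/-- A direction maximizing `B(ζ,ζ) + ⟨η,N⟩² B(N,N)`, `ζ = η - ⟨η,N⟩ N`, is orthogonal to `N` and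
an eigenvector for the tangential part of `B` as soon as the maximum exceeds `B(N,N)`. -/
lemma extremal_direction {E : Type*} [NormedAddCommGroup E] [InnerProductSpace ℝ E]
    {B : E →L[ℝ] E →L[ℝ] ℝ} (hB : ∀ a b, B a b = B b a) {N ξ : E} (hN : ‖N‖ = 1) (hξ : ‖ξ‖ = 1)
    {q : ℝ} (hq : q = B (ξ - inner ℝ ξ N • N) (ξ - inner ℝ ξ N • N) + inner ℝ ξ N ^ 2 * B N N)
    (hmax : ∀ η, ‖η‖ = 1 →
      B (η - inner ℝ η N • N) (η - inner ℝ η N • N) + inner ℝ η N ^ 2 * B N N ≤ q)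
    (hgt : B N N < q) :
    inner ℝ ξ N = 0 ∧ ∀ η, inner ℝ η N = 0 → B ξ η = B ξ ξ * inner ℝ ξ η := by
  have hhom : ∀ η, inner ℝ η N = 0 → B η η ≤ q * ‖η‖ ^ 2 := by
    intro η hη
    rcases eq_or_ne η 0 with rfl | hne
    · simp
    · have hpos : 0 < ‖η‖ := norm_pos_iff.2 hne
      have h1 := hmax (‖η‖⁻¹ • η) (by rw [norm_smul, norm_inv, norm_norm, inv_mul_cancel₀ hpos.ne'])
      rw [real_inner_smul_left, hη] at h1
      simp only [mul_zero, zero_smul, sub_zero, map_smul, smul_apply, smul_eq_mul, ne_eq,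
        OfNat.ofNat_ne_zero, not_false_eq_true, zero_pow, zero_mul, add_zero] at h1
      have h2 : B η η = ‖η‖ ^ 2 * (‖η‖⁻¹ * (‖η‖⁻¹ * B η η)) := by field_simp
      rw [h2, mul_comm q]
      gcongr
  have hNN : inner ℝ N N = (1 : ℝ) := by rw [real_inner_self_eq_norm_sq, hN, one_pow]
  -- The tangential part of ξ has squared length 1 - ⟨ξ,N⟩², so q ≤ q(1 - ⟨ξ,N⟩²) + ⟨ξ,N⟩² B(N,N),
  -- impossible for q > B(N,N) unless ⟨ξ,N⟩ = 0.
  have hb : inner ℝ ξ N = 0 := by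
    have h1 := hhom (ξ - inner ℝ ξ N • N) (by
      rw [inner_sub_left, real_inner_smul_left, hNN]; ring)
    have h2 : ‖ξ - inner ℝ ξ N • N‖ ^ 2 = 1 - inner ℝ ξ N ^ 2 := by
      rw [norm_sub_sq_real, hξ, real_inner_smul_right, norm_smul, hN, Real.norm_eq_abs, mul_one,
        sq_abs]
      ring
    rw [h2] at h1
    have h3 : inner ℝ ξ N ^ 2 * (q - B N N) ≤ 0 := by linarith
    have h4 : inner ℝ ξ N ^ 2 ≤ 0 := by
      by_contra! h5
      have := mul_pos h5 (sub_pos.2 hgt)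
      linarith
    exact pow_eq_zero_iff (two_ne_zero) |>.1 (le_antisymm h4 (sq_nonneg _))
  refine ⟨hb, fun η hη => ?_⟩
  have hq' : q = B ξ ξ := by rw [hq, hb]; simp
  rw [← hq']
  set a := B ξ η - q * inner ℝ ξ η with ha
  set c := q * ‖η‖ ^ 2 - B η η with hc
  have hquad : ∀ t : ℝ, 2 * t * a ≤ t ^ 2 * c := by
    intro t
    have h1 := hhom (ξ + t • η) (by rw [inner_add_left, real_inner_smul_left, hb, hη]; ring)
    rw [norm_add_sq_real, hξ, real_inner_smul_right, norm_smul, mul_pow, Real.norm_eq_abs,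
      sq_abs] at h1
    simp only [map_add, map_smul, add_apply, smul_apply, smul_eq_mul] at h1
    rw [hB η ξ, ← hq'] at h1
    rw [ha, hc]
    linarith
  have hcpos : 0 < |c| + 1 := by positivity
  -- The perturbation ξ + tη at essentially the best t; |c| + 1 replaces c to stay away from zero.
  have h1 := hquad (a / (|c| + 1))
  have h2 : (a / (|c| + 1)) ^ 2 * c ≤ (a / (|c| + 1)) ^ 2 * (|c| + 1) := by
    gcongr
    linarith [le_abs_self c]
  have h3 : (a / (|c| + 1)) ^ 2 * (|c| + 1) = a ^ 2 / (|c| + 1) := by field_simp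
  have h4 : 2 * (a / (|c| + 1)) * a = 2 * (a ^ 2 / (|c| + 1)) := by ring
  have h5 : a ^ 2 / (|c| + 1) ≤ 0 := by linarith
  have h6 : a ^ 2 ≤ 0 := by
    rw [div_le_iff₀ hcpos] at h5
    linarith
  have h7 : a = 0 := pow_eq_zero_iff (two_ne_zero) |>.1 (le_antisymm h6 (sq_nonneg _))
  linarith

lemma norm_tangentialPart_le {n : ℕ} {ρ : Euc n → ℝ} {ξ x : Euc n} {c : ℝ}
    (hc : ‖normalField ρ x‖ ≤ c) : ‖tangentialPart ρ ξ x‖ ≤ (1 + c ^ 2) * ‖ξ‖ := by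
  have hc0 : 0 ≤ c := (norm_nonneg _).trans hc
  rw [tangentialPart]
  refine (norm_sub_le _ _).trans ?_
  rw [norm_smul]
  have h1 : ‖(inner ℝ ξ (normalField ρ x) : ℝ)‖ ≤ ‖ξ‖ * c :=
    (norm_inner_le_norm _ _).trans (by gcongr)
  calc ‖ξ‖ + ‖(inner ℝ ξ (normalField ρ x) : ℝ)‖ * ‖normalField ρ x‖ ≤ ‖ξ‖ + ‖ξ‖ * c * c := by
        gcongr
    _ = _ := by ring

namespace Solution

variable {n m : ℕ} {Ω : Set (Euc n)} {ρ u : Euc n → ℝ} {f φ : Euc n × ℝ → ℝ}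
  {L κ M f₀ Lf Lφ : ℝ} {x p : Euc n} {c Mν : ℝ}

set_option hygiene false in
local notation "∂ᵤ" => D (closure Ω)
set_option hygiene false in
local notation "∂ₚ" => D (SProd.sprod (closure Ω) (univ : Set ℝ))

lemma auxFun_eq (y₀ : Euc n) (K₁ K₂ : ℝ) (ξ x : Euc n) : auxFun Ω ρ u φ y₀ K₁ K₂ ξ x =
    ∂ᵤ (∂ᵤ u) x ξ ξ - 2 * inner ℝ ξ (normalField ρ x) * mixedTerm Ω ρ u φ ξ x +
    K₁ / 2 * inner ℝ (x - y₀) (x - y₀) +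
    K₂ / 2 * ∑ j, ∂ᵤ u x (EuclideanSpace.single j 1) * ∂ᵤ u x (EuclideanSpace.single j 1) := by
  rw [auxFun, crossVec_add_crossScal]

section

variable (h : Solution m Ω ρ u f φ L κ M f₀ Lf Lφ)
include h

lemma abs_Dφ_le (hx : x ∈ closure Ω) (e : Euc n) :
    |∂ₚ φ (x, u x) (e, ∂ᵤ u x e)| ≤ Lφ * ((1 + M) * ‖e‖) :=
  (ContinuousLinearMap.le_of_opNorm_le _ (h.norm_φ_le hx).2.1 _).trans
    (mul_le_mul_of_nonneg_left (h.norm_graph_le hx e) h.Lφ_nonneg)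

lemma abs_D1_le (hx : x ∈ closure Ω) (e : Euc n) : |∂ᵤ u x e| ≤ M * ‖e‖ :=
  ContinuousLinearMap.le_of_opNorm_le _ (h.norm_D1_le hx) e

lemma abs_mixedTerm_le (hx : x ∈ closure Ω) (h0 : ‖normalField ρ x‖ ≤ c)
    (h1 : ‖fderiv ℝ (normalField ρ) x‖ ≤ c) (ξ : Euc n) :
    |mixedTerm Ω ρ u φ ξ x| ≤ (Lφ * (1 + M) + M * c) * (1 + c ^ 2) * ‖ξ‖ := by
  have hc0 : 0 ≤ c := (norm_nonneg _).trans h0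
  have hM := h.M_nonneg
  have hL := h.Lφ_nonneg
  have hζ := norm_tangentialPart_le (ξ := ξ) h0
  have e1 := h.abs_Dφ_le hx (tangentialPart ρ ξ x)
  have e2 := h.abs_D1_le hx (fderiv ℝ (normalField ρ) x (tangentialPart ρ ξ x))
  have e3 := ContinuousLinearMap.le_of_opNorm_le _ h1 (tangentialPart ρ ξ x)
  rw [mixedTerm]
  refine (abs_sub _ _).trans ?_
  calc _ ≤ Lφ * ((1 + M) * ‖tangentialPart ρ ξ x‖) + M * (c * ‖tangentialPart ρ ξ x‖) := by
        gcongr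
        exact e2.trans (by gcongr)
    _ = (Lφ * (1 + M) + M * c) * ‖tangentialPart ρ ξ x‖ := by ring
    _ ≤ (Lφ * (1 + M) + M * c) * ((1 + c ^ 2) * ‖ξ‖) := by gcongr
    _ = _ := by ring

lemma abs_D2_normal_le (hp : p ∈ frontier Ω) (h1 : ‖fderiv ℝ (normalField ρ) p‖ ≤ c)
    (hc : 1 ≤ c) (hMν : |∂ᵤ (∂ᵤ u) p (normalField ρ p) (normalField ρ p)| ≤ Mν) (e : Euc n) :
    |∂ᵤ (∂ᵤ u) p (normalField ρ p) e| ≤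
      ((Lφ * (1 + M) + M * c) * (1 + c ^ 2) + Mν) * ‖e‖ := by
  have hpc := frontier_subset_closure hp
  have hN := h.dom.norm_normalField hp
  have h2 := h.abs_mixedTerm_le hpc (hN.le.trans hc) h1 e
  have h3 : e = tangentialPart ρ e p + inner ℝ e (normalField ρ p) • normalField ρ p := by
    simp [tangentialPart]
  have h4 : ∂ᵤ (∂ᵤ u) p (normalField ρ p) e = mixedTerm Ω ρ u φ e p +
      inner ℝ e (normalField ρ p) * ∂ᵤ (∂ᵤ u) p (normalField ρ p) (normalField ρ p) := by
    rw [← h.D2_tangential_normal hp e, h.D2_symm hpc (tangentialPart ρ e p)]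
    conv_lhs => rw [h3]
    simp
  have h5 : |(inner ℝ e (normalField ρ p) : ℝ)| ≤ ‖e‖ := by
    simpa [hN] using abs_real_inner_le_norm e (normalField ρ p)
  rw [h4]
  refine (abs_add_le _ _).trans ?_
  rw [abs_mul, add_mul, mul_comm Mν]
  gcongr

/-- Since DN ξ is tangential, the eigenvector property turns -2D²u(ξ, DN ξ) into -2s u_ξξ with s ≥
κ: uniform convexity provides the good term. Monotonicity of φ discards φ_z u_ξξ, and all other
terms are at most a constant times 1 + Mν. -/
lemma D3_tangential_normal_le (hp : p ∈ frontier Ω) (hc : 1 ≤ c)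
    (h1 : ‖fderiv ℝ (normalField ρ) p‖ ≤ c) (h2 : ‖fderiv ℝ (fderiv ℝ (normalField ρ)) p‖ ≤ c)
    (hMν : |∂ᵤ (∂ᵤ u) p (normalField ρ p) (normalField ρ p)| ≤ Mν) {ξ : Euc n} (hξ : ‖ξ‖ = 1)
    (hξN : inner ℝ ξ (normalField ρ p) = 0) (hq : 0 ≤ ∂ᵤ (∂ᵤ u) p ξ ξ)
    (heig : ∀ η, inner ℝ η (normalField ρ p) = 0 →
      ∂ᵤ (∂ᵤ u) p ξ η = ∂ᵤ (∂ᵤ u) p ξ ξ * inner ℝ ξ η) :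
    ∂ᵤ (∂ᵤ (∂ᵤ u)) p ξ ξ (normalField ρ p) ≤ -(2 * κ * ∂ᵤ (∂ᵤ u) p ξ ξ) +
      (c + Lφ * (1 + M) ^ 2 + Lφ * (1 + M) * c + M * c + M * c ^ 2) * (1 + Mν) := by
  have hpc := frontier_subset_closure hp
  have hN := h.dom.norm_normalField hp
  have hM := h.M_nonneg
  have hL := h.Lφ_nonneg
  have hMν0 : 0 ≤ Mν := (abs_nonneg _).trans hMν
  obtain ⟨-, b1, b2, -⟩ := h.norm_φ_le hpc
  set q := ∂ᵤ (∂ᵤ u) p ξ ξ with hqdef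
  set s : ℝ := inner ℝ ξ (fderiv ℝ (normalField ρ) p ξ) with hs
  rw [h.D3_tangential_normal hp hξN hs, heig _ (h.dom.inner_fderiv_normalField_self hp ξ), ← hs,
    ← hqdef]
  have hκs : κ ≤ s := by
    have := h.dom.le_inner_fderiv_normalField hp hξN
    rw [hξ, real_inner_comm] at this
    linarith
  have hsc : |s| ≤ c := by
    have e1 := abs_real_inner_le_norm ξ (fderiv ℝ (normalField ρ) p ξ)
    have e2 := ContinuousLinearMap.le_of_opNorm_le _ h1 ξ
    rw [hξ] at e1 e2
    linarith
  have hz := h.Dφ_vertical_nonpos hpc (u p)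
  have t1 : |s * ∂ᵤ (∂ᵤ u) p (normalField ρ p) (normalField ρ p)| ≤ c * Mν := by
    rw [abs_mul]
    gcongr
  have hg := h.norm_graph_le hpc ξ
  rw [hξ, mul_one] at hg
  have t2 : |∂ₚ (∂ₚ φ) (p, u p) (ξ, ∂ᵤ u p ξ) (ξ, ∂ᵤ u p ξ)| ≤ Lφ * (1 + M) ^ 2 := by
    calc _ ≤ ‖∂ₚ (∂ₚ φ) (p, u p)‖ * ‖((ξ, ∂ᵤ u p ξ) : Euc n × ℝ)‖ *
          ‖((ξ, ∂ᵤ u p ξ) : Euc n × ℝ)‖ := (∂ₚ (∂ₚ φ) (p, u p)).le_opNorm₂ _ _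
      _ ≤ Lφ * (1 + M) * (1 + M) := by gcongr
      _ = _ := by ring
  have t3 : |s * ∂ₚ φ (p, u p) (normalField ρ p, ∂ᵤ u p (normalField ρ p))| ≤
      c * (Lφ * (1 + M)) := by
    have := h.abs_Dφ_le hpc (normalField ρ p)
    rw [hN, mul_one] at this
    rw [abs_mul]
    gcongr
  have t4 : |∂ᵤ u p (fderiv ℝ (fderiv ℝ (normalField ρ)) p ξ ξ)| ≤ M * c := by
    refine (h.abs_D1_le hpc _).trans ?_
    gcongr
    calc _ ≤ ‖fderiv ℝ (fderiv ℝ (normalField ρ)) p‖ * ‖ξ‖ * ‖ξ‖ :=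
          (fderiv ℝ (fderiv ℝ (normalField ρ)) p).le_opNorm₂ _ _
      _ ≤ c := by rwa [hξ, mul_one, mul_one]
  have t5 : |s * ∂ᵤ u p (fderiv ℝ (normalField ρ) p (normalField ρ p))| ≤ c * (M * c) := by
    have e1 := h.abs_D1_le hpc (fderiv ℝ (normalField ρ) p (normalField ρ p))
    have e2 := ContinuousLinearMap.le_of_opNorm_le _ h1 (normalField ρ p)
    rw [hN, mul_one] at e2
    rw [abs_mul]
    gcongr
    exact e1.trans (by gcongr)
  have t6 : κ * q ≤ s * q := by gcongr
  have t7 : ∂ₚ φ (p, u p) (0, 1) * q ≤ 0 := mul_nonpos_of_nonpos_of_nonneg hz hq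
  have t8 : 0 ≤ (Lφ * (1 + M) ^ 2 + Lφ * (1 + M) * c + M * c + M * c ^ 2) * Mν := by positivity
  linarith [(abs_le.1 t1).2, (abs_le.1 t2).2, (abs_le.1 t3).1, (abs_le.1 t4).1, (abs_le.1 t5).2]

/-- At a boundary maximum the outward derivative of `auxFun` is nonnegative. Because ⟨ξ,N⟩ = 0 at p,
the derivative of `mixedTerm` is multiplied by zero and needs no bound. -/
lemma le_D3_normal (hp : p ∈ frontier Ω) (hc : 1 ≤ c) {K₁ K₂ d : ℝ} (hK₁ : 0 ≤ K₁) (hK₂ : 0 ≤ K₂)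
    (h1 : ‖fderiv ℝ (normalField ρ) p‖ ≤ c)
    (hMν : |∂ᵤ (∂ᵤ u) p (normalField ρ p) (normalField ρ p)| ≤ Mν) {ξ y₀ : Euc n} (hξ : ‖ξ‖ = 1)
    (hd : ‖p - y₀‖ ≤ d) (hξN : inner ℝ ξ (normalField ρ p) = 0)
    (hmax : IsMaxOn (auxFun Ω ρ u φ y₀ K₁ K₂ ξ) (closure Ω) p) :
    -((2 * c * ((Lφ * (1 + M) + M * c) * (1 + c ^ 2)) + K₁ * d +
      K₂ * (n * (M * ((Lφ * (1 + M) + M * c) * (1 + c ^ 2) + 1)))) * (1 + Mν)) ≤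
      ∂ᵤ (∂ᵤ (∂ᵤ u)) p (normalField ρ p) ξ ξ := by
  have hpc := frontier_subset_closure hp
  have hN := h.dom.norm_normalField hp
  have hM := h.M_nonneg
  have hL := h.Lφ_nonneg
  have hMν0 : 0 ≤ Mν := (abs_nonneg _).trans hMν
  have hd0 : 0 ≤ d := (norm_nonneg _).trans hd
  set Y : ℝ := (Lφ * (1 + M) + M * c) * (1 + c ^ 2) with hY
  have hY0 : 0 ≤ Y := by positivity
  obtain ⟨Y', hY', -⟩ := h.hasFDerivWithinAt_mixedTerm hpc ξ
  have d1 := ((h.hasFDerivWithinAt_D2 hpc).clm_apply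
    (hasFDerivWithinAt_const ξ p (closure Ω))).clm_apply (hasFDerivWithinAt_const ξ p (closure Ω))
  have d2 : HasFDerivWithinAt (fun y => 2 * inner ℝ ξ (normalField ρ y)) _ (closure Ω) p :=
    ((innerSL ℝ ξ).hasFDerivAt.comp_hasFDerivWithinAt p
      (h.hasFDerivWithinAt_normalField p)).const_mul 2
  have d3 := (((hasFDerivWithinAt_id p (closure Ω)).sub_const y₀).inner ℝ
    ((hasFDerivWithinAt_id p (closure Ω)).sub_const y₀)).const_mul (K₁ / 2)
  have d4 : ∀ j ∈ (Finset.univ : Finset (Fin n)), HasFDerivWithinAt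
      (fun y => ∂ᵤ u y (EuclideanSpace.single j 1) * ∂ᵤ u y (EuclideanSpace.single j 1)) _
      (closure Ω) p := fun j _ =>
    ((h.hasFDerivWithinAt_D1 hpc).clm_apply
      (hasFDerivWithinAt_const (EuclideanSpace.single j 1) p (closure Ω))).mul
    ((h.hasFDerivWithinAt_D1 hpc).clm_apply
      (hasFDerivWithinAt_const (EuclideanSpace.single j 1) p (closure Ω)))
  have d5 := (HasFDerivWithinAt.fun_sum d4).const_mul (K₂ / 2)
  have d6 := ((d1.sub (d2.mul hY')).add d3).add d5
  have hmax' : IsLocalMaxOn (fun x => ∂ᵤ (∂ᵤ u) x ξ ξ -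
      2 * inner ℝ ξ (normalField ρ x) * mixedTerm Ω ρ u φ ξ x +
      K₁ / 2 * inner ℝ (x - y₀) (x - y₀) +
      K₂ / 2 * ∑ j, ∂ᵤ u x (EuclideanSpace.single j 1) * ∂ᵤ u x (EuclideanSpace.single j 1))
      (closure Ω) p := by
    have : auxFun Ω ρ u φ y₀ K₁ K₂ ξ = _ := funext fun x => auxFun_eq y₀ K₁ K₂ ξ x
    rw [← this]
    exact hmax.localize
  obtain ⟨t, ht, hcone⟩ := h.dom.neg_normal_mem_posTangentConeAt hp
  have h7 := hmax'.hasFDerivWithinAt_nonpos d6 hcone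
  rw [map_neg, map_smul, smul_eq_mul] at h7
  have h8 := nonneg_of_mul_nonneg_right (neg_nonpos.1 h7) ht
  simp only [add_apply, sub_apply, smul_apply, sum_apply, ContinuousLinearMap.comp_apply,
    ContinuousLinearMap.flip_apply, zero_apply, map_zero, zero_add,
    smul_eq_mul, hξN, mul_zero, zero_mul, innerSL_apply_apply, fderivInnerCLM_apply,
    ContinuousLinearMap.prod_apply, ContinuousLinearMap.id_apply, id] at h8
  have t1 : |2 * inner ℝ ξ (fderiv ℝ (normalField ρ) p (normalField ρ p)) *
      mixedTerm Ω ρ u φ ξ p| ≤ 2 * c * Y := by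
    have e1 := h.abs_mixedTerm_le hpc (hN.le.trans hc) h1 ξ
    rw [hξ, mul_one] at e1
    have e2 := abs_real_inner_le_norm ξ (fderiv ℝ (normalField ρ) p (normalField ρ p))
    have e3 := ContinuousLinearMap.le_of_opNorm_le _ h1 (normalField ρ p)
    rw [hN, mul_one] at e3
    rw [hξ, one_mul] at e2
    rw [abs_mul, abs_mul, abs_two]
    gcongr
    exact e2.trans e3
  have t2 : inner ℝ (p - y₀) (normalField ρ p) ≤ d := by
    have := real_inner_le_norm (p - y₀) (normalField ρ p)
    rw [hN, mul_one] at this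
    exact this.trans hd
  have t3 : inner ℝ (normalField ρ p) (p - y₀) ≤ d := by rwa [real_inner_comm]
  have t4 : ∀ j ∈ (Finset.univ : Finset (Fin n)), ∂ᵤ u p (EuclideanSpace.single j 1) *
      ∂ᵤ (∂ᵤ u) p (normalField ρ p) (EuclideanSpace.single j 1) ≤ M * (Y + Mν) := by
    intro j _
    have e0 : ‖(EuclideanSpace.single j 1 : Euc n)‖ = 1 := by simp
    have e1 := h.abs_D2_normal_le hp h1 hc hMν (EuclideanSpace.single j 1)
    have e2 := h.abs_D1_le hpc (EuclideanSpace.single j 1)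
    rw [e0, mul_one] at e1 e2
    refine (le_abs_self _).trans ?_
    rw [abs_mul]
    gcongr
  have t5 := Finset.sum_le_card_nsmul _ _ _ t4
  rw [Finset.card_univ, Fintype.card_fin, nsmul_eq_mul] at t5
  have t6 : ∑ j, (∂ᵤ u p (EuclideanSpace.single j 1) *
      ∂ᵤ (∂ᵤ u) p (normalField ρ p) (EuclideanSpace.single j 1) +
      ∂ᵤ u p (EuclideanSpace.single j 1) *
      ∂ᵤ (∂ᵤ u) p (normalField ρ p) (EuclideanSpace.single j 1)) ≤ 2 * (n * (M * (Y + Mν))) := by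
    rw [Finset.sum_add_distrib]
    linarith
  have t7 : K₁ / 2 * (inner ℝ (p - y₀) (normalField ρ p) + inner ℝ (normalField ρ p) (p - y₀)) ≤
      K₁ * d := by nlinarith
  have t9 : K₂ / 2 * ∑ j, (∂ᵤ u p (EuclideanSpace.single j 1) *
      ∂ᵤ (∂ᵤ u) p (normalField ρ p) (EuclideanSpace.single j 1) +
      ∂ᵤ u p (EuclideanSpace.single j 1) *
      ∂ᵤ (∂ᵤ u) p (normalField ρ p) (EuclideanSpace.single j 1)) ≤
      K₂ * (n * (M * (Y + Mν))) := by
    calc _ ≤ K₂ / 2 * (2 * (n * (M * (Y + Mν)))) := by gcongr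
      _ = _ := by ring
  have t10 : (n : ℝ) * (M * (Y + Mν)) ≤ n * (M * (Y + 1)) * (1 + Mν) := by
    have : Y + Mν ≤ (Y + 1) * (1 + Mν) := by nlinarith
    calc _ ≤ (n : ℝ) * (M * ((Y + 1) * (1 + Mν))) := by gcongr
      _ = _ := by ring
  have t11 := mul_le_mul_of_nonneg_left t10 hK₂
  have t12 : 0 ≤ (2 * c * Y + K₁ * d) * Mν := by positivity
  linarith [(abs_le.1 t1).1, (abs_le.1 t1).2]

end

end Solution

lemma continuous_tangentialPart {n : ℕ} {Ω : Set (Euc n)} {ρ : Euc n → ℝ} {L κ : ℝ}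
    (h : UCDomain Ω ρ L κ) :
    Continuous fun q : Euc n × Euc n => tangentialPart ρ q.2 q.1 := by
  have hN : Continuous (normalField ρ) := h.differentiable_normalField.continuous
  unfold tangentialPart
  fun_prop

namespace Solution

variable {n m : ℕ} {Ω : Set (Euc n)} {ρ u : Euc n → ℝ} {f φ : Euc n × ℝ → ℝ}
  {L κ M f₀ Lf Lφ : ℝ}

set_option hygiene false in
local notation "∂ᵤ" => D (closure Ω)
set_option hygiene false in
local notation "∂ₚ" => D (SProd.sprod (closure Ω) (univ : Set ℝ))

lemma continuousOn_auxFun (h : Solution m Ω ρ u f φ L κ M f₀ Lf Lφ) (y₀ : Euc n) (K₁ K₂ : ℝ) :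
    ContinuousOn (fun q : Euc n × Euc n => auxFun Ω ρ u φ y₀ K₁ K₂ q.2 q.1)
      (closure Ω ×ˢ (univ : Set (Euc n))) := by
  set S := closure Ω ×ˢ (univ : Set (Euc n)) with hS
  have hmap : MapsTo Prod.fst S (closure Ω) := fun q hq => hq.1
  have c1 : ContinuousOn (fun q : Euc n × Euc n => ∂ᵤ u q.1) S :=
    h.contDiffOn_D1.continuousOn.comp continuousOn_fst hmap
  have c2 : ContinuousOn (fun q : Euc n × Euc n => ∂ᵤ (∂ᵤ u) q.1) S :=
    h.contDiffOn_D2.continuousOn.comp continuousOn_fst hmap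
  have cζ : ContinuousOn (fun q : Euc n × Euc n => tangentialPart ρ q.2 q.1) S :=
    (continuous_tangentialPart h.dom).continuousOn
  have hN : Continuous (normalField ρ) := h.dom.differentiable_normalField.continuous
  have cN : ContinuousOn (fun q : Euc n × Euc n =>
      2 * (inner ℝ q.2 (normalField ρ q.1) : ℝ)) S := by
    apply Continuous.continuousOn
    fun_prop
  have cDN : ContinuousOn (fun q : Euc n × Euc n => fderiv ℝ (normalField ρ) q.1) S :=
    (((contDiff_normalField h.dom.defining.contDiff).continuous_fderiv
      (by norm_num)).comp continuous_fst).continuousOn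
  have cu : ContinuousOn (fun q : Euc n × Euc n => (q.1, u q.1)) S :=
    continuousOn_fst.prodMk (h.u_contDiff'.continuousOn.comp continuousOn_fst hmap)
  have cφ : ContinuousOn (fun q : Euc n × Euc n => ∂ₚ φ (q.1, u q.1)) S :=
    (contDiffOn_D (m := 2) h.uniqueDiffOn_prod h.φ_contDiff (by norm_num)).continuousOn.comp cu
      fun q hq => ⟨hq.1, mem_univ _⟩
  have cmix : ContinuousOn (fun q : Euc n × Euc n => mixedTerm Ω ρ u φ q.2 q.1) S :=
    (cφ.clm_apply (cζ.prodMk (c1.clm_apply cζ))).sub (c1.clm_apply (cDN.clm_apply cζ))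
  have cj : ∀ j : Fin n, ContinuousOn
      (fun q : Euc n × Euc n => ∂ᵤ u q.1 (EuclideanSpace.single j 1)) S := fun j =>
    c1.clm_apply continuousOn_const
  have cy : ContinuousOn (fun q : Euc n × Euc n => (inner ℝ (q.1 - y₀) (q.1 - y₀) : ℝ)) S := by
    apply Continuous.continuousOn
    fun_prop
  simp only [auxFun_eq]
  exact ((((c2.clm_apply continuousOn_snd).clm_apply continuousOn_snd).sub (cN.mul cmix)).add
    (continuousOn_const.mul cy)).add
    (continuousOn_const.mul (continuousOn_finsetSum _ fun j _ => (cj j).mul (cj j)))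

/-- The second derivatives are bounded by the double normal derivatives on the boundary. -/
theorem exists_hessian_bound (n m : ℕ) (hn : 2 ≤ n) (L κ M f₀ Lf Lφ : ℝ) (hκ : 0 < κ)
    (hf₀ : 0 < f₀) : ∃ C : ℝ, 0 ≤ C ∧
    ∀ (Ω : Set (Euc n)) (ρ u : Euc n → ℝ) (f φ : Euc n × ℝ → ℝ),
      Solution m Ω ρ u f φ L κ M f₀ Lf Lφ → ∀ Mν : ℝ,
        (∀ p ∈ frontier Ω, |∂ᵤ (∂ᵤ u) p (normalField ρ p) (normalField ρ p)| ≤ Mν) → 0 ≤ Mν →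
        ∀ x ∈ closure Ω, ∀ ξ : Euc n, ‖ξ‖ = 1 → ∂ᵤ (∂ᵤ u) x ξ ξ ≤ C * (1 + Mν) := by
  obtain ⟨K₁, K₂, C₀, hK₁, hK₂, hC₀, H⟩ := exists_interior_bound n m L M f₀ Lf Lφ hf₀
  obtain ⟨c, hc, HN⟩ := exists_normalField_bound n L
  obtain ⟨d, hd, HD⟩ := exists_diameter_bound L κ hκ
  set Y : ℝ := (Lφ * (1 + M) + M * c) * (1 + c ^ 2) with hY
  set C₁ : ℝ := c + Lφ * (1 + M) ^ 2 + Lφ * (1 + M) * c + M * c + M * c ^ 2 with hC₁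
  set C₂ : ℝ := 2 * c * Y + K₁ * d + K₂ * (n * (M * (Y + 1))) with hC₂
  set C₃ : ℝ := K₁ / 2 * d ^ 2 + K₂ / 2 * (n * (M * M)) with hC₃
  refine ⟨|C₀| + |(C₁ + C₂) / (2 * κ)| + 1 + 6 * |c * Y| + |C₃|, by positivity, ?_⟩
  intro Ω ρ u f φ h Mν hMν hMν0 x hx η hη
  have hM := h.M_nonneg
  have hL := h.Lφ_nonneg
  have hY0 : 0 ≤ Y := by positivity
  have hcY : 0 ≤ c * Y := by positivity
  obtain ⟨y₀, hy₀⟩ := h.dom.nonempty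
  have hcomp : IsCompact (closure Ω ×ˢ Metric.sphere (0 : Euc n) 1) :=
    h.dom.isCompact_closure.prod (isCompact_sphere _ _)
  obtain ⟨⟨p, ξ⟩, ⟨hp, hξ⟩, hmax⟩ := hcomp.exists_isMaxOn
    ⟨(x, η), hx, by simpa using hη⟩
    ((h.continuousOn_auxFun y₀ K₁ K₂).mono (prod_mono subset_rfl (subset_univ _)))
  simp only at hp hξ
  rw [mem_sphere_zero_iff_norm] at hξ
  have hmax' : ∀ y ∈ closure Ω, ∀ ζ : Euc n, ‖ζ‖ = 1 →
      auxFun Ω ρ u φ y₀ K₁ K₂ ζ y ≤ auxFun Ω ρ u φ y₀ K₁ K₂ ξ p := fun y hy ζ hζ =>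
    hmax (show (y, ζ) ∈ closure Ω ×ˢ Metric.sphere (0 : Euc n) 1 from
      ⟨hy, mem_sphere_zero_iff_norm.2 hζ⟩)
  have hcross : ∀ y ∈ closure Ω, ∀ ζ : Euc n, ‖ζ‖ = 1 →
      |2 * inner ℝ ζ (normalField ρ y) * mixedTerm Ω ρ u φ ζ y| ≤ 2 * (c * Y) := by
    intro y hy ζ hζ
    obtain ⟨n0, n1, -, -⟩ := HN Ω ρ h.dom.defining y hy
    have e1 := h.abs_mixedTerm_le hy n0 n1 ζ
    have e2 := abs_real_inner_le_norm ζ (normalField ρ y)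
    rw [hζ, mul_one] at e1
    rw [hζ, one_mul] at e2
    rw [abs_mul, abs_mul, abs_two, mul_assoc]
    gcongr
    exact e2.trans n0
  have hrest : ∀ y ∈ closure Ω, 0 ≤ K₁ / 2 * inner ℝ (y - y₀) (y - y₀) + K₂ / 2 * ∑ j,
      ∂ᵤ u y (EuclideanSpace.single j 1) * ∂ᵤ u y (EuclideanSpace.single j 1) ∧
      K₁ / 2 * inner ℝ (y - y₀) (y - y₀) + K₂ / 2 * ∑ j,
      ∂ᵤ u y (EuclideanSpace.single j 1) * ∂ᵤ u y (EuclideanSpace.single j 1) ≤ C₃ := by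
    intro y hy
    have e1 := HD n Ω ρ hn h.dom y hy y₀ (subset_closure hy₀)
    rw [real_inner_self_eq_norm_sq]
    have e2 : ∀ j ∈ (Finset.univ : Finset (Fin n)), ∂ᵤ u y (EuclideanSpace.single j 1) *
        ∂ᵤ u y (EuclideanSpace.single j 1) ≤ M * M := by
      intro j _
      have e3 := h.abs_D1_le hy (EuclideanSpace.single j 1)
      rw [show ‖(EuclideanSpace.single j 1 : Euc n)‖ = 1 by simp, mul_one] at e3
      rw [← abs_mul_abs_self]
      gcongr
    have e4 := Finset.sum_le_card_nsmul _ _ _ e2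
    rw [Finset.card_univ, Fintype.card_fin, nsmul_eq_mul] at e4
    have e5 : 0 ≤ ∑ j, ∂ᵤ u y (EuclideanSpace.single j 1) * ∂ᵤ u y (EuclideanSpace.single j 1) :=
      Finset.sum_nonneg fun j _ => mul_self_nonneg _
    constructor
    · positivity
    · rw [hC₃]
      gcongr
  have hred : ∂ᵤ (∂ᵤ u) x η η ≤ ∂ᵤ (∂ᵤ u) p ξ ξ + 4 * (c * Y) + C₃ := by
    have e1 := hmax' x hx η hη
    simp only [auxFun_eq] at e1
    linarith [(hrest x hx).1, (hrest p hp).2, (abs_le.1 (hcross x hx η hη)).2,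
      (abs_le.1 (hcross p hp ξ hξ)).1]
  have hC3 : 0 ≤ C₃ := (hrest x hx).1.trans (hrest x hx).2
  suffices hmain : ∂ᵤ (∂ᵤ u) p ξ ξ ≤ (|C₀| + |(C₁ + C₂) / (2 * κ)| + 1 + 2 * |c * Y|) * (1 + Mν) by
    have e3 : 0 ≤ (4 * |c * Y| + |C₃|) * Mν := by positivity
    linarith [le_abs_self (c * Y), le_abs_self C₃]
  rcases h.dom.mem_or_mem_frontier hp with hpΩ | hpf
  · have e1 := H Ω ρ u f φ κ h p hpΩ ξ y₀ hξ (by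
      filter_upwards [h.dom.isOpen.mem_nhds hpΩ] with y hy
      exact hmax' y (subset_closure hy) ξ hξ)
    have e2 : (0:ℝ) ≤ |(C₁ + C₂) / (2 * κ)| + 1 + 2 * |c * Y| := by positivity
    nlinarith [le_abs_self C₀, abs_nonneg C₀]
  · have hN := h.dom.norm_normalField hpf
    obtain ⟨n0, n1, n2, -⟩ := HN Ω ρ h.dom.defining p hp
    -- q is the decoupled form at (p, ξ). The quadratic terms of `auxFun` do not depend on ξ, so ξ
    -- also maximizes this form at p; either q ≤ Mν or `extremal_direction` applies.
    set q := ∂ᵤ (∂ᵤ u) p ξ ξ - 2 * inner ℝ ξ (normalField ρ p) * mixedTerm Ω ρ u φ ξ p with hq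
    rcases le_or_gt q Mν with hqM | hqM
    · have e1 := (abs_le.1 (hcross p hp ξ hξ)).2
      have e2 : 0 ≤ (|C₀| + |(C₁ + C₂) / (2 * κ)|) * (1 + Mν) := by positivity
      have e3 : 0 ≤ 2 * |c * Y| * Mν := by positivity
      linarith [le_abs_self (c * Y)]
    · have hext := extremal_direction (B := ∂ᵤ (∂ᵤ u) p) (fun a b => h.D2_symm hp a b) hN hξ
        (q := q) (by
          have := h.D2_decomposition hpf ξ
          rw [tangentialPart] at this
          linarith) (fun ζ hζ => by
          have e1 := h.D2_decomposition hpf ζ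
          have e2 := hmax' p hp ζ hζ
          simp only [auxFun_eq] at e2
          rw [tangentialPart] at e1
          linarith) ((le_abs_self _).trans_lt ((hMν p hpf).trans_lt hqM))
      obtain ⟨hξN, heig⟩ := hext
      have hqq : q = ∂ᵤ (∂ᵤ u) p ξ ξ := by rw [hq, hξN]; ring
      have e1 := h.D3_tangential_normal_le hpf hc n1 n2 (hMν p hpf) hξ hξN
        (by linarith) heig
      have e2 := h.le_D3_normal hpf hc hK₁ hK₂ n1 (hMν p hpf) (y₀ := y₀) hξ
        (HD n Ω ρ hn h.dom p hp y₀ (subset_closure hy₀)) hξN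
        (fun y hy => hmax' y hy ξ hξ)
      -- Both estimates now concern D³u(ξ, ξ, N): 2κ u_ξξ ≤ (C₁ + C₂)(1 + Mν).
      rw [h.D3_symm_left hp, h.D3_symm_right hp] at e2
      rw [← hY, ← hC₂] at e2
      rw [← hC₁] at e1
      have e3 : ∂ᵤ (∂ᵤ u) p ξ ξ ≤ (C₁ + C₂) / (2 * κ) * (1 + Mν) := by
        rw [div_mul_eq_mul_div, le_div_iff₀ (by positivity)]
        linarith
      have e4 : (C₁ + C₂) / (2 * κ) * (1 + Mν) ≤ |(C₁ + C₂) / (2 * κ)| * (1 + Mν) := by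
        gcongr
        exact le_abs_self _
      have e5 : 0 ≤ (|C₀| + 1 + 2 * |c * Y|) * (1 + Mν) := by positivity
      linarith

end Solution

/-! ### The convex barrier at a boundary point -/

/-- The barrier `(ρ + K ρ²) / |∇ρ(p)| - ε |x - p|²`. -/
noncomputable def barrier {n : ℕ} (ρ : Euc n → ℝ) (K ε : ℝ) (p x : Euc n) : ℝ :=
  ‖gradient ρ p‖⁻¹ * (ρ x + K * ρ x ^ 2) - ε * inner ℝ (x - p) (x - p)

/-- The derivative of the barrier. -/
noncomputable def barrierDeriv {n : ℕ} (ρ : Euc n → ℝ) (K ε : ℝ) (p x e : Euc n) : ℝ :=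
  ‖gradient ρ p‖⁻¹ * ((1 + 2 * K * ρ x) * inner ℝ (gradient ρ x) e) -
    ε * (2 * inner ℝ (x - p) e)

/-- The second derivative of the barrier. -/
noncomputable def barrierHess {n : ℕ} (ρ : Euc n → ℝ) (K ε : ℝ) (p x e : Euc n) : ℝ :=
  UCDomain.hessForm ρ K p x e - ε * (2 * inner ℝ e e)

lemma hasD2_inner_self {n : ℕ} (p x e : Euc n) :
    HasD2 (fun t : ℝ => inner ℝ (x + t • e - p) (x + t • e - p)) (2 * inner ℝ (x - p) e)
      (2 * inner ℝ e e) := by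
  refine (HasD2.bilin (innerSL ℝ (E := Euc n)) ((HasD2.line x e).sub (HasD2.const p))
      ((HasD2.line x e).sub (HasD2.const p))).congr ?_ ?_
  · change inner ℝ (e - 0) (x + (0 : ℝ) • e - p) + inner ℝ (x + (0 : ℝ) • e - p) (e - 0) = _
    rw [sub_zero, zero_smul, add_zero, real_inner_comm]
    ring
  · change inner ℝ ((0 : Euc n) - 0) _ + (2 : ℝ) • inner ℝ (e - 0) (e - 0) +
      inner ℝ _ ((0 : Euc n) - 0) = _
    simp

namespace UCDomain

variable {n : ℕ} {Ω : Set (Euc n)} {ρ : Euc n → ℝ} {L κ : ℝ} {p x : Euc n} {K ε c r : ℝ}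

lemma hasD2_barrier (h : UCDomain Ω ρ L κ) (K ε : ℝ) (p x e : Euc n) :
    HasD2 (fun t : ℝ => barrier ρ K ε p (x + t • e)) (barrierDeriv ρ K ε p x e)
      (barrierHess ρ K ε p x e) := by
  have h1 : HasD2 (fun t : ℝ => ‖gradient ρ p‖⁻¹ * (ρ (x + t • e) + K * ρ (x + t • e) ^ 2))
      (‖gradient ρ p‖⁻¹ * ((1 + 2 * K * ρ x) * inner ℝ (gradient ρ x) e))
      (hessForm ρ K p x e) :=
    ⟨_, Eventually.of_forall fun t => h.hasDerivAt_convexified K p x e t, by simp, by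
      simpa using h.hasDerivAt_convexified_deriv K p x e 0⟩
  exact h1.sub ((hasD2_inner_self p x e).const_mul ε)

lemma L_nonneg (h : UCDomain Ω ρ L κ) (hp : p ∈ closure Ω) : 0 ≤ L :=
  (norm_nonneg _).trans (h.norm_gradient_le hp)

lemma inv_norm_gradient_le (h : UCDomain Ω ρ L κ) (hp : p ∈ frontier Ω) :
    ‖gradient ρ p‖⁻¹ ≤ 1 := inv_le_one_of_one_le₀ (h.one_le_norm_gradient hp)

lemma abs_le_of_norm_sub_le (h : UCDomain Ω ρ L κ) (hp : p ∈ frontier Ω) (hx : x ∈ closure Ω)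
    (hr : ‖x - p‖ ≤ r) : |ρ x| ≤ L * r := by
  have h1 := h.abs_sub_le (frontier_subset_closure hp) hx
  rw [h.eq_zero_of_mem_frontier hp, sub_zero] at h1
  have := h.L_nonneg hx
  exact h1.trans (by gcongr)

/-- ρ + Kρ² ≤ 0 near p inside Ω, so the subtracted paraboloid is a definite margin. It makes the
comparison function nonnegative on the sphere around p. -/
lemma barrier_le (h : UCDomain Ω ρ L κ) (hx : x ∈ closure Ω) (hK : 1 / 2 ≤ 1 + 2 * K * ρ x) :
    barrier ρ K ε p x ≤ -(ε * ‖x - p‖ ^ 2) := by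
  have h1 := h.nonpos_of_mem_closure hx
  have h2 : ρ x + K * ρ x ^ 2 ≤ 0 := by nlinarith
  have h3 : ‖gradient ρ p‖⁻¹ * (ρ x + K * ρ x ^ 2) ≤ 0 :=
    mul_nonpos_of_nonneg_of_nonpos (inv_nonneg.2 (norm_nonneg _)) h2
  rw [barrier, real_inner_self_eq_norm_sq]
  linarith

lemma neg_barrier_le (h : UCDomain Ω ρ L κ) (hp : p ∈ frontier Ω) (hx : x ∈ closure Ω)
    (hK : 0 ≤ K) (hε1 : ε ≤ 1) (hr : ‖x - p‖ ≤ r) (hr1 : r ≤ 1) :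
    -barrier ρ K ε p x ≤ (L + 1) * r := by
  have h0 := h.nonpos_of_mem_closure hx
  have h1 := h.abs_le_of_norm_sub_le hp hx hr
  rw [abs_of_nonpos h0] at h1
  have h2 := h.inv_norm_gradient_le hp
  have h3 : 0 ≤ ‖gradient ρ p‖⁻¹ := inv_nonneg.2 (norm_nonneg _)
  have h4 : ‖gradient ρ p‖⁻¹ * -ρ x ≤ 1 * (L * r) := by
    gcongr
    linarith
  have h5 : 0 ≤ ‖gradient ρ p‖⁻¹ * (K * ρ x ^ 2) := by positivity
  have hr0 : 0 ≤ r := (norm_nonneg _).trans hr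
  have h6 : ε * ‖x - p‖ ^ 2 ≤ r := by
    calc ε * ‖x - p‖ ^ 2 ≤ 1 * r ^ 2 := by gcongr
      _ ≤ r := by nlinarith
  rw [barrier, real_inner_self_eq_norm_sq]
  linarith

/-- Near p the gradient of the barrier is close to N(p), so a small derivative of the barrier
identifies almost tangential directions. -/
lemma abs_barrierDeriv_sub_le (h : UCDomain Ω ρ L κ) (hp : p ∈ frontier Ω) (hx : x ∈ closure Ω)
    (hK : 0 ≤ K) (hε : 0 ≤ ε) (hε1 : ε ≤ 1) (hr : ‖x - p‖ ≤ r) {e : Euc n} (he : ‖e‖ = 1) :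
    |barrierDeriv ρ K ε p x e - inner ℝ e (normalField ρ p)| ≤ (L + 2 * K * L ^ 2 + 2) * r := by
  have hL := h.L_nonneg hx
  have hr0 : 0 ≤ r := (norm_nonneg _).trans hr
  have hg : 0 < ‖gradient ρ p‖ := zero_lt_one.trans_le (h.one_le_norm_gradient hp)
  have h1 : inner ℝ e (normalField ρ p) = ‖gradient ρ p‖⁻¹ * inner ℝ (gradient ρ p) e := by
    rw [h.inner_gradient_eq hp, inv_mul_cancel_left₀ hg.ne', real_inner_comm]
  have h2 : barrierDeriv ρ K ε p x e - inner ℝ e (normalField ρ p) =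
      ‖gradient ρ p‖⁻¹ * (inner ℝ (gradient ρ x - gradient ρ p) e +
        2 * K * ρ x * inner ℝ (gradient ρ x) e) - 2 * ε * inner ℝ (x - p) e := by
    rw [barrierDeriv, h1, inner_sub_left (gradient ρ x)]
    ring
  have e1 : |inner ℝ (gradient ρ x - gradient ρ p) e| ≤ L * r := by
    have := abs_real_inner_le_norm (gradient ρ x - gradient ρ p) e
    rw [he, mul_one] at this
    exact this.trans ((h.norm_gradient_sub_le (frontier_subset_closure hp) hx).trans (by gcongr))
  have e2 : |2 * K * ρ x * inner ℝ (gradient ρ x) e| ≤ 2 * K * L ^ 2 * r := by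
    have e3 := abs_real_inner_le_norm (gradient ρ x) e
    rw [he, mul_one] at e3
    have e4 := e3.trans (h.norm_gradient_le hx)
    rw [abs_mul, abs_mul, abs_of_nonneg (by positivity : 0 ≤ 2 * K)]
    calc _ ≤ 2 * K * (L * r) * L := by
          gcongr
          exact h.abs_le_of_norm_sub_le hp hx hr
      _ = _ := by ring
  have e5 : |2 * ε * inner ℝ (x - p) e| ≤ 2 * r := by
    have e3 := abs_real_inner_le_norm (x - p) e
    rw [he, mul_one] at e3
    rw [abs_mul, abs_of_nonneg (by positivity : 0 ≤ 2 * ε)]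
    calc _ ≤ 2 * 1 * r := by
          gcongr
          exact e3.trans hr
      _ = _ := by ring
  rw [h2]
  refine (abs_sub _ _).trans ?_
  rw [abs_mul, abs_of_nonneg (inv_nonneg.2 hg.le)]
  have e6 := abs_add_le (inner ℝ (gradient ρ x - gradient ρ p) e)
    (2 * K * ρ x * inner ℝ (gradient ρ x) e)
  calc _ ≤ 1 * (L * r + 2 * K * L ^ 2 * r) + 2 * r := by
        gcongr
        · exact h.inv_norm_gradient_le hp
        · linarith
    _ = _ := by ring

lemma norm_normalField_sub_le (h : UCDomain Ω ρ L κ) (hp : p ∈ closure Ω) (hx : x ∈ closure Ω)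
    (hc : ∀ y ∈ closure Ω, ‖fderiv ℝ (normalField ρ) y‖ ≤ c) (hr : ‖x - p‖ ≤ r) :
    ‖normalField ρ x - normalField ρ p‖ ≤ c * r := by
  have h1 := h.convex_closure.norm_image_sub_le_of_norm_hasFDerivWithin_le
    (fun y _ => (h.differentiable_normalField y).hasFDerivAt.hasFDerivWithinAt) hc hp hx
  have hc0 := (norm_nonneg _).trans (hc x hx)
  exact h1.trans (by gcongr)

lemma norm_fderiv_normalField_sub_le (h : UCDomain Ω ρ L κ) (hp : p ∈ closure Ω)
    (hx : x ∈ closure Ω) (hc : ∀ y ∈ closure Ω, ‖fderiv ℝ (fderiv ℝ (normalField ρ)) y‖ ≤ c)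
    (hr : ‖x - p‖ ≤ r) :
    ‖fderiv ℝ (normalField ρ) x - fderiv ℝ (normalField ρ) p‖ ≤ c * r := by
  have h1 := h.convex_closure.norm_image_sub_le_of_norm_hasFDerivWithin_le
    (fun y _ => (((contDiff_normalField h.defining.contDiff).fderiv_right (m := 2)
      (by norm_num)).differentiable (by norm_num) y).hasFDerivAt.hasFDerivWithinAt) hc hp hx
  have hc0 := (norm_nonneg _).trans (hc x hx)
  exact h1.trans (by gcongr)

/-- Convexity in almost tangential directions near the boundary. -/
lemma inner_fderiv_normalField_nonneg (h : UCDomain Ω ρ L κ) (hκ : 0 ≤ κ) (hp : p ∈ frontier Ω)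
    (hx : x ∈ closure Ω) (hc1 : ∀ y ∈ closure Ω, ‖fderiv ℝ (normalField ρ) y‖ ≤ c)
    (hc2 : ∀ y ∈ closure Ω, ‖fderiv ℝ (fderiv ℝ (normalField ρ)) y‖ ≤ c) (hr : ‖x - p‖ ≤ r)
    {e : Euc n} (he : ‖e‖ = 1) {b : ℝ} (hb : |inner ℝ e (normalField ρ p)| ≤ b)
    (hsmall : 2 * c * b + κ * b ^ 2 + c * r ≤ κ) :
    0 ≤ inner ℝ e (fderiv ℝ (normalField ρ) x e) := by
  have hpc := frontier_subset_closure hp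
  have hN := h.norm_normalField hp
  have hc0 : 0 ≤ c := (norm_nonneg _).trans (hc1 p hpc)
  have hb0 : 0 ≤ b := (abs_nonneg _).trans hb
  set a : ℝ := inner ℝ e (normalField ρ p) with ha
  set τ := e - a • normalField ρ p with hτ
  have hNN : inner ℝ (normalField ρ p) (normalField ρ p) = (1 : ℝ) := by
    rw [real_inner_self_eq_norm_sq, hN, one_pow]
  have hτN : inner ℝ τ (normalField ρ p) = 0 := by
    rw [hτ, inner_sub_left, real_inner_smul_left, hNN, ← ha]
    ring
  have hτn : ‖τ‖ ^ 2 = 1 - a ^ 2 := by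
    rw [hτ, norm_sub_sq_real, he, real_inner_smul_right, norm_smul, hN, Real.norm_eq_abs, mul_one,
      sq_abs, ← ha]
    ring
  have hτ1 : ‖τ‖ ≤ 1 := by nlinarith [norm_nonneg τ, sq_nonneg a]
  have h1 := h.le_inner_fderiv_normalField hp hτN
  rw [hτn] at h1
  have h2 : a ^ 2 ≤ b ^ 2 := by
    rw [← sq_abs]
    gcongr
  set A := fderiv ℝ (normalField ρ) p with hA
  have hAe : ∀ v, ‖A v‖ ≤ c * ‖v‖ := fun v => ContinuousLinearMap.le_of_opNorm_le _ (hc1 p hpc) v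
  have e1 : |inner ℝ e (fderiv ℝ (normalField ρ) x e - A e)| ≤ c * r := by
    have h3 := abs_real_inner_le_norm e (fderiv ℝ (normalField ρ) x e - A e)
    rw [he, one_mul] at h3
    refine h3.trans ?_
    have h4 := ContinuousLinearMap.le_of_opNorm_le _
      (h.norm_fderiv_normalField_sub_le hpc hx hc2 hr) e
    rwa [he, mul_one] at h4
  have e2 : |inner ℝ e (A (a • normalField ρ p))| ≤ c * b := by
    have h3 := abs_real_inner_le_norm e (A (a • normalField ρ p))
    rw [he, one_mul] at h3
    refine h3.trans ((hAe _).trans ?_)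
    rw [norm_smul, hN, mul_one, Real.norm_eq_abs]
    gcongr
  have e3 : |inner ℝ (a • normalField ρ p) (A τ)| ≤ c * b := by
    refine (abs_real_inner_le_norm _ _).trans ?_
    rw [norm_smul, hN, mul_one, Real.norm_eq_abs, mul_comm c b]
    gcongr
    exact (hAe τ).trans (mul_le_of_le_one_right hc0 hτ1)
  -- Split e = τ + aN in both slots and freeze DN at p: the curvature term ⟨DN τ, τ⟩ ≥ κ(1 - a²) is
  -- the only one that is not small.
  have h5 : inner ℝ e (fderiv ℝ (normalField ρ) x e) =
      inner ℝ e (fderiv ℝ (normalField ρ) x e - A e) + inner ℝ e (A (a • normalField ρ p)) +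
      inner ℝ (a • normalField ρ p) (A τ) + inner ℝ (A τ) τ := by
    rw [real_inner_comm τ (A τ)]
    have : A e = A τ + A (a • normalField ρ p) := by rw [← map_add, hτ, sub_add_cancel]
    rw [inner_sub_right, this, inner_add_right]
    conv_lhs => rw [← sub_add_cancel (inner ℝ e _) (inner ℝ e (A τ))]
    rw [show inner ℝ e (A τ) = (inner ℝ τ (A τ) + inner ℝ (a • normalField ρ p) (A τ) : ℝ) by
      rw [← inner_add_left, hτ, sub_add_cancel]]
    ring
  rw [h5]
  have h6 : κ * a ^ 2 ≤ κ * b ^ 2 := by gcongr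
  linarith [(abs_le.1 e1).1, (abs_le.1 e2).1, (abs_le.1 e3).1]

end UCDomain

/-- In the application a_i = σλ_i, ν_i = ⟨e_i, DN e_i⟩ and H_i is the barrier derivative. Positive
a_i are compared with a_j, and |H_j| ≥ 1/(2n) gives F_j ≤ 4n² Σ F_i H_i². Negative a_i have a good
sign when |H_i| < η, and otherwise 1 ≤ H_i²/η² moves them into the same sum. -/
lemma sum_curvature_le {n : ℕ} {F a ν H : Fin n → ℝ} {B T c C Λ θ η : ℝ} (hF : ∀ i, 0 ≤ F i)
    (hT : 0 ≤ T) (hB : 0 ≤ B) (hc : 0 ≤ c) (hC : 0 ≤ C) (hΛ : 0 ≤ Λ) (hθ : 0 ≤ θ) (hη : 0 < η)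
    (ha : ∀ i, |a i| ≤ Λ * B) (hν : ∀ i, |ν i| ≤ c) (hpos : ∀ i, |H i| < η → 0 ≤ ν i)
    {j : Fin n} (hj : 1 ≤ 2 * n * |H j|)
    (hcomp : ∀ i, F i * a i ≤ C * (F j * a j) + θ * B * T) :
    ∑ i, F i * (a i * ν i) ≤ n * c * θ * B * T +
      (4 * n ^ 3 * c * C * Λ + c * Λ / η ^ 2) * B * ∑ i, F i * H i ^ 2 := by
  set S := ∑ i, F i * H i ^ 2 with hS
  have hS0 : ∀ i, 0 ≤ F i * H i ^ 2 := fun i => mul_nonneg (hF i) (sq_nonneg _)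
  have hFj : F j ≤ 4 * n ^ 2 * S := by
    have h1 : F j * H j ^ 2 ≤ S :=
      Finset.single_le_sum (f := fun i => F i * H i ^ 2) (fun i _ => hS0 i) (Finset.mem_univ j)
    have h2 : 1 ≤ (2 * n * |H j|) ^ 2 := one_le_pow₀ hj
    rw [mul_pow, sq_abs] at h2
    calc F j = F j * 1 := (mul_one _).symm
      _ ≤ F j * ((2 * n) ^ 2 * H j ^ 2) := mul_le_mul_of_nonneg_left h2 (hF j)
      _ = 4 * n ^ 2 * (F j * H j ^ 2) := by ring
      _ ≤ _ := by gcongr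
  have hS1 : 0 ≤ S := Finset.sum_nonneg fun i _ => hS0 i
  have hterm : ∀ i ∈ (Finset.univ : Finset (Fin n)), F i * (a i * ν i) ≤
      c * (C * (4 * n ^ 2 * S * (Λ * B)) + θ * B * T) + c * Λ / η ^ 2 * B * (F i * H i ^ 2) := by
    intro i _
    have hr1 : 0 ≤ c * (C * (4 * n ^ 2 * S * (Λ * B)) + θ * B * T) := by positivity
    have hr2 : 0 ≤ c * Λ / η ^ 2 * B * (F i * H i ^ 2) := mul_nonneg (by positivity) (hS0 i)
    rcases le_or_gt 0 (a i) with hai | hai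
    · have h1 : F i * (a i * ν i) ≤ c * (F i * a i) := by
        have := mul_le_mul_of_nonneg_left ((le_abs_self _).trans (hν i)) (mul_nonneg (hF i) hai)
        linarith
      have h2 : F j * a j ≤ 4 * n ^ 2 * S * (Λ * B) :=
        (mul_le_mul_of_nonneg_left ((le_abs_self _).trans (ha j)) (hF j)).trans (by gcongr)
      have h3 : c * (F i * a i) ≤ c * (C * (4 * n ^ 2 * S * (Λ * B)) + θ * B * T) := by
        gcongr
        exact (hcomp i).trans (by gcongr)
      linarith
    · rcases lt_or_ge |H i| η with hH | hH
      · have h1 : F i * (a i * ν i) ≤ 0 :=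
          mul_nonpos_of_nonneg_of_nonpos (hF i)
            (mul_nonpos_of_nonpos_of_nonneg hai.le (hpos i hH))
        linarith
      · have h1 : a i * ν i ≤ Λ * B * c := by
          refine (le_abs_self _).trans ?_
          rw [abs_mul]
          gcongr
          exacts [ha i, hν i]
        have h2 : 1 ≤ H i ^ 2 / η ^ 2 := by
          rw [one_le_div (by positivity), ← sq_abs (H i)]
          gcongr
        have h3 : F i * (a i * ν i) ≤ F i * (Λ * B * c * (H i ^ 2 / η ^ 2)) := by
          refine mul_le_mul_of_nonneg_left (h1.trans ?_) (hF i)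
          exact le_mul_of_one_le_right (by positivity) h2
        have h4 : F i * (Λ * B * c * (H i ^ 2 / η ^ 2)) =
            c * Λ / η ^ 2 * B * (F i * H i ^ 2) := by ring
        linarith
  refine (Finset.sum_le_sum hterm).trans (le_of_eq ?_)
  rw [Finset.sum_add_distrib, Finset.sum_const, Finset.card_univ, Fintype.card_fin, nsmul_eq_mul,
    ← Finset.mul_sum, ← hS]
  ring

/-! ### The comparison function for the double normal derivative -/

/-- The boundary defect `u_ν - φ(x,u)`, extended to the closure of the domain. -/
noncomputable def defect {n : ℕ} (Ω : Set (Euc n)) (ρ u : Euc n → ℝ) (φ : Euc n × ℝ → ℝ)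
    (x : Euc n) : ℝ :=
  D (closure Ω) u x (normalField ρ x) - φ (x, u x)

/-- The function that is minimized in the double normal estimate. -/
noncomputable def barrierComparison {n : ℕ} (Ω : Set (Euc n)) (ρ u : Euc n → ℝ)
    (φ : Euc n × ℝ → ℝ) (K ε β σ B : ℝ) (p x : Euc n) : ℝ :=
  (1 - β * barrier ρ K ε p x) * (σ * defect Ω ρ u φ x) - B * barrier ρ K ε p x

namespace Solution

variable {n m : ℕ} {Ω : Set (Euc n)} {ρ u : Euc n → ℝ} {f φ : Euc n × ℝ → ℝ}
  {L κ M f₀ Lf Lφ : ℝ} {x p : Euc n} {c : ℝ}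

set_option hygiene false in
local notation "∂ᵤ" => D (closure Ω)
set_option hygiene false in
local notation "∂ₚ" => D (SProd.sprod (closure Ω) (univ : Set ℝ))

section

variable (h : Solution m Ω ρ u f φ L κ M f₀ Lf Lφ)
include h

lemma hasD2_defect (hx : x ∈ Ω) (e : Euc n) :
    HasD2 (fun t : ℝ => defect Ω ρ u φ (x + t • e))
      (∂ᵤ (∂ᵤ u) x e (normalField ρ x) + ∂ᵤ u x (fderiv ℝ (normalField ρ) x e) -
        ∂ₚ φ (x, u x) (e, ∂ᵤ u x e))
      (∂ᵤ (∂ᵤ (∂ᵤ u)) x e e (normalField ρ x) +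
        2 * ∂ᵤ (∂ᵤ u) x e (fderiv ℝ (normalField ρ) x e) +
        ∂ᵤ u x (fderiv ℝ (fderiv ℝ (normalField ρ)) x e e) -
        (∂ₚ (∂ₚ φ) (x, u x) (e, ∂ᵤ u x e) (e, ∂ᵤ u x e) +
          ∂ₚ φ (x, u x) (0, ∂ᵤ (∂ᵤ u) x e e))) := by
  have hNc := contDiff_normalField h.dom.defining.contDiff
  have hN : HasD2 (fun t : ℝ => normalField ρ (x + t • e)) (fderiv ℝ (normalField ρ) x e)
      (fderiv ℝ (fderiv ℝ (normalField ρ)) x e e) :=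
    HasD2.along e
      (Eventually.of_forall fun y => (hNc.differentiable (by norm_num) y).hasFDerivAt)
      (((hNc.fderiv_right (m := 2) (by norm_num)).differentiable (by norm_num) x).hasFDerivAt)
  have h1 := HasD2.bilin (ContinuousLinearMap.id ℝ (Euc n →L[ℝ] ℝ)) (h.hasD2_D1 hx e) hN
  have h2 := (h.hasD2_graph hx e).comp (g := φ) (g' := ∂ₚ φ) (g'' := ∂ₚ (∂ₚ φ) (x, u x))
    (by
      simp only [zero_smul, add_zero]
      exact (h.eventually_mem_prod hx _).mono fun q hq => h.hasFDerivAt_φ hq)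
    (by
      simp only [zero_smul, add_zero]
      exact h.hasFDerivAt_Dφ ⟨hx, mem_univ _⟩)
  refine (h1.sub h2).congr ?_ ?_
  · simp
  · simp

lemma abs_defect_le (hx : x ∈ closure Ω) (hN : ‖normalField ρ x‖ ≤ c) :
    |defect Ω ρ u φ x| ≤ M * c + Lφ := by
  have hM := h.M_nonneg
  rw [defect]
  refine (abs_sub _ _).trans (add_le_add ((h.abs_D1_le hx _).trans (by gcongr)) (h.norm_φ_le hx).1)

lemma defect_eq_zero (hp : p ∈ frontier Ω) : defect Ω ρ u φ p = 0 := h.boundary_normalField hp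

/-- The linearized operator applied to the boundary defect. -/
lemma abs_sum_defect_le {e : OrthonormalBasis (Fin n) ℝ (Euc n)} {l : Fin n → ℝ} (hx : x ∈ Ω)
    (he : IsEigenframe m Ω u f x e l) (h0 : ‖normalField ρ x‖ ≤ c)
    (h2 : ‖fderiv ℝ (fderiv ℝ (normalField ρ)) x‖ ≤ c) :
    |∑ i, coeff m l i * (∂ᵤ (∂ᵤ (∂ᵤ u)) x (e i) (e i) (normalField ρ x) +
        2 * ∂ᵤ (∂ᵤ u) x (e i) (fderiv ℝ (normalField ρ) x (e i)) +
        ∂ᵤ u x (fderiv ℝ (fderiv ℝ (normalField ρ)) x (e i) (e i)) -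
        (∂ₚ (∂ₚ φ) (x, u x) (e i, ∂ᵤ u x (e i)) (e i, ∂ᵤ u x (e i)) +
          ∂ₚ φ (x, u x) (0, ∂ᵤ (∂ᵤ u) x (e i) (e i)))) -
      2 * ∑ i, coeff m l i * (l i * inner ℝ (e i) (fderiv ℝ (normalField ρ) x (e i)))| ≤
    Lf * (1 + M) * c + Lφ * ((m + 1) * Lf) +
      (M * c + Lφ * (1 + M) ^ 2) * ∑ i, coeff m l i := by
  have hxc := subset_closure hx
  have hM := h.M_nonneg
  have hLf := h.Lf_nonneg
  have hLφ := h.Lφ_nonneg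
  have hF := he.coeff_pos
  obtain ⟨-, b1, b2, -⟩ := h.norm_φ_le hxc
  -- By symmetry of D³u the leading terms form the linearized equation in the direction N, and φ_z Σ
  -- F_i λ_i is bounded by Euler's identity. The curvature sum, moved to the left, is the only term
  -- that is not bounded by a constant plus a multiple of Σ F_i.
  have hsplit : ∑ i, coeff m l i * (∂ᵤ (∂ᵤ (∂ᵤ u)) x (e i) (e i) (normalField ρ x) +
        2 * ∂ᵤ (∂ᵤ u) x (e i) (fderiv ℝ (normalField ρ) x (e i)) +
        ∂ᵤ u x (fderiv ℝ (fderiv ℝ (normalField ρ)) x (e i) (e i)) -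
        (∂ₚ (∂ₚ φ) (x, u x) (e i, ∂ᵤ u x (e i)) (e i, ∂ᵤ u x (e i)) +
          ∂ₚ φ (x, u x) (0, ∂ᵤ (∂ᵤ u) x (e i) (e i)))) -
      2 * ∑ i, coeff m l i * (l i * inner ℝ (e i) (fderiv ℝ (normalField ρ) x (e i))) =
      ∑ i, coeff m l i * ∂ᵤ (∂ᵤ (∂ᵤ u)) x (normalField ρ x) (e i) (e i) -
      ∂ₚ φ (x, u x) (0, 1) * ∑ i, l i * coeff m l i +
      ∑ i, coeff m l i * (∂ᵤ u x (fderiv ℝ (fderiv ℝ (normalField ρ)) x (e i) (e i)) -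
        ∂ₚ (∂ₚ φ) (x, u x) (e i, ∂ᵤ u x (e i)) (e i, ∂ᵤ u x (e i))) := by
    rw [Finset.mul_sum, Finset.mul_sum, ← Finset.sum_sub_distrib, ← Finset.sum_sub_distrib,
      ← Finset.sum_add_distrib]
    refine Finset.sum_congr rfl fun i _ => ?_
    have e1 : ∂ₚ φ (x, u x) (0, ∂ᵤ (∂ᵤ u) x (e i) (e i)) = l i * ∂ₚ φ (x, u x) (0, 1) := by
      rw [he.apply_self, ← smul_eq_mul, ← map_smul]
      simp
    rw [e1, he.eigen, h.D3_symm_right hxc (e i) (e i), h.D3_symm_left hxc (e i)]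
    ring
  rw [hsplit]
  have t1 : |∑ i, coeff m l i * ∂ᵤ (∂ᵤ (∂ᵤ u)) x (normalField ρ x) (e i) (e i)| ≤
      Lf * (1 + M) * c := (h.abs_sum_D3_le hx he _).trans (by gcongr)
  have t2 : |∂ₚ φ (x, u x) (0, 1) * ∑ i, l i * coeff m l i| ≤ Lφ * ((m + 1) * Lf) := by
    have e1 : ∑ i, l i * coeff m l i = (m + 1) * f (x, u x) := by
      rw [← he.esym_eq]
      exact sum_mul_esym_erase m Finset.univ l
    have e2 : |∂ₚ φ (x, u x) (0, 1)| ≤ Lφ := by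
      refine (ContinuousLinearMap.le_of_opNorm_le _ b1 _).trans ?_
      simp [Prod.norm_def]
    rw [abs_mul, e1, abs_mul, abs_of_nonneg (by positivity : (0 : ℝ) ≤ m + 1)]
    gcongr
    exact (h.norm_f_le hxc).1
  have t3 : |∑ i, coeff m l i * (∂ᵤ u x (fderiv ℝ (fderiv ℝ (normalField ρ)) x (e i) (e i)) -
        ∂ₚ (∂ₚ φ) (x, u x) (e i, ∂ᵤ u x (e i)) (e i, ∂ᵤ u x (e i)))| ≤
      (M * c + Lφ * (1 + M) ^ 2) * ∑ i, coeff m l i := by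
    refine (Finset.abs_sum_le_sum_abs _ _).trans ?_
    rw [Finset.mul_sum]
    refine Finset.sum_le_sum fun i _ => ?_
    rw [abs_mul, abs_of_pos (hF i), mul_comm]
    refine mul_le_mul_of_nonneg_right ?_ (hF i).le
    have hei := e.orthonormal.1 i
    have hg := h.norm_graph_le hxc (e i)
    rw [hei, mul_one] at hg
    refine (abs_sub _ _).trans (add_le_add ?_ ?_)
    · refine (h.abs_D1_le hxc _).trans ?_
      gcongr
      calc _ ≤ ‖fderiv ℝ (fderiv ℝ (normalField ρ)) x‖ * ‖e i‖ * ‖e i‖ :=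
            (fderiv ℝ (fderiv ℝ (normalField ρ)) x).le_opNorm₂ _ _
        _ ≤ c := by rwa [hei, mul_one, mul_one]
    · calc _ ≤ ‖∂ₚ (∂ₚ φ) (x, u x)‖ * ‖((e i, ∂ᵤ u x (e i)) : Euc n × ℝ)‖ *
            ‖((e i, ∂ᵤ u x (e i)) : Euc n × ℝ)‖ := (∂ₚ (∂ₚ φ) (x, u x)).le_opNorm₂ _ _
        _ ≤ Lφ * (1 + M) * (1 + M) := by gcongr
        _ = _ := by ring
  exact (abs_add_le _ _).trans (add_le_add ((abs_sub _ _).trans (add_le_add t1 t2)) t3)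

/-- First and second order conditions at an interior minimum of the comparison function. -/
lemma barrierComparison_conditions {K ε β σ B : ℝ} (hx : x ∈ Ω)
    (hmin : IsLocalMin (barrierComparison Ω ρ u φ K ε β σ B p) x) (e : Euc n) {w₁ w₂ : ℝ}
    (hw₁ : w₁ = ∂ᵤ (∂ᵤ u) x e (normalField ρ x) + ∂ᵤ u x (fderiv ℝ (normalField ρ) x e) -
        ∂ₚ φ (x, u x) (e, ∂ᵤ u x e))
    (hw₂ : w₂ = ∂ᵤ (∂ᵤ (∂ᵤ u)) x e e (normalField ρ x) +
        2 * ∂ᵤ (∂ᵤ u) x e (fderiv ℝ (normalField ρ) x e) +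
        ∂ᵤ u x (fderiv ℝ (fderiv ℝ (normalField ρ)) x e e) -
        (∂ₚ (∂ₚ φ) (x, u x) (e, ∂ᵤ u x e) (e, ∂ᵤ u x e) +
          ∂ₚ φ (x, u x) (0, ∂ᵤ (∂ᵤ u) x e e))) :
    (1 - β * barrier ρ K ε p x) * (σ * w₁) =
        (B + β * (σ * defect Ω ρ u φ x)) * barrierDeriv ρ K ε p x e ∧
      0 ≤ (1 - β * barrier ρ K ε p x) * (σ * w₂) - 2 * β * barrierDeriv ρ K ε p x e * (σ * w₁) -
        (B + β * (σ * defect Ω ρ u φ x)) * barrierHess ρ K ε p x e := by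
  have hb := h.dom.hasD2_barrier K ε p x e
  have hw := h.hasD2_defect hx e
  rw [← hw₁, ← hw₂] at hw
  have hP := ((((HasD2.const (1 : ℝ)).sub (hb.const_mul β)).mul (hw.const_mul σ)).sub
    (hb.const_mul B))
  have hline : Tendsto (fun t : ℝ => x + t • e) (𝓝 0) (𝓝 x) := by
    have : Continuous fun t : ℝ => x + t • e := by fun_prop
    simpa using this.tendsto 0
  obtain ⟨h1, h2⟩ := hP.eq_zero_and_nonneg (by
    filter_upwards [hline.eventually hmin] with t ht
    simpa [barrierComparison] using ht)
  simp only [zero_smul, add_zero, zero_sub] at h1 h2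
  constructor <;> linarith

end

end Solution

lemma exists_one_le_abs_inner {n : ℕ} (e : OrthonormalBasis (Fin n) ℝ (Euc n)) {v : Euc n}
    (hv : ‖v‖ = 1) : ∃ j, 1 ≤ n * |inner ℝ (e j) v| := by
  by_contra! hlt
  have h1 : ∑ i, inner ℝ (e i) v ^ 2 = 1 := by
    have := e.sum_sq_norm_inner_right v
    simpa [hv] using this
  have hn : 0 < n := by
    rcases Nat.eq_zero_or_pos n with rfl | hn
    · simp at h1
    · exact hn
  have hn1 : (1 : ℝ) ≤ n := by exact_mod_cast hn
  have h2 : ∀ i ∈ (Finset.univ : Finset (Fin n)), (n : ℝ) ^ 2 * inner ℝ (e i) v ^ 2 < 1 := by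
    intro i _
    rw [← sq_abs (inner ℝ (e i) v : ℝ), ← mul_pow]
    exact pow_lt_one₀ (by positivity) (hlt i) two_ne_zero
  have h3 := Finset.sum_lt_sum_of_nonempty
    (Finset.univ_nonempty_iff.2 (Fin.pos_iff_nonempty.1 hn)) h2
  rw [← Finset.mul_sum, h1, Finset.sum_const, Finset.card_univ, Fintype.card_fin,
    nsmul_eq_mul] at h3
  nlinarith

/-- Where the barrier gradient has a large component, the corresponding eigenvalue is large. -/
lemma eigenvalue_lower_bound {a H ν l g q R σ B W δ n : ℝ} (hn : 1 ≤ n * |a|) (hn0 : 1 ≤ n)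
    (hH : |H - a| ≤ δ) (hν : |ν - a| ≤ δ) (hδ : 8 * n * δ ≤ 1) (hg1 : 1 ≤ g) (hg2 : g ≤ 3 / 2)
    (hq : 3 / 4 * B ≤ q) (hB : 0 ≤ B) (hσ : σ = 1 ∨ σ = -1) (hR : |R| ≤ W) (hW : 8 * n * W ≤ B)
    (heq : g * (σ * (l * ν + R)) = q * H) : B / 8 ≤ σ * l ∧ 1 ≤ 2 * n * |H| := by
  have hδa : 8 * δ ≤ |a| := by
    have : n * (8 * δ) ≤ n * |a| := by linarith
    exact le_of_mul_le_mul_left this (by linarith)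
  have hHa : 7 / 8 * |a| ≤ |H| := by
    have := abs_sub_abs_le_abs_sub a H
    rw [abs_sub_comm] at this
    linarith
  have hνa : 7 / 8 * |a| ≤ |ν| := by
    have := abs_sub_abs_le_abs_sub a ν
    rw [abs_sub_comm] at this
    linarith
  have hn2 : 0 < n := by linarith
  have ha : 0 < |a| := by
    by_contra! h0
    nlinarith
  -- H and ν both differ from a by at most |a|/8, so they have the same sign and |H| ≥ (7/9)|ν|.
  have hprod : 3 / 4 * ν ^ 2 ≤ H * ν := by
    rw [abs_le] at hH hν
    rcases abs_cases a with ⟨h1, h2⟩ | ⟨h1, h2⟩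
    · rw [h1] at hδa ha
      have h3 : 0 ≤ ν := by linarith
      have h4 : 0 ≤ H - 3 / 4 * ν := by linarith
      nlinarith [mul_nonneg h3 h4]
    · rw [h1] at hδa ha
      have h3 : ν ≤ 0 := by linarith
      have h4 : H - 3 / 4 * ν ≤ 0 := by linarith
      nlinarith [mul_nonneg_of_nonpos_of_nonpos h3 h4]
  have hν0 : 0 < ν ^ 2 := by
    rw [← sq_abs]
    have : 0 < |ν| := by linarith
    positivity
  have hσR : |σ * R * ν| ≤ W * (2 * n * ν ^ 2) := by
    have hσ1 : |σ| = 1 := by rcases hσ with rfl | rfl <;> simp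
    have h1 : 1 ≤ 2 * n * |ν| := by nlinarith
    have h2 : |ν| ≤ 2 * n * ν ^ 2 := by
      rw [← sq_abs ν]
      nlinarith [abs_nonneg ν]
    rw [abs_mul, abs_mul, hσ1, one_mul]
    have hW0 := (abs_nonneg R).trans hR
    gcongr
  constructor
  · have h1 : g * (σ * l * ν ^ 2 + σ * R * ν) = q * (H * ν) := by
      linear_combination ν * heq
    have h2 : 3 / 4 * B * (3 / 4 * ν ^ 2) ≤ q * (H * ν) := by
      have : 0 ≤ 3 / 4 * ν ^ 2 := by positivity
      gcongr
      linarith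
    -- Dividing by g ≤ 3/2 leaves (3/4)(3/4)/(3/2) = 3/8 of B; the remainder R costs 1/4 and 1/8 is
    -- kept.
    have h3 : 3 / 8 * B * ν ^ 2 ≤ σ * l * ν ^ 2 + σ * R * ν := by
      set y := σ * l * ν ^ 2 + σ * R * ν
      have hy : 0 ≤ g * y := by
        rw [h1]
        refine le_trans ?_ h2
        positivity
      have hy0 : 0 ≤ y := nonneg_of_mul_nonneg_right hy (by linarith)
      nlinarith
    have h4 : W * (2 * n * ν ^ 2) ≤ B / 4 * ν ^ 2 := by nlinarith
    have h5 : B / 8 * ν ^ 2 ≤ σ * l * ν ^ 2 := by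
      linarith [(abs_le.1 hσR).2]
    exact le_of_mul_le_mul_right h5 hν0
  · nlinarith

namespace Solution

variable {n m : ℕ} {Ω : Set (Euc n)} {ρ u : Euc n → ℝ} {f φ : Euc n × ℝ → ℝ}
  {L κ M f₀ Lf Lφ : ℝ} {x p : Euc n} {c : ℝ}

set_option hygiene false in
local notation "∂ᵤ" => D (closure Ω)
set_option hygiene false in
local notation "∂ₚ" => D (SProd.sprod (closure Ω) (univ : Set ℝ))

set_option maxHeartbeats 1000000 in
/-- The comparison function has no interior minimum near the boundary. -/
theorem not_isLocalMin_barrierComparison (h : Solution m Ω ρ u f φ L κ M f₀ Lf Lφ)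
    (hf₀ : 0 < f₀) (hm : m + 1 ≤ n) (hx : x ∈ Ω) (hp : p ∈ frontier Ω)
    {K ε β σ B k₁ Λ C θ η δ : ℝ} (hσ : σ = 1 ∨ σ = -1) (hB : 0 < B) (hβ : 0 ≤ β) (hk₁ : 0 < k₁)
    (hc : 0 ≤ c) (hΛ : 0 ≤ Λ) (hC : 0 ≤ C) (hθ : 0 ≤ θ) (hη : 0 < η)
    (h0 : ‖normalField ρ x‖ ≤ c) (h1 : ‖fderiv ℝ (normalField ρ) x‖ ≤ c)
    (h2 : ‖fderiv ℝ (fderiv ℝ (normalField ρ)) x‖ ≤ c)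
    (hb0 : barrier ρ K ε p x ≤ 0) (hb1 : β * -barrier ρ K ε p x ≤ 1 / 2)
    (hBW : 4 * β * (M * c + Lφ) ≤ B) (hBW₁ : 8 * n * (M * c + Lφ * (1 + M)) ≤ B)
    (hhess : ∀ e : Euc n, ‖e‖ = 1 → k₁ ≤ barrierHess ρ K ε p x e)
    (hcomp : ∀ l : Fin n → ℝ, IsGarding (m + 1) Finset.univ l → (∀ i, |l i| ≤ Λ * B) →
      ∀ j, B / 8 ≤ σ * l j → ∀ i, coeff m l i * (σ * l i) ≤
        C * (coeff m l j * (σ * l j)) + θ * B * ∑ i, coeff m l i)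
    (hD2 : ∀ e : Euc n, ‖e‖ = 1 → |∂ᵤ (∂ᵤ u) x e e| ≤ Λ * B)
    (hδ1 : ∀ e : Euc n, ‖e‖ = 1 → |barrierDeriv ρ K ε p x e - inner ℝ e (normalField ρ p)| ≤ δ)
    (hδ2 : ‖normalField ρ x - normalField ρ p‖ ≤ δ) (hδn : 8 * n * δ ≤ 1)
    (hν : ∀ e : Euc n, ‖e‖ = 1 → |barrierDeriv ρ K ε p x e| < η →
      0 ≤ inner ℝ e (fderiv ℝ (normalField ρ) x e))
    (hβ3 : 3 * (4 * n ^ 3 * c * C * Λ + c * Λ / η ^ 2) ≤ β) (hθ1 : 12 * (n * c * θ) ≤ k₁)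
    (hBE : 4 * ((Lf * (1 + M) * c + Lφ * ((m + 1) * Lf)) * (max 1 Lf / f₀) +
      (M * c + Lφ * (1 + M) ^ 2)) < k₁ * B) :
    ¬ IsLocalMin (barrierComparison Ω ρ u φ K ε β σ B p) x := by
  intro hmin
  have hxc := subset_closure hx
  have hM := h.M_nonneg
  have hLf := h.Lf_nonneg
  have hLφ := h.Lφ_nonneg
  obtain ⟨e, l, he⟩ := h.exists_isEigenframe hx
  have hei : ∀ i, ‖e i‖ = 1 := e.orthonormal.1
  have hF := he.coeff_pos
  have hNp := h.dom.norm_normalField hp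
  have hσ1 : |σ| = 1 := by rcases hσ with rfl | rfl <;> simp
  set g := 1 - β * barrier ρ K ε p x with hg
  have hg1 : 1 ≤ g := by
    have := mul_nonneg hβ (neg_nonneg.2 hb0)
    linarith
  have hg2 : g ≤ 3 / 2 := by linarith
  set q := B + β * (σ * defect Ω ρ u φ x) with hq
  have hqB : 3 / 4 * B ≤ q := by
    have e1 := h.abs_defect_le hxc h0
    have e2 : |β * (σ * defect Ω ρ u φ x)| ≤ β * (M * c + Lφ) := by
      rw [abs_mul, abs_mul, hσ1, one_mul, abs_of_nonneg hβ]
      gcongr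
    linarith [(abs_le.1 e2).1]
  set H : Fin n → ℝ := fun i => barrierDeriv ρ K ε p x (e i) with hH
  set ν : Fin n → ℝ := fun i => inner ℝ (e i) (fderiv ℝ (normalField ρ) x (e i)) with hνdef
  set T := ∑ i, coeff m l i with hT
  set S := ∑ i, coeff m l i * H i ^ 2 with hS
  have hT0 : 0 ≤ T := Finset.sum_nonneg fun i _ => (hF i).le
  have hS0 : 0 ≤ S := Finset.sum_nonneg fun i _ => mul_nonneg (hF i).le (sq_nonneg _)
  -- The lower bound on T = Σ F_i allows bounded terms to be written as multiples of T.
  have hTlow : f₀ ≤ max 1 Lf * T := by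
    have e1 := h.norm_f_le hxc
    have e2 := he.garding.le_sum_esym_erase (by simpa using hm) (le_max_left 1 Lf) (by
      rw [he.esym_eq]
      exact ((le_abs_self _).trans e1.1).trans (le_max_right _ _))
    rw [he.esym_eq] at e2
    exact (h.f_lower _ (h.mem_valueRange hxc)).trans e2
  have hTpos : 0 < T := by
    by_contra! h3
    have : max 1 Lf * T ≤ 0 :=
      mul_nonpos_of_nonneg_of_nonpos (zero_le_one.trans (le_max_left _ _)) h3
    linarith
  -- a direction in which the eigenvalue is large
  obtain ⟨j, hj⟩ := exists_one_le_abs_inner e hNp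
  have hn1 : (1 : ℝ) ≤ n := by
    have : 1 ≤ n := by omega
    exact_mod_cast this
  -- The first-order condition in an eigendirection with a definite normal component reads g σ(λ_j
  -- ν_j + R) = q H_j, where ν_j and H_j are both close to ⟨e_j, N(p)⟩; so σλ_j is comparable with
  -- B.
  have hlarge : B / 8 ≤ σ * l j ∧ 1 ≤ 2 * n * |H j| := by
    have c1 := (h.barrierComparison_conditions hx hmin (e j) rfl rfl).1
    rw [he.eigen] at c1
    refine eigenvalue_lower_bound (a := inner ℝ (e j) (normalField ρ p))
      (ν := inner ℝ (e j) (normalField ρ x)) (g := g) (q := q)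
      (R := ∂ᵤ u x (fderiv ℝ (normalField ρ) x (e j)) - ∂ₚ φ (x, u x) (e j, ∂ᵤ u x (e j)))
      (W := M * c + Lφ * (1 + M)) hj hn1 (hδ1 _ (hei j)) ?_ hδn hg1 hg2 hqB hB.le hσ ?_ hBW₁ ?_
    · rw [← inner_sub_right]
      have := abs_real_inner_le_norm (e j) (normalField ρ x - normalField ρ p)
      rw [hei, one_mul] at this
      exact this.trans hδ2
    · have e1 := h.abs_Dφ_le hxc (e j)
      have e2 := ContinuousLinearMap.le_of_opNorm_le _ h1 (e j)
      rw [hei, mul_one] at e1 e2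
      refine (abs_sub _ _).trans (add_le_add ((h.abs_D1_le hxc _).trans ?_) e1)
      gcongr
    · rw [← c1]
      ring
  obtain ⟨hlj, hHj⟩ := hlarge
  have hl : ∀ i, |l i| ≤ Λ * B := fun i => by
    rw [← he.apply_self i]
    exact hD2 _ (hei i)
  have hX := sum_curvature_le (F := coeff m l) (a := fun i => σ * l i) (ν := ν) (H := H) (T := T)
    (fun i => (hF i).le) hT0 hB.le hc hC hΛ hθ hη
    (fun i => by rw [abs_mul, hσ1, one_mul]; exact hl i)
    (fun i => by
      have e1 := abs_real_inner_le_norm (e i) (fderiv ℝ (normalField ρ) x (e i))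
      have e2 := ContinuousLinearMap.le_of_opNorm_le _ h1 (e i)
      rw [hei, one_mul] at e1
      rw [hei, mul_one] at e2
      exact e1.trans e2)
    (fun i hi => hν _ (hei i) hi) hHj (hcomp l he.garding hl j hlj)
  have hlin := h.abs_sum_defect_le hx he h0 h2
  set w₂ : Fin n → ℝ := fun i => ∂ᵤ (∂ᵤ (∂ᵤ u)) x (e i) (e i) (normalField ρ x) +
        2 * ∂ᵤ (∂ᵤ u) x (e i) (fderiv ℝ (normalField ρ) x (e i)) +
        ∂ᵤ u x (fderiv ℝ (fderiv ℝ (normalField ρ)) x (e i) (e i)) -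
        (∂ₚ (∂ₚ φ) (x, u x) (e i, ∂ᵤ u x (e i)) (e i, ∂ᵤ u x (e i)) +
          ∂ₚ φ (x, u x) (0, ∂ᵤ (∂ᵤ u) x (e i) (e i))) with hw₂
  have hg0 : 0 < g := zero_lt_one.trans_le hg1
  have hq0 : 0 ≤ q := le_trans (by positivity) hqB
  have hqg : B / 2 * g ≤ q := by
    refine le_trans ?_ hqB
    have := mul_le_mul_of_nonneg_left hg2 (half_pos hB).le
    linarith only [this]
  -- The first-order condition turns the cross term of the weight and the defect into -2βqH_i²/g ≤
  -- -βBH_i²; this is the purpose of the weight 1 - βb. The convexity of the barrier contributes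
  -- 3Bk₁/4.
  have hpt : ∀ i, 0 ≤ g * σ * w₂ i - β * B * H i ^ 2 - 3 / 4 * B * k₁ := by
    intro i
    obtain ⟨c1, c2⟩ := h.barrierComparison_conditions hx hmin (e i) rfl (w₂ := w₂ i) rfl
    set y := σ * (∂ᵤ (∂ᵤ u) x (e i) (normalField ρ x) +
      ∂ᵤ u x (fderiv ℝ (normalField ρ) x (e i)) - ∂ₚ φ (x, u x) (e i, ∂ᵤ u x (e i))) with hy
    have c3 : H i * y = q * H i ^ 2 / g := by
      rw [eq_div_iff hg0.ne']
      linear_combination H i * c1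
    have c4 : B / 2 * H i ^ 2 ≤ H i * y := by
      rw [c3, le_div_iff₀ hg0]
      have := mul_le_mul_of_nonneg_right hqg (sq_nonneg (H i))
      linarith only [this]
    have c5 : 3 / 4 * B * k₁ ≤ q * barrierHess ρ K ε p x (e i) :=
      mul_le_mul hqB (hhess _ (hei i)) hk₁.le hq0
    have c6 := mul_le_mul_of_nonneg_left c4 (mul_nonneg zero_le_two hβ)
    linarith only [c2, c5, c6]
  have hsum : 0 ≤ ∑ i, coeff m l i * (g * σ * w₂ i - β * B * H i ^ 2 - 3 / 4 * B * k₁) :=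
    Finset.sum_nonneg fun i _ => mul_nonneg (hF i).le (hpt i)
  have hexp : ∑ i, coeff m l i * (g * σ * w₂ i - β * B * H i ^ 2 - 3 / 4 * B * k₁) =
      g * (σ * ∑ i, coeff m l i * w₂ i) - β * B * S - 3 / 4 * B * k₁ * T := by
    rw [hS, hT, Finset.mul_sum, Finset.mul_sum, Finset.mul_sum, Finset.mul_sum,
      ← Finset.sum_sub_distrib, ← Finset.sum_sub_distrib]
    refine Finset.sum_congr rfl fun i _ => ?_
    ring
  rw [hexp] at hsum
  have hσX : ∑ i, coeff m l i * (σ * l i * ν i) = σ * ∑ i, coeff m l i * (l i * ν i) := by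
    rw [Finset.mul_sum]
    exact Finset.sum_congr rfl fun i _ => by ring
  rw [hσX] at hX
  set X := ∑ i, coeff m l i * (l i * ν i) with hXdef
  set W₂ := ∑ i, coeff m l i * w₂ i with hW₂
  set E₀ := Lf * (1 + M) * c + Lφ * ((m + 1) * Lf) with hE₀
  set E₁ := M * c + Lφ * (1 + M) ^ 2 with hE₁
  have hE₀0 : 0 ≤ E₀ := by positivity
  have hE₁0 : 0 ≤ E₁ := by positivity
  set Γ := 4 * n ^ 3 * c * C * Λ + c * Λ / η ^ 2 with hΓ
  have hΓ0 : 0 ≤ Γ := by positivity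
  have t1 : σ * W₂ - 2 * (σ * X) ≤ E₀ + E₁ * T := by
    refine le_trans (le_trans (le_of_eq ?_) (le_abs_self (σ * (W₂ - 2 * X)))) ?_
    · ring
    · rw [abs_mul, hσ1, one_mul]
      exact hlin
  have t2 : E₀ ≤ E₀ * (max 1 Lf / f₀) * T := by
    have : 1 ≤ max 1 Lf / f₀ * T := by
      rw [div_mul_eq_mul_div, le_div_iff₀ hf₀, one_mul]
      exact hTlow
    rw [mul_assoc]
    exact le_mul_of_one_le_right hE₀0 this
  have t3 : σ * W₂ ≤ 2 * (n * c * θ * B * T + Γ * B * S) +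
      (E₀ * (max 1 Lf / f₀) + E₁) * T := by
    linarith only [t1, t2, hX]
  have t4 : g * (σ * W₂) ≤ 3 / 2 * (2 * (n * c * θ * B * T + Γ * B * S) +
      (E₀ * (max 1 Lf / f₀) + E₁) * T) := by
    have hpos : 0 ≤ 2 * (n * c * θ * B * T + Γ * B * S) +
      (E₀ * (max 1 Lf / f₀) + E₁) * T := by positivity
    calc _ ≤ g * (2 * (n * c * θ * B * T + Γ * B * S) +
          (E₀ * (max 1 Lf / f₀) + E₁) * T) := by gcongr
      _ ≤ _ := by gcongr
  -- Balance: β pays for the S terms, and of the available (3/4)k₁BT the θ term uses at most 1/4 and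
  -- the error terms less than 3/8.
  have t5 : 3 * Γ * (B * S) ≤ β * (B * S) := by gcongr
  have t6 : 12 * (n * c * θ) * (B * T) ≤ k₁ * (B * T) := by gcongr
  have t7 : 4 * (E₀ * (max 1 Lf / f₀) + E₁) * T < k₁ * B * T := by gcongr
  have t8 : 0 < k₁ * B * T := by positivity
  linarith only [hsum, t4, t5, t6, t7, t8]

end Solution

/-! ### Conditions at the boundary point and choice of the constants -/

namespace UCDomain

variable {n : ℕ} {Ω : Set (Euc n)} {ρ : Euc n → ℝ} {L κ : ℝ} {p : Euc n}

lemma barrier_self (h : UCDomain Ω ρ L κ) (hp : p ∈ frontier Ω) (K ε : ℝ) :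
    barrier ρ K ε p p = 0 := by
  simp [barrier, h.eq_zero_of_mem_frontier hp]

lemma differentiable_barrier (h : UCDomain Ω ρ L κ) (K ε : ℝ) (p : Euc n) :
    Differentiable ℝ (barrier ρ K ε p) := by
  have hρ := h.differentiable
  have h1 : Differentiable ℝ fun x : Euc n => x - p := differentiable_id.sub_const p
  exact ((hρ.add ((hρ.pow 2).const_mul K)).const_mul _).sub ((h1.inner ℝ h1).const_mul ε)

/-- The factor |∇ρ(p)|⁻¹ in the barrier is there for this value 1, so that σu_νν is compared with B
itself. -/
lemma fderiv_barrier_normalField (h : UCDomain Ω ρ L κ) (hp : p ∈ frontier Ω) (K ε : ℝ) :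
    fderiv ℝ (barrier ρ K ε p) p (normalField ρ p) = 1 := by
  obtain ⟨a', h1, h2, -⟩ := h.hasD2_barrier K ε p p (normalField ρ p)
  have h3 : HasDerivAt (fun t : ℝ => p + t • normalField ρ p) (normalField ρ p) 0 := by
    simpa using ((hasDerivAt_id (0 : ℝ)).smul_const (normalField ρ p)).const_add p
  have h4 : HasFDerivAt (barrier ρ K ε p) (fderiv ℝ (barrier ρ K ε p) p)
      (p + (0 : ℝ) • normalField ρ p) := by
    rw [zero_smul, add_zero]
    exact (h.differentiable_barrier K ε p p).hasFDerivAt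
  have h5 : HasDerivAt (fun t : ℝ => barrier ρ K ε p (p + t • normalField ρ p))
      (fderiv ℝ (barrier ρ K ε p) p (normalField ρ p)) 0 :=
    HasFDerivAt.comp_hasDerivAt (f := fun t : ℝ => p + t • normalField ρ p) 0 h4 h3
  rw [h5.unique h1.self_of_nhds, h2, barrierDeriv,
    h.eq_zero_of_mem_frontier hp, h.inner_gradient_eq hp, real_inner_self_eq_norm_sq,
    h.norm_normalField hp, sub_self, inner_zero_left]
  have := h.one_le_norm_gradient hp
  field_simp
  ring

end UCDomain

namespace Solution

variable {n m : ℕ} {Ω : Set (Euc n)} {ρ u : Euc n → ℝ} {f φ : Euc n × ℝ → ℝ}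
  {L κ M f₀ Lf Lφ : ℝ} {x p : Euc n} {c : ℝ}

set_option hygiene false in
local notation "∂ᵤ" => D (closure Ω)
set_option hygiene false in
local notation "∂ₚ" => D (SProd.sprod (closure Ω) (univ : Set ℝ))

section

variable (h : Solution m Ω ρ u f φ L κ M f₀ Lf Lφ)
include h

/-- The positive trace turns an upper bound for all eigenvalues into a lower bound for each. -/
lemma abs_D2_le (hx : x ∈ Ω) {Λ : ℝ} (hD2 : ∀ e : Euc n, ‖e‖ = 1 → ∂ᵤ (∂ᵤ u) x e e ≤ Λ)
    (hΛ : 0 ≤ Λ) {e : Euc n} (he : ‖e‖ = 1) : |∂ᵤ (∂ᵤ u) x e e| ≤ n * Λ := by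
  obtain ⟨v, l, hv⟩ := h.exists_isEigenframe hx
  have hl : ∀ i, l i ≤ Λ := fun i => by
    rw [← hv.apply_self i]
    exact hD2 _ (v.orthonormal.1 i)
  have hsum : 0 < ∑ i, l i := by
    have := hv.garding 1 (by omega)
    rwa [esym_one] at this
  have hlow : ∀ j, -(n * Λ) ≤ l j := by
    intro j
    have h1 := Finset.add_sum_erase Finset.univ l (Finset.mem_univ j)
    have h2 : ∑ i ∈ Finset.univ.erase j, l i ≤ ∑ i ∈ Finset.univ.erase j, Λ :=
      Finset.sum_le_sum fun i _ => hl i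
    have h3 : ∑ i ∈ Finset.univ.erase j, Λ ≤ ∑ i : Fin n, Λ :=
      Finset.sum_le_sum_of_subset_of_nonneg (Finset.erase_subset _ _) fun _ _ _ => hΛ
    rw [Finset.sum_const (s := Finset.univ), Finset.card_univ, Fintype.card_fin,
      nsmul_eq_mul] at h3
    linarith
  have hone : ∑ j, inner ℝ (v j) e ^ 2 = 1 := by
    have := v.sum_sq_norm_inner_right e
    simpa [he] using this
  have hn : Λ ≤ n * Λ := by
    have : 1 ≤ n := by
      rcases Nat.eq_zero_or_pos n with rfl | hn
      · simp at hone
      · exact hn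
    have h1 : (1 : ℝ) ≤ n := by exact_mod_cast this
    exact le_mul_of_one_le_left hΛ h1
  rw [abs_le]
  refine ⟨?_, (hD2 e he).trans hn⟩
  rw [hv.apply_eq_sum]
  calc -(n * Λ) = ∑ j, inner ℝ (v j) e ^ 2 * -(n * Λ) := by rw [← Finset.sum_mul, hone, one_mul]
    _ ≤ _ := Finset.sum_le_sum fun j _ => mul_le_mul_of_nonneg_left (hlow j) (sq_nonneg _)

lemma continuousOn_barrierComparison (K ε β σ B : ℝ) (p : Euc n) :
    ContinuousOn (barrierComparison Ω ρ u φ K ε β σ B p) (closure Ω) := by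
  have h1 : ContinuousOn (barrier ρ K ε p) (closure Ω) :=
    (h.dom.differentiable_barrier K ε p).continuous.continuousOn
  have h2 : ContinuousOn (defect Ω ρ u φ) (closure Ω) := fun y hy => by
    obtain ⟨w', hw', -⟩ := h.hasFDerivWithinAt_defect hy
    exact hw'.continuousWithinAt
  exact ((continuousOn_const.sub (continuousOn_const.mul h1)).mul
    (continuousOn_const.mul h2)).sub (continuousOn_const.mul h1)

/-- If the comparison function is nonnegative near a boundary point, then the double normal
derivative is bounded there. -/
lemma normal_derivative_le (hp : p ∈ frontier Ω)
    (h1 : ‖fderiv ℝ (normalField ρ) p‖ ≤ c) {K ε β σ B r : ℝ} (hr : 0 < r)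
    (hσ : σ = 1 ∨ σ = -1)
    (hP : ∀ y ∈ closure Ω, ‖y - p‖ ≤ r → 0 ≤ barrierComparison Ω ρ u φ K ε β σ B p y) :
    σ * ∂ᵤ (∂ᵤ u) p (normalField ρ p) (normalField ρ p) ≤ B + (M * c + Lφ * (1 + M)) := by
  have hpc := frontier_subset_closure hp
  have hN := h.dom.norm_normalField hp
  have hσ1 : |σ| = 1 := by rcases hσ with rfl | rfl <;> simp
  obtain ⟨w', hw', hw'e⟩ := h.hasFDerivWithinAt_defect hpc
  have hb := (h.dom.differentiable_barrier K ε p p).hasFDerivAt.hasFDerivWithinAt (s := closure Ω)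
  have hPd : HasFDerivWithinAt (barrierComparison Ω ρ u φ K ε β σ B p) _ (closure Ω) p :=
    (((hb.const_mul β).const_sub 1).mul (hw'.const_mul σ)).sub (hb.const_mul B)
  have hP0 : barrierComparison Ω ρ u φ K ε β σ B p p = 0 := by
    rw [barrierComparison, h.defect_eq_zero hp, h.dom.barrier_self hp]
    ring
  have hmin : IsLocalMinOn (barrierComparison Ω ρ u φ K ε β σ B p) (closure Ω) p := by
    have hball : Metric.closedBall p r ∈ 𝓝 p := Metric.closedBall_mem_nhds p hr
    filter_upwards [self_mem_nhdsWithin, mem_nhdsWithin_of_mem_nhds hball] with y hy hyr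
    rw [hP0]
    exact hP y hy (by rwa [← dist_eq_norm])
  -- The comparison function vanishes at p and is nonnegative nearby, so its inward derivative is
  -- nonnegative. Defect and barrier vanish at p, hence β drops out.
  obtain ⟨t, ht, hcone⟩ := h.dom.neg_normal_mem_posTangentConeAt hp
  have h7 := hmin.hasFDerivWithinAt_nonneg hPd hcone
  rw [map_neg, map_smul, smul_eq_mul, neg_nonneg] at h7
  have h8 := nonpos_of_mul_nonpos_right h7 ht
  simp only [add_apply, sub_apply, smul_apply, neg_apply, smul_eq_mul, h.dom.barrier_self hp,
    h.dom.fderiv_barrier_normalField hp, h.boundary_normalField hp, hw'e, mul_zero, sub_zero,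
    zero_mul, add_zero, one_mul, mul_one] at h8
  have e1 := h.abs_Dφ_le hpc (normalField ρ p)
  have e2 := h.abs_D1_le hpc (fderiv ℝ (normalField ρ) p (normalField ρ p))
  have e3 := ContinuousLinearMap.le_of_opNorm_le _ h1 (normalField ρ p)
  rw [hN, mul_one] at e1 e3
  have hM := h.M_nonneg
  have e4 : |σ * (∂ᵤ u p (fderiv ℝ (normalField ρ) p (normalField ρ p)) -
      ∂ₚ φ (p, u p) (normalField ρ p, ∂ᵤ u p (normalField ρ p)))| ≤ M * c + Lφ * (1 + M) := by
    rw [abs_mul, hσ1, one_mul]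
    exact (abs_sub _ _).trans (add_le_add (e2.trans (by gcongr)) e1)
  linarith [(abs_le.1 e4).1]

end

end Solution

namespace Solution

variable {n m : ℕ} {Ω : Set (Euc n)} {ρ u : Euc n → ℝ} {f φ : Euc n × ℝ → ℝ}
  {L κ M f₀ Lf Lφ : ℝ} {x p : Euc n} {c : ℝ}

set_option hygiene false in
local notation "∂ᵤ" => D (closure Ω)
set_option hygiene false in
local notation "∂ₚ" => D (SProd.sprod (closure Ω) (univ : Set ℝ))

/-- Nonnegativity of the comparison function follows if it has no interior minimum. -/
lemma barrierComparison_nonneg (h : Solution m Ω ρ u f φ L κ M f₀ Lf Lφ) (hp : p ∈ frontier Ω)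
    (hc : ∀ y ∈ closure Ω, ‖normalField ρ y‖ ≤ c) {K ε β σ B r : ℝ} (hr : 0 < r) (hB : 0 ≤ B)
    (hσ : σ = 1 ∨ σ = -1) (hβ : 0 ≤ β) (hε : 0 ≤ ε)
    (hb : ∀ y ∈ closure Ω, ‖y - p‖ ≤ r → barrier ρ K ε p y ≤ -(ε * ‖y - p‖ ^ 2))
    (hb1 : ∀ y ∈ closure Ω, ‖y - p‖ ≤ r → β * -barrier ρ K ε p y ≤ 1 / 2)
    (hBr : 3 / 2 * (M * c + Lφ) ≤ B * (ε * r ^ 2))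
    (hno : ∀ y ∈ Ω, ‖y - p‖ ≤ r → ¬ IsLocalMin (barrierComparison Ω ρ u φ K ε β σ B p) y) :
    ∀ y ∈ closure Ω, ‖y - p‖ ≤ r → 0 ≤ barrierComparison Ω ρ u φ K ε β σ B p y := by
  have hσ1 : |σ| = 1 := by rcases hσ with rfl | rfl <;> simp
  have hpc := frontier_subset_closure hp
  have hcomp : IsCompact (closure Ω ∩ Metric.closedBall p r) :=
    h.dom.isCompact_closure.inter_right Metric.isClosed_closedBall
  obtain ⟨y, ⟨hy, hyr⟩, hmin⟩ := hcomp.exists_isMinOn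
    ⟨p, hpc, Metric.mem_closedBall_self hr.le⟩
    ((h.continuousOn_barrierComparison K ε β σ B p).mono inter_subset_left)
  suffices hy0 : 0 ≤ barrierComparison Ω ρ u φ K ε β σ B p y by
    intro z hz hzr
    exact hy0.trans (hmin ⟨hz, by rwa [Metric.mem_closedBall, dist_eq_norm]⟩)
  rw [Metric.mem_closedBall, dist_eq_norm] at hyr
  have hby := hb y hy hyr
  have hb0 : barrier ρ K ε p y ≤ 0 := hby.trans (neg_nonpos.2 (by positivity))
  -- Three positions of the minimum: an interior one is excluded by `hno`; on the sphere -Bb ≥ Bεr²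
  -- beats the defect, whose weight is at most 3/2; on ∂Ω the defect is zero and -Bb ≥ 0.
  rcases h.dom.mem_or_mem_frontier hy with hyΩ | hyf
  · rcases hyr.lt_or_eq with hlt | heq
    · refine absurd ?_ (hno y hyΩ hyr)
      have hball : Metric.ball p r ∈ 𝓝 y :=
        Metric.isOpen_ball.mem_nhds (by rwa [Metric.mem_ball, dist_eq_norm])
      filter_upwards [h.dom.isOpen.mem_nhds hyΩ, hball] with z hz hzr
      exact hmin ⟨subset_closure hz, Metric.ball_subset_closedBall hzr⟩
    · rw [heq] at hby
      have e1 := h.abs_defect_le hy (hc y hy)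
      have e2 := hb1 y hy hyr
      have e3 := mul_nonneg hβ (neg_nonneg.2 hb0)
      have e4 : |(1 - β * barrier ρ K ε p y) * (σ * defect Ω ρ u φ y)| ≤
          3 / 2 * (M * c + Lφ) := by
        rw [abs_mul, abs_mul, hσ1, one_mul, abs_of_nonneg (by linarith)]
        gcongr
        linarith
      have e5 := mul_le_mul_of_nonneg_left hby hB
      rw [barrierComparison]
      linarith [(abs_le.1 e4).1]
  · rw [barrierComparison, h.defect_eq_zero hyf]
    have := mul_nonneg hB (neg_nonneg.2 hb0)
    linarith

set_option maxHeartbeats 1000000 in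
/-- The double normal derivative is controlled by half of its maximum. -/
theorem exists_double_normal_absorption (n m : ℕ) (hn : 2 ≤ n) (hm : m + 1 ≤ n)
    (L κ M f₀ Lf Lφ : ℝ) (hκ : 0 < κ) (hf₀ : 0 < f₀) : ∃ A : ℝ,
    ∀ (Ω : Set (Euc n)) (ρ u : Euc n → ℝ) (f φ : Euc n × ℝ → ℝ),
      Solution m Ω ρ u f φ L κ M f₀ Lf Lφ → ∀ Mν : ℝ, 0 ≤ Mν →
        (∀ p ∈ frontier Ω, |∂ᵤ (∂ᵤ u) p (normalField ρ p) (normalField ρ p)| ≤ Mν) →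
        ∀ p ∈ frontier Ω, |∂ᵤ (∂ᵤ u) p (normalField ρ p) (normalField ρ p)| ≤ A + Mν / 2 := by
  -- If one of the bounds is negative, no solution satisfies it and the claim is empty.
  by_cases hsgn : 0 ≤ M ∧ 0 ≤ Lf ∧ 0 ≤ Lφ ∧ 0 ≤ L
  swap
  · refine ⟨0, fun Ω ρ u f φ h => absurd ?_ hsgn⟩
    obtain ⟨y, hy⟩ := h.dom.nonempty
    exact ⟨h.M_nonneg, h.Lf_nonneg, h.Lφ_nonneg, h.dom.L_nonneg (subset_closure hy)⟩
  obtain ⟨hM, hLf, hLφ, hL⟩ := hsgn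
  obtain ⟨C₀, hC₀, H₀⟩ := exists_hessian_bound n m hn L κ M f₀ Lf Lφ hκ hf₀
  obtain ⟨c, hc, HN⟩ := exists_normalField_bound n L
  obtain ⟨K, r₀, k₁, hK, hr₀, -, hk₁, hk₁1, HK⟩ := exists_convexity_constants L κ hκ
  have hn0 : (0 : ℝ) < n := by
    have : 0 < n := by omega
    exact_mod_cast this
  have hc0 : 0 < c := by linarith
  -- The order of choice is Λ, b, δ, θ, then C, β, r and finally A, all independent of Mν and so of
  -- B. Since 1 + Mν ≤ 2B, the Hessian bound gives |D²u| ≤ ΛB.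
  set Λ : ℝ := 2 * n * C₀ + 1 with hΛ
  have hΛ0 : 0 < Λ := by positivity
  -- Then 2cb and κb² are at most κ/4 each, and cr ≤ κ/2 completes the smallness required for
  -- convexity in almost tangential directions; η = b/2 and δ ≤ b/2 together give b.
  set b : ℝ := min (1 / 2) (κ / (8 * c)) with hb
  have hb0 : 0 < b := lt_min (by norm_num) (by positivity)
  set δ : ℝ := min (b / 2) (1 / (8 * n)) with hδ
  have hδ0 : 0 < δ := lt_min (by positivity) (by positivity)
  set θ : ℝ := k₁ / (12 * (n * c)) with hθ
  have hθ0 : 0 < θ := by positivity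
  obtain ⟨C, hC, HC⟩ := exists_esym_erase_mul_le (ι := Fin n) m n hθ0 hΛ0
  set β : ℝ := 3 * (4 * n ^ 3 * c * C * Λ + c * Λ / (b / 2) ^ 2) with hβ
  have hβ0 : 0 ≤ β := by positivity
  set ε : ℝ := k₁ / 2 with hε
  have hε0 : 0 < ε := by positivity
  -- Each summand encodes one smallness condition on r = 1/Q, read off in `r1` to `r6`.
  set Q : ℝ := (L + 2 * K * L ^ 2 + 2) / δ + c / δ + 2 * c / κ + 2 * β * (L + 1) + 1 / r₀ + 1
    with hQ
  have q1 : 0 ≤ (L + 2 * K * L ^ 2 + 2) / δ := by positivity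
  have q2 : 0 ≤ c / δ := by positivity
  have q3 : 0 ≤ 2 * c / κ := by positivity
  have q4 : 0 ≤ 2 * β * (L + 1) := by positivity
  have q5 : 0 ≤ 1 / r₀ := by positivity
  have hQ0 : 0 < Q := by positivity
  set r : ℝ := 1 / Q with hr
  have hr0 : 0 < r := by positivity
  have hQr : ∀ a, a ≤ Q → a * r ≤ 1 := fun a ha => by
    rw [hr, mul_one_div]
    exact (div_le_one hQ0).2 ha
  have r1 : (L + 2 * K * L ^ 2 + 2) * r ≤ δ := by
    have := hQr _ (show (L + 2 * K * L ^ 2 + 2) / δ ≤ Q by linarith)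
    rwa [div_mul_eq_mul_div, div_le_one hδ0] at this
  have r2 : c * r ≤ δ := by
    have := hQr _ (show c / δ ≤ Q by linarith)
    rwa [div_mul_eq_mul_div, div_le_one hδ0] at this
  have r3 : 2 * c * r ≤ κ := by
    have := hQr _ (show 2 * c / κ ≤ Q by linarith)
    rwa [div_mul_eq_mul_div, div_le_one hκ] at this
  have r4 := hQr _ (show 2 * β * (L + 1) ≤ Q by linarith)
  have r5 : r ≤ r₀ := by
    have := hQr _ (show 1 / r₀ ≤ Q by linarith)
    rwa [div_mul_eq_mul_div, div_le_one hr₀, one_mul] at this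
  have r6 : r ≤ 1 := by
    have := hQr _ (show 1 ≤ Q by linarith)
    rwa [one_mul] at this
  set W : ℝ := M * c + Lφ with hW
  set W₁ : ℝ := M * c + Lφ * (1 + M) with hW₁
  set E : ℝ := (Lf * (1 + M) * c + Lφ * ((m + 1) * Lf)) * (max 1 Lf / f₀) +
      (M * c + Lφ * (1 + M) ^ 2) with hE
  have hW0 : 0 ≤ W := by positivity
  have hW₁0 : 0 ≤ W₁ := by positivity
  have hE0 : 0 ≤ E := by positivity
  -- Each summand makes B exceed one threshold: defect against weight, remainder R, error terms
  -- against k₁B, and the sphere.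
  set A : ℝ := 1 + 4 * β * W + 8 * n * W₁ + 4 * E / k₁ + 3 / 2 * W / (ε * r ^ 2) with hA
  refine ⟨A + W₁, ?_⟩
  intro Ω ρ u f φ h Mν hMν0 hMν p hp
  have hpc := frontier_subset_closure hp
  have a1 : 0 ≤ 4 * β * W := by positivity
  have a2 : 0 ≤ 8 * n * W₁ := by positivity
  have a3 : 0 ≤ 4 * E / k₁ := by positivity
  have a4 : 0 ≤ 3 / 2 * W / (ε * r ^ 2) := by positivity
  set B : ℝ := A + Mν / 2 with hB
  have hB1 : 1 ≤ B := by linarith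
  have hB0 : 0 < B := by linarith
  have hN0 : ∀ y ∈ closure Ω, ‖normalField ρ y‖ ≤ c := fun y hy => (HN Ω ρ h.dom.defining y hy).1
  have hN1 : ∀ y ∈ closure Ω, ‖fderiv ℝ (normalField ρ) y‖ ≤ c := fun y hy =>
    (HN Ω ρ h.dom.defining y hy).2.1
  have hN2 : ∀ y ∈ closure Ω, ‖fderiv ℝ (fderiv ℝ (normalField ρ)) y‖ ≤ c := fun y hy =>
    (HN Ω ρ h.dom.defining y hy).2.2.1
  have hbar : ∀ y ∈ closure Ω, ‖y - p‖ ≤ r → barrier ρ K ε p y ≤ -(ε * ‖y - p‖ ^ 2) :=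
    fun y hy hyr => h.dom.barrier_le hy (HK n Ω ρ h.dom p hp y hy (hyr.trans r5)).1
  have hbar1 : ∀ y ∈ closure Ω, ‖y - p‖ ≤ r → β * -barrier ρ K ε p y ≤ 1 / 2 := by
    intro y hy hyr
    have e1 := h.dom.neg_barrier_le hp hy hK (by linarith : ε ≤ 1) hyr r6
    have e2 := mul_le_mul_of_nonneg_left e1 hβ0
    linarith only [e2, r4]
  have hBr : 3 / 2 * (M * c + Lφ) ≤ B * (ε * r ^ 2) := by
    have : 3 / 2 * W / (ε * r ^ 2) ≤ B := by linarith
    rwa [div_le_iff₀ (by positivity)] at this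
  have hBE : 4 * E < k₁ * B := by
    have : 4 * E / k₁ < B := by linarith
    rw [div_lt_iff₀ hk₁] at this
    linarith
  have hD2 : ∀ y ∈ Ω, ∀ e : Euc n, ‖e‖ = 1 → |∂ᵤ (∂ᵤ u) y e e| ≤ Λ * B := by
    intro y hy e he
    have e1 := h.abs_D2_le hy (Λ := C₀ * (1 + Mν)) (fun e he =>
      H₀ Ω ρ u f φ h Mν hMν hMν0 y (subset_closure hy) e he) (by positivity) he
    refine e1.trans ?_
    have e2 : 1 + Mν ≤ 2 * B := by linarith
    calc (n : ℝ) * (C₀ * (1 + Mν)) ≤ n * (C₀ * (2 * B)) := by gcongr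
      _ ≤ Λ * B := by
        rw [hΛ]
        linarith
  have hδn : 8 * n * δ ≤ 1 := by
    have := min_le_right (b / 2) (1 / (8 * (n : ℝ)))
    rw [← hδ, le_div_iff₀ (by positivity)] at this
    linarith
  have main : ∀ σ : ℝ, σ = 1 ∨ σ = -1 →
      σ * ∂ᵤ (∂ᵤ u) p (normalField ρ p) (normalField ρ p) ≤ B + W₁ := by
    intro σ hσ
    refine h.normal_derivative_le hp (hN1 p hpc) hr0 hσ (K := K) (ε := ε) (β := β) ?_
    refine h.barrierComparison_nonneg hp hN0 hr0 hB0.le hσ hβ0 hε0.le hbar hbar1 hBr ?_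
    intro y hy hyr
    have hyc := subset_closure hy
    have hderiv : ∀ e : Euc n, ‖e‖ = 1 →
        |barrierDeriv ρ K ε p y e - inner ℝ e (normalField ρ p)| ≤ δ := fun e he =>
      (h.dom.abs_barrierDeriv_sub_le hp hyc hK hε0.le (by linarith) hyr he).trans r1
    refine h.not_isLocalMin_barrierComparison (c := c) (k₁ := k₁) (Λ := Λ) (C := C) (θ := θ)
      (η := b / 2) (δ := δ) hf₀ hm hy hp hσ hB0 hβ0 hk₁ hc0.le hΛ0.le hC.le hθ0.le (half_pos hb0)
      (hN0 y hyc) (hN1 y hyc) (hN2 y hyc)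
      ((hbar y hyc hyr).trans (neg_nonpos.2 (by positivity))) (hbar1 y hyc hyr) (by linarith)
      (by linarith) ?_ ?_ (hD2 y hy) hderiv
      ((h.dom.norm_normalField_sub_le hpc hyc hN1 hyr).trans r2) hδn ?_ le_rfl ?_ hBE
    · intro e he
      have e1 := (HK n Ω ρ h.dom p hp y hyc (hyr.trans r5)).2 e
      rw [barrierHess, real_inner_self_eq_norm_sq, he, hε]
      rw [he] at e1
      linarith
    · intro l hl hlB j hj i
      exact HC Finset.univ l (by simp) hl σ B hσ hB0 (fun i _ => hlB i) j (Finset.mem_univ j) hj i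
        (Finset.mem_univ i)
    · intro e he hlt
      refine h.dom.inner_fderiv_normalField_nonneg hκ.le hp hyc hN1 hN2 hyr he (b := b) ?_ ?_
      · have e1 := hderiv e he
        have e2 := min_le_left (b / 2) (1 / (8 * (n : ℝ)))
        rw [abs_le] at e1 ⊢
        rw [abs_lt] at hlt
        constructor <;> linarith
      · have e1 : b ≤ 1 / 2 := min_le_left _ _
        have e2 : b ≤ κ / (8 * c) := min_le_right _ _
        rw [le_div_iff₀ (by positivity)] at e2
        have e3 : κ * b ^ 2 ≤ κ * (1 / 2) ^ 2 := by gcongr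
        linarith
    · rw [hθ]
      apply le_of_eq
      field_simp
  rw [abs_le]
  constructor
  · linarith [main (-1) (Or.inr rfl)]
  · linarith [main 1 (Or.inl rfl)]

/-- The double normal estimate in dimension at least two. -/
theorem exists_double_normal_bound (n m : ℕ) (hn : 2 ≤ n) (hm : m + 1 ≤ n)
    (L κ M f₀ Lf Lφ : ℝ) (hκ : 0 < κ) (hf₀ : 0 < f₀) : ∃ C : ℝ,
    ∀ (Ω : Set (Euc n)) (ρ u : Euc n → ℝ) (f φ : Euc n × ℝ → ℝ),
      Solution m Ω ρ u f φ L κ M f₀ Lf Lφ → ∀ p ∈ frontier Ω,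
        |∂ᵤ (∂ᵤ u) p (normalField ρ p) (normalField ρ p)| ≤ C := by
  obtain ⟨A, HA⟩ := exists_double_normal_absorption n m hn hm L κ M f₀ Lf Lφ hκ hf₀
  refine ⟨2 * A, fun Ω ρ u f φ h p hp => ?_⟩
  have hN : Continuous (normalField ρ) := h.dom.differentiable_normalField.continuous
  have hcont : ContinuousOn
      (fun y => |∂ᵤ (∂ᵤ u) y (normalField ρ y) (normalField ρ y)|) (frontier Ω) :=
    (((h.contDiffOn_D2.continuousOn.clm_apply hN.continuousOn).clm_apply
      hN.continuousOn).mono frontier_subset_closure).abs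
  obtain ⟨q, hq, hmax⟩ := (h.dom.isCompact_closure.of_isClosed_subset isClosed_frontier
    frontier_subset_closure).exists_isMaxOn ⟨p, hp⟩ hcont
  -- Mν is taken to be the maximum, attained at q, so the term Mν/2 is absorbed there.
  have h1 := HA Ω ρ u f φ h _ (abs_nonneg _) (fun y hy => hmax hy) q hq
  have h2 : |∂ᵤ (∂ᵤ u) p (normalField ρ p) (normalField ρ p)| ≤
      |∂ᵤ (∂ᵤ u) q (normalField ρ q) (normalField ρ q)| := hmax hp
  linarith

/-- In dimension one the equation itself bounds the second derivative. -/
lemma abs_D2_le_of_dim_one {Ω : Set (Euc 1)} {ρ u : Euc 1 → ℝ} {f φ : Euc 1 × ℝ → ℝ}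
    (h : Solution 0 Ω ρ u f φ L κ M f₀ Lf Lφ) {x e : Euc 1} (hx : x ∈ closure Ω) (he : ‖e‖ = 1) :
    |∂ᵤ (∂ᵤ u) x e e| ≤ Lf := by
  have hint : ∀ y ∈ Ω, ∂ᵤ (∂ᵤ u) y e e ∈ Icc (-Lf) Lf := by
    intro y hy
    obtain ⟨v, l, hv⟩ := h.exists_isEigenframe hy
    have hone : ∑ j, inner ℝ (v j) e ^ 2 = 1 := by
      have := v.sum_sq_norm_inner_right e
      simpa [he] using this
    have heq : ∂ᵤ (∂ᵤ u) y e e = f (y, u y) := by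
      rw [← hv.esym_eq, esym_one, hv.apply_eq_sum]
      simp only [Fin.sum_univ_one] at hone ⊢
      rw [hone, one_mul]
    rw [heq]
    exact abs_le.1 (h.norm_f_le (subset_closure hy)).1
  have hcont : ContinuousWithinAt (fun y => ∂ᵤ (∂ᵤ u) y e e) Ω x :=
    (((h.contDiffOn_D2.continuousOn.clm_apply continuousOn_const).clm_apply
      continuousOn_const) x hx).mono subset_closure
  exact abs_le.2 (closure_minimal (by rintro _ ⟨y, hy, rfl⟩; exact hint y hy) isClosed_Icc
    (hcont.mem_closure_image hx))

end Solution

end HessianNeumann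

theorem theorem4p5 (n k : ℕ) (hk : 1 ≤ k) (hkn : k ≤ n)
    (κ L M f₀ Lf Lφ : ℝ) (hκ : 0 < κ) (hf₀ : 0 < f₀) :
    ∃ C : ℝ, ∀ (Ω : Set (EuclideanSpace ℝ (Fin n))) (ρ u : EuclideanSpace ℝ (Fin n) → ℝ)
      (f φ : EuclideanSpace ℝ (Fin n) × ℝ → ℝ),
      -- the domain: bounded, uniformly convex, of class `C⁴`
      IsOpen Ω → Ω.Nonempty → Bornology.IsBounded Ω → Convex ℝ Ω →
      HessianNeumann.IsC4DefiningFunction Ω ρ L →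
      HessianNeumann.PrincipalCurvaturesGE Ω ρ κ →
      -- the data
      ContDiffOn ℝ 2 f (closure Ω ×ˢ (Set.univ : Set ℝ)) →
      (∀ x ∈ closure Ω, ∀ z : ℝ, 0 < f (x, z)) →
      ContDiffOn ℝ 3 φ (closure Ω ×ˢ (Set.univ : Set ℝ)) →
      (∀ x ∈ closure Ω, Antitone fun z : ℝ => φ (x, z)) →
      -- the solution
      ContDiffOn ℝ 4 u Ω → ContDiffOn ℝ 3 u (closure Ω) →
      HessianNeumann.IsAdmissible k Ω u →
      (∀ x ∈ Ω, HessianNeumann.sigma k (HessianNeumann.hessianEigenvalues u x) = f (x, u x)) →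
      (∀ x ∈ frontier Ω,
        fderivWithin ℝ u (closure Ω) x (HessianNeumann.outerNormal ρ x) = φ (x, u x)) →
      -- the quantities on which the constant depends
      HessianNeumann.CNormLE 1 u (closure Ω) (closure Ω) M →
      HessianNeumann.CNormLE 2 f (closure Ω ×ˢ (Set.univ : Set ℝ))
        (HessianNeumann.valueRange Ω u) Lf →
      (∀ p ∈ HessianNeumann.valueRange Ω u, f₀ ≤ f p) →
      HessianNeumann.CNormLE 3 φ (closure Ω ×ˢ (Set.univ : Set ℝ))
        (HessianNeumann.valueRange Ω u) Lφ →
      -- the double normal derivative bound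
      ∀ x ∈ frontier Ω,
        |iteratedFDerivWithin ℝ 2 u (closure Ω) x
          ![HessianNeumann.outerNormal ρ x, HessianNeumann.outerNormal ρ x]| ≤ C := by
  have key : ∃ C : ℝ, ∀ (Ω : Set (EuclideanSpace ℝ (Fin n)))
      (ρ u : EuclideanSpace ℝ (Fin n) → ℝ) (f φ : EuclideanSpace ℝ (Fin n) × ℝ → ℝ),
      HessianNeumann.Solution (k - 1) Ω ρ u f φ L κ M f₀ Lf Lφ → ∀ p ∈ frontier Ω,
        |HessianNeumann.D (closure Ω) (HessianNeumann.D (closure Ω) u) p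
          (HessianNeumann.normalField ρ p) (HessianNeumann.normalField ρ p)| ≤ C := by
    -- Dimension one is separate because the diameter bound turns the normal within a plane.
    rcases (hk.trans hkn).eq_or_lt with rfl | hn
    · obtain rfl : k = 1 := by omega
      exact ⟨Lf, fun Ω ρ u f φ h p hp =>
        h.abs_D2_le_of_dim_one (frontier_subset_closure hp) (h.dom.norm_normalField hp)⟩
    · exact HessianNeumann.Solution.exists_double_normal_bound n (k - 1) hn (by omega)
        L κ M f₀ Lf Lφ hκ hf₀
  obtain ⟨C, hC⟩ := key
  refine ⟨C, ?_⟩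
  intro Ω ρ u f φ hΩo hΩn hΩb hΩc hρ hcurv hf hfpos hφ hφanti hu hu' hadm heq hbd huM hfL hfl hφL
    x hx
  have hk1 : k - 1 + 1 = k := by omega
  have h : HessianNeumann.Solution (k - 1) Ω ρ u f φ L κ M f₀ Lf Lφ :=
    { dom := ⟨hΩo, hΩn, hΩb, hΩc, hρ, hcurv⟩
      f_contDiff := hf
      f_pos := hfpos
      φ_contDiff := hφ
      φ_anti := hφanti
      u_contDiff := hu
      u_contDiff' := hu'
      admissible := by rwa [hk1]
      equation := by rwa [hk1]
      boundary := hbd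
      u_norm := huM
      f_norm := hfL
      f_lower := hfl
      φ_norm := hφL }
  have h1 := hC Ω ρ u f φ h x hx
  rw [h.dom.normalField_eq_outerNormal hx] at h1
  rw [iteratedFDerivWithin_two_apply u h.uniqueDiffOn (frontier_subset_closure hx)]
  exact h1
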